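/- Let $\phi:\mathbb R\to[0,1]$ be $C^\infty$ with $\phi(\xi)=1$ for $|\xi|\le\frac12$ and $\phi(\xi)=0$ for $|\xi|>1$, and let $a:\mathbb R\to\mathbb R$ be an even $C^\infty$ function with $a^2(\xi)=\phi(\xi/2)-\phi(\xi)$ for all $\xi$; thus $a(\xi)=0$ unless $\frac12\le|\xi|\le2$. Let $X$ be a real, (jointly) measurable, finite-variance, isotropic random field on the torus $\mathbb R/2\pi\mathbb Z$ (its finite-dimensional laws are invariant under rotations), $$X(\vartheta)=\sum_{l\in\mathbb Z}w_l e^{il\vartheta},\qquad w_l=\frac1{2\pi}\int_{-\pi}^{\pi}X(\vartheta)e^{-il\vartheta}\,d\vartheta ,$$ with $w_0=0$ a.s., $E w_l=0$, $C_l:=E|w_l|^2$ and $\sum_l C_l<\infty$. Assume: * (A1) there are $\alpha>1$, constants $0<c_1\le c_2<\infty$ and $g$ with values in $[c_1,c_2]$ such that $C_l=g(l)\,l^{-\alpha}$ for $l=1,2,\dots$; * (B) $X$ is a Gaussian process. For $N=2^{j+2}$, $j\in\mathbb N$, put $\tau=\frac{2\pi}N$ and $$\psi_N(t)=\frac1{\sqrt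 N}\sum_{l\in\mathbb Z}a(\tfrac{4l}N)e^{ilt},\quad \beta_{Nk}=\frac1{2\pi}\int_{-\pi}^{\pi}X(\vartheta)\psi_N(\vartheta-k\tau)\,d\vartheta,\quad \sigma_N^2=\frac1N\sum_{N/8\le|l|\le N/2}C_l\,a^2(\tfrac{4l}N),\quad \widehat\beta_{Nk}=\frac{\beta_{Nk}}{\sigma_N},$$ $$S_N=\frac1{\sqrt N}\sum_{k=1}^N\widehat\beta_{Nk}^3,\qquad U_N=\frac1{\sqrt N}\sum_{k=1}^N(\widehat\beta_{Nk}^4-3).$$ Let $K_N(t)=\frac1{2\pi N}\bigl|\sum_{k=1}^Ne^{itk}\bigr|^2$, $\delta_{l_1\dots l_p}=E\bigl[\prod_{i=1}^p|w_{l_i}|^2/C_{l_i}\bigr]$, and $\widehat\sigma_N^2=\frac2N\sum_{N/8\le l\le N/2}|w_l|^2a^2(\frac{4l}N)$. For $p\ge1$ put $$F_{p,N}=\sum_{l_1,\dots,l_p}\frac1{\delta_{l_1\dots l_p}}\prod_{i=1}^p\Bigl(|w_{l_i}|^2a^2(\tfrac{4l_i}N)\Bigr)K_N\bigl(\tfrac{2\pi}N(l_1+\dots+l_p)\bigr),$$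 where each $l_i$ ranges over the integers with $N/8\le|l_i|\le N/2$, and define the variance estimators $$\widehat\sigma_{S_N}^2=\frac{12\pi}{N^3\widehat\sigma_N^6}F_{3,N},\qquad \widehat\sigma_{U_N}^2=\frac{72}{\widehat\sigma_N^4}\frac{2\pi}{N^2}F_{2,N}+\frac{24}{\widehat\sigma_N^8}\frac{2\pi}{N^4}F_{4,N}.$$ Then, as $N=2^{j+2}\to\infty$, $$\Bigl(\frac{S_N}{\widehat\sigma_{S_N}},\ \frac{U_N}{\widehat\sigma_{U_N}}\Bigr)\ \longrightarrow\ N(0,I_2)\quad\text{in distribution.}$$ -/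

import Mathlib

open MeasureTheory ProbabilityTheory Filter
open scoped Real Topology

noncomputable section

namespace Needlet

/-- The torus `ℝ / 2πℤ`; its normalized measure `AddCircle.haarAddCircle` is `dϑ / 2π`. -/
abbrev Torus : Type := AddCircle (2 * π)

instance factTwoPiPos : Fact (0 < 2 * π) := ⟨Real.two_pi_pos⟩

/-- The window function `a` of the needlet frame: `a` is even, smooth, and
`a² (ξ) = φ (ξ / 2) - φ (ξ)` for some smooth `φ` with values in `[0, 1]`, equal to `1` for
`|ξ| ≤ 1 / 2` and vanishing for `|ξ| > 1`. In particular `a (ξ) = 0` unless `1 / 2 ≤ |ξ| ≤ 2`. -/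
structure IsWindow (a : ℝ → ℝ) : Prop where
  smooth : ContDiff ℝ (⊤ : ℕ∞) a
  even : ∀ ξ, a (-ξ) = a ξ
  exists_cutoff : ∃ φ : ℝ → ℝ, ContDiff ℝ (⊤ : ℕ∞) φ ∧ (∀ ξ, 0 ≤ φ ξ ∧ φ ξ ≤ 1) ∧
    (∀ ξ, |ξ| ≤ 1 / 2 → φ ξ = 1) ∧ (∀ ξ, 1 < |ξ| → φ ξ = 0) ∧
    ∀ ξ, a ξ ^ 2 = φ (ξ / 2) - φ ξ

/-- The frequencies `l ∈ ℤ` with `N / 8 ≤ |l| ≤ N / 2`. Since `a (4 l / N) = 0` for every other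
`l`, sums over all `l ∈ ℤ` with a factor `a (4 l / N)` are sums over this finite set. -/
def freqs (N : ℕ) : Finset ℤ :=
  (Finset.Icc (-(N : ℤ)) N).filter fun l => (N : ℤ) ≤ 8 * |l| ∧ 2 * |l| ≤ N

/-- `ψ_N (t) = N^{-1/2} ∑_l a (4 l / N) e^{ilt}`, which is real because `a` is even. -/
def psi (a : ℝ → ℝ) (N : ℕ) (t : Torus) : ℝ :=
  (((1 / Real.sqrt N : ℝ) : ℂ) *
    ∑ l ∈ freqs N, ((a (4 * l / N) : ℝ) : ℂ) * fourier l t).re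

/-- Fejér's kernel `K_N (t) = (2πN)⁻¹ |∑_{k=1}^N e^{itk}|²`. -/
def fejer (N : ℕ) (t : ℝ) : ℝ :=
  1 / (2 * π * N) * ‖∑ k ∈ Finset.Icc 1 N, Complex.exp (Complex.I * t * k)‖ ^ 2

section Field

variable {Ω : Type*} [MeasurableSpace Ω]

/-- The Fourier coefficient `w_l = (2π)⁻¹ ∫ X (ϑ) e^{-ilϑ} dϑ` of the field. -/
def coeff (X : Torus → Ω → ℝ) (l : ℤ) (ω : Ω) : ℂ :=
  fourierCoeff (fun θ : Torus => (X θ ω : ℂ)) l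

/-- The angular power spectrum `C_l = E |w_l|²`. -/
def powerSpectrum (P : Measure Ω) (X : Torus → Ω → ℝ) (l : ℤ) : ℝ :=
  ∫ ω, ‖coeff X l ω‖ ^ 2 ∂P

/-- The model: a real, measurable, finite variance, isotropic (that is, all finite-dimensional laws
are invariant under rotations of the torus) random field `X (ϑ) = ∑_l w_l e^{ilϑ}` on the torus,
with `w_0 = 0`, `E w_l = 0` and `∑_l C_l < ∞`. (The paths of such a field are almost surely
in `L²`, so that they are the sums in `L²` of their Fourier series.) -/
structure IsIsotropicField (P : Measure Ω) (X : Torus → Ω → ℝ) : Prop where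
  measurable : Measurable fun p : Torus × Ω => X p.1 p.2
  memLp : ∀ θ, MemLp (X θ) 2 P
  isotropic : ∀ (h : Torus) (n : ℕ) (θ : Fin n → Torus),
    IdentDistrib (fun ω i => X (θ i + h) ω) (fun ω i => X (θ i) ω) P P
  coeff_zero : ∀ᵐ ω ∂P, coeff X 0 ω = 0
  mean_zero : ∀ l, ∫ ω, coeff X l ω ∂P = 0
  summable_spectrum : Summable (powerSpectrum P X)

/-- `C_l = g (l) l^{-α}` for `l = 1, 2, …`, where `α > 1` and `g` takes values in a compact
subinterval `[c₁, c₂]` of `(0, ∞)`. -/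
def PowerLawSpectrum (P : Measure Ω) (X : Torus → Ω → ℝ) : Prop :=
  ∃ (g : ℕ → ℝ) (c₁ c₂ α : ℝ), 0 < c₁ ∧ 1 < α ∧ (∀ l, 1 ≤ l → c₁ ≤ g l ∧ g l ≤ c₂) ∧
    ∀ l : ℕ, 1 ≤ l → powerSpectrum P X l = g l * (l : ℝ) ^ (-α)

/-- `β_{Nk} = (2π)⁻¹ ∫ X (ϑ) ψ_N (ϑ - k τ) dϑ`, with `τ = 2π / N`. -/
def beta (a : ℝ → ℝ) (X : Torus → Ω → ℝ) (N k : ℕ) (ω : Ω) : ℝ :=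
  ∫ θ : Torus, X θ ω * psi a N (θ - ((k * (2 * π / N) : ℝ) : Torus)) ∂AddCircle.haarAddCircle

/-- `σ_N² = N⁻¹ ∑_{N/8 ≤ |l| ≤ N/2} C_l a² (4 l / N)`. -/
def sigmaSq (a : ℝ → ℝ) (P : Measure Ω) (X : Torus → Ω → ℝ) (N : ℕ) : ℝ :=
  1 / N * ∑ l ∈ freqs N, powerSpectrum P X l * a (4 * l / N) ^ 2

/-- The normalized wavelet coefficient `β_{Nk} / σ_N`. -/
def betaHat (a : ℝ → ℝ) (P : Measure Ω) (X : Torus → Ω → ℝ) (N k : ℕ) (ω : Ω) : ℝ :=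
  beta a X N k ω / Real.sqrt (sigmaSq a P X N)

/-- The skewness statistic `S_N`. -/
def skewness (a : ℝ → ℝ) (P : Measure Ω) (X : Torus → Ω → ℝ) (N : ℕ) (ω : Ω) : ℝ :=
  1 / Real.sqrt N * ∑ k ∈ Finset.Icc 1 N, betaHat a P X N k ω ^ 3

/-- The kurtosis statistic `U_N`. -/
def kurtosis (a : ℝ → ℝ) (P : Measure Ω) (X : Torus → Ω → ℝ) (N : ℕ) (ω : Ω) : ℝ :=
  1 / Real.sqrt N * ∑ k ∈ Finset.Icc 1 N, (betaHat a P X N k ω ^ 4 - 3)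

/-- The estimator `σ̂_N² = (2 / N) ∑_{N/8 ≤ l ≤ N/2} |w_l|² a² (4 l / N)` (positive `l` only). -/
def sigmaSqEst (a : ℝ → ℝ) (X : Torus → Ω → ℝ) (N : ℕ) (ω : Ω) : ℝ :=
  2 / N * ∑ l ∈ (freqs N).filter (fun l => 0 < l), ‖coeff X l ω‖ ^ 2 * a (4 * l / N) ^ 2

/-- `δ_{l_1 … l_p} = E [∏_i |w_{l_i}|² / C_{l_i}]`. -/
def delta (P : Measure Ω) (X : Torus → Ω → ℝ) {p : ℕ} (l : Fin p → ℤ) : ℝ :=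
  ∫ ω, ∏ i, (‖coeff X (l i) ω‖ ^ 2 / powerSpectrum P X (l i)) ∂P

/-- `∑_{l_1 … l_p} δ_{l_1 … l_p}⁻¹ (∏_i |w_{l_i}|² a² (4 l_i / N)) K_N (2π (l_1 + … + l_p) / N)`. -/
def fejerSum (a : ℝ → ℝ) (P : Measure Ω) (X : Torus → Ω → ℝ) (p N : ℕ) (ω : Ω) : ℝ :=
  ∑ l ∈ Fintype.piFinset (fun _ : Fin p => freqs N),
    1 / delta P X l * (∏ i, ‖coeff X (l i) ω‖ ^ 2 * a (4 * l i / N) ^ 2) *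
      fejer N (2 * π / N * ((∑ i, l i : ℤ) : ℝ))

/-- The estimator `σ̂²_{S_N}` of the variance of the skewness. -/
def skewVarEst (a : ℝ → ℝ) (P : Measure Ω) (X : Torus → Ω → ℝ) (N : ℕ) (ω : Ω) : ℝ :=
  12 * π / (N ^ 3 * sigmaSqEst a X N ω ^ 3) * fejerSum a P X 3 N ω

/-- The estimator `σ̂²_{U_N} = σ̂²_{1U_N} + σ̂²_{2U_N}` of the variance of the kurtosis. -/
def kurtVarEst (a : ℝ → ℝ) (P : Measure Ω) (X : Torus → Ω → ℝ) (N : ℕ) (ω : Ω) : ℝ :=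
  72 / sigmaSqEst a X N ω ^ 2 * (2 * π / N ^ 2) * fejerSum a P X 2 N ω +
    24 / sigmaSqEst a X N ω ^ 4 * (2 * π / N ^ 4) * fejerSum a P X 4 N ω

/-- The studentized pair `(S_N / σ̂_{S_N}, U_N / σ̂_{U_N})`. -/
def studentized (a : ℝ → ℝ) (P : Measure Ω) (X : Torus → Ω → ℝ) (N : ℕ) (ω : Ω) :
    EuclideanSpace ℝ (Fin 2) :=
  !₂[skewness a P X N ω / Real.sqrt (skewVarEst a P X N ω),
    kurtosis a P X N ω / Real.sqrt (kurtVarEst a P X N ω)]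

end Field

end Needlet

end

open MeasureTheory ProbabilityTheory Filter
open scoped Real Topology

set_option linter.unusedSectionVars false

/-! The frequencies in play satisfy `N / 8 ≤ |l| ≤ N / 2`, so none is a multiple of `N` and the
wavelet coefficients sum to zero over the grid. Hence the cubes in the skewness may be replaced by
Hermite polynomials `H₃`. A combination `x S_N + y U_N` then equals `G = N^{-1/2} ∑ p (β̂_k)` with
`p = x H₃ + y (X⁴ - 3)`, a sum over a centred Gaussian vector with unit variances and correlations
`ρ_{kl}`.

Central limit theorem, by Stein's method. If `X q - q' = p`, Gaussian integration by parts gives `E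
[G e^{isG}] = i s E [Γ e^{isG}]` with `Γ = N⁻¹ ∑ ρ_{kl} q (β̂_k) p' (β̂_l)`
(`integral_addStat_mul_cexp`), and this forces `|E e^{iG} - e^{-v/2}| ≤ E |Γ - v|`
(`norm_integral_cexp_sub_le`). Take `v = E Γ = 6 x² R₃ + y² (72 R₂ + 24 R₄)`, where `R_p = N⁻¹ ∑
ρ_{kl}^p`. A Poincaré inequality gives `Var Γ = O(N^{-1/2})` (`variance_formStat_le`), because the
covariance operator is bounded; this in turn holds because the power law makes the normalized
spectral weights uniformly bounded (`exists_hasSpectralBounds`). The estimate is uniform over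
bounded `x`, `y`, so the `R_p` need not converge.

Estimators. At the points `2πm / N` Fejér's kernel vanishes unless `N ∣ m`, so `F_{p,N}` runs over
tuples whose sum is a multiple of `N`; expanding `ρ^p` in characters gives `R_p` as a sum over the
same tuples (`sum_corr_pow`). Division by `δ` makes the estimator of `R_p` unbiased once `σ̂_N` is
replaced by `σ_N`. The variables `|w_l|² / C_l` are independent for distinct `|l|`, with bounded
moments, so only pairs of tuples sharing a frequency contribute to the variance, and these are a
fraction `O(1/N)` of all pairs (`variance_sum_prod_le`, `sum_share_le`). Likewise `σ̂_N² / σ_N² →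
1`.

Relative consistency also needs the `R_p` bounded below: for even `p` the diagonal suffices, while
`R₃` needs many resonant triples `(l, m, -l-m)` on which the window is not small
(`le_corrPower_three`). Slutsky's theorem concludes. -/

namespace Needlet

/-! ### Functions of polynomial growth; integration by parts and the Poincaré inequality by
rotation. -/

section GaussianCalculus

/-- `f` is bounded by a polynomial in the norm. -/
def PolyGrowth {E F : Type*} [NormedAddCommGroup E] [NormedAddCommGroup F] (f : E → F) : Prop :=
  ∃ (C : ℝ) (m : ℕ), ∀ x, ‖f x‖ ≤ C * (1 + ‖x‖) ^ m

namespace PolyGrowth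

variable {E E' F : Type*} [NormedAddCommGroup E] [NormedAddCommGroup E'] [NormedAddCommGroup F]

lemma exists_nonneg {f : E → F} (hf : PolyGrowth f) :
    ∃ (C : ℝ) (m : ℕ), 0 ≤ C ∧ ∀ x, ‖f x‖ ≤ C * (1 + ‖x‖) ^ m := by
  obtain ⟨C, m, h⟩ := hf
  refine ⟨|C|, m, abs_nonneg _, fun x => (h x).trans ?_⟩
  gcongr
  exact le_abs_self C

lemma const (c : F) : PolyGrowth (fun _ : E => c) := ⟨‖c‖, 0, by simp⟩

lemma of_norm_le {f : E → F} {F' : Type*} [NormedAddCommGroup F'] {g : E → F'}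
    (hg : PolyGrowth g) (h : ∀ x, ‖f x‖ ≤ ‖g x‖) : PolyGrowth f := by
  obtain ⟨C, m, hC⟩ := hg
  exact ⟨C, m, fun x => (h x).trans (hC x)⟩

lemma add {f g : E → F} (hf : PolyGrowth f) (hg : PolyGrowth g) :
    PolyGrowth (fun x => f x + g x) := by
  obtain ⟨C, m, hC, hf⟩ := hf.exists_nonneg
  obtain ⟨D, n, hD, hg⟩ := hg.exists_nonneg
  refine ⟨C + D, m + n, fun x => (norm_add_le _ _).trans ?_⟩
  have h1 : (1 : ℝ) ≤ 1 + ‖x‖ := by linarith [norm_nonneg x]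
  have h2 : (1 + ‖x‖) ^ m ≤ (1 + ‖x‖) ^ (m + n) := pow_le_pow_right₀ h1 (by lia)
  have h3 : (1 + ‖x‖) ^ n ≤ (1 + ‖x‖) ^ (m + n) := pow_le_pow_right₀ h1 (by lia)
  rw [add_mul]
  exact add_le_add ((hf x).trans (by gcongr)) ((hg x).trans (by gcongr))

lemma mul {R : Type*} [NormedRing R] {f g : E → R} (hf : PolyGrowth f) (hg : PolyGrowth g) :
    PolyGrowth (fun x => f x * g x) := by
  obtain ⟨C, m, hC, hf⟩ := hf.exists_nonneg
  obtain ⟨D, n, hD, hg⟩ := hg.exists_nonneg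
  refine ⟨C * D, m + n, fun x => (norm_mul_le _ _).trans ?_⟩
  calc ‖f x‖ * ‖g x‖ ≤ (C * (1 + ‖x‖) ^ m) * (D * (1 + ‖x‖) ^ n) := by
        gcongr
        · exact hf x
        · exact hg x
    _ = _ := by ring

lemma neg {f : E → F} (hf : PolyGrowth f) : PolyGrowth (fun x => - f x) :=
  hf.of_norm_le (by simp)

lemma sub {f g : E → F} (hf : PolyGrowth f) (hg : PolyGrowth g) :
    PolyGrowth (fun x => f x - g x) := by
  simpa [sub_eq_add_neg] using hf.add hg.neg

lemma pow {f : E → ℝ} (hf : PolyGrowth f) (n : ℕ) : PolyGrowth (fun x => f x ^ n) := by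
  induction n with
  | zero => simpa using const 1
  | succ n ih => simpa [pow_succ] using ih.mul hf

lemma sum {ι : Type*} (s : Finset ι) {f : ι → E → F} (hf : ∀ i ∈ s, PolyGrowth (f i)) :
    PolyGrowth (fun x => ∑ i ∈ s, f i x) := by
  classical
  induction s using Finset.induction_on with
  | empty => simpa using const 0
  | insert i s his ih =>
    simp_rw [Finset.sum_insert his]
    exact (hf i (by simp)).add (ih fun j hj => hf j (by simp [hj]))

lemma comp {f : E → F} {g : E' → E} (hf : PolyGrowth f) (hg : PolyGrowth g) :
    PolyGrowth (fun x => f (g x)) := by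
  obtain ⟨C, m, hC, hf⟩ := hf.exists_nonneg
  obtain ⟨D, n, hD, hg⟩ := hg.exists_nonneg
  refine ⟨C * (1 + D) ^ m, n * m, fun x => (hf _).trans ?_⟩
  have h1 : (1 : ℝ) ≤ (1 + ‖x‖) ^ n := one_le_pow₀ (by linarith [norm_nonneg x])
  rw [pow_mul, mul_assoc, ← mul_pow]
  gcongr
  nlinarith [hg x]

lemma id : PolyGrowth (fun x : E => x) := ⟨1, 1, by simp⟩

lemma clm [NormedSpace ℝ E] [NormedSpace ℝ F] (L : E →L[ℝ] F) : PolyGrowth (fun x => L x) :=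
  ⟨‖L‖, 1, fun x => (L.le_opNorm x).trans (by gcongr; simp)⟩

lemma fst : PolyGrowth (fun p : E × E' => p.1) := id.of_norm_le fun p => norm_fst_le p

lemma snd : PolyGrowth (fun p : E × E' => p.2) := id.of_norm_le fun p => norm_snd_le p

lemma eval {ι : Type*} [Fintype ι] (i : ι) : PolyGrowth (fun x : ι → ℝ => x i) :=
  id.of_norm_le fun x => norm_le_pi_norm x i

lemma polynomial (p : Polynomial ℝ) : PolyGrowth (fun x : ℝ => p.eval x) := by
  induction p using Polynomial.induction_on' with
  | add p q hp hq => simpa using hp.add hq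
  | monomial n a => simpa using (const a).mul (id.pow n)

lemma ofReal {f : E → ℝ} (hf : PolyGrowth f) : PolyGrowth (fun x => (f x : ℂ)) :=
  hf.of_norm_le (by simp)

variable [NormedSpace ℝ E] [CompleteSpace E] [SecondCountableTopology E] [MeasurableSpace E]
  [BorelSpace E] {μ : Measure E} [IsGaussian μ]

/-- Gaussian measures have moments of all orders. Since the class is closed under the algebraic
operations above, every integrability condition below reduces to polynomial growth and
measurability. -/
lemma integrable {f : E → F} (hf : PolyGrowth f) (hm : AEStronglyMeasurable f μ) :
    Integrable f μ := by
  obtain ⟨C, m, h⟩ := hf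
  have h1 : Integrable (fun x : E => (1 + ‖x‖) ^ m) μ := by
    have h0 : MemLp (fun x : E => ‖x‖) m μ := (IsGaussian.memLp_id μ m (by simp)).norm
    have h1 : MemLp (fun _ : E => (1 : ℝ)) m μ := memLp_const 1
    have h2 : MemLp (fun x : E => 1 + ‖x‖) m μ := h1.add h0
    refine (h2.integrable_norm_pow').congr (ae_of_all _ fun x => ?_)
    simp only [Real.norm_eq_abs]
    rw [abs_of_nonneg (by positivity)]
  exact (h1.const_mul C).mono' hm (ae_of_all _ h)

lemma integrable_of_continuous [SecondCountableTopologyEither E F] {f : E → F}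
    (hf : PolyGrowth f) (hm : Continuous f) : Integrable f μ :=
  hf.integrable hm.aestronglyMeasurable

end PolyGrowth

variable {E : Type*} [NormedAddCommGroup E] [NormedSpace ℝ E] [CompleteSpace E]
  [SecondCountableTopology E] [MeasurableSpace E] [BorelSpace E] {μ : Measure E} [IsGaussian μ]

omit [CompleteSpace E] [SecondCountableTopology E] [MeasurableSpace E] [BorelSpace E] in
lemma norm_rotation_le (t : ℝ) (p : E × E) : ‖ContinuousLinearMap.rotation t p‖ ≤ 2 * ‖p‖ := by
  have h1 := norm_fst_le p
  have h2 := norm_snd_le p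
  have hc : |Real.cos t| ≤ 1 := Real.abs_cos_le_one t
  have hs : |Real.sin t| ≤ 1 := Real.abs_sin_le_one t
  have key : ∀ a b : ℝ, |a| ≤ 1 → |b| ≤ 1 → ‖a • p.1 + b • p.2‖ ≤ 2 * ‖p‖ := by
    intro a b ha hb
    refine (norm_add_le _ _).trans ?_
    rw [norm_smul, norm_smul, Real.norm_eq_abs, Real.norm_eq_abs]
    nlinarith [norm_nonneg p.1, norm_nonneg p.2]
  rw [ContinuousLinearMap.rotation_apply, Prod.norm_def]
  refine max_le (key _ _ hc hs) ?_
  exact key _ _ (by simpa using hs) hc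

lemma integral_comp_rotation {F : Type*} [NormedAddCommGroup F] [NormedSpace ℝ F]
    (hμ : μ[id] = 0) (t : ℝ) {f : E × E → F} (hf : Continuous f) [SecondCountableTopology F] :
    ∫ p, f (ContinuousLinearMap.rotation t p) ∂(μ.prod μ) = ∫ p, f p ∂(μ.prod μ) := by
  conv_rhs => rw [← IsGaussian.map_rotation_eq_self hμ t]
  rw [integral_map (by fun_prop) hf.aestronglyMeasurable]

omit [CompleteSpace E] [SecondCountableTopology E] [MeasurableSpace E] [BorelSpace E] in
-- The velocity of the first component is the second component. So the derivative of `f` of the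
-- first component along the rotation is `df` evaluated at the rotated pair, whose law under `μ.prod
-- μ` does not depend on the angle when `μ` is centred. Both theorems of this section rest on this.
lemma hasDerivAt_rotation_fst (p : E × E) (t : ℝ) :
    HasDerivAt (fun s => (ContinuousLinearMap.rotation s p).1)
      (ContinuousLinearMap.rotation t p).2 t := by
  simp only [ContinuousLinearMap.rotation_apply]
  exact ((Real.hasDerivAt_cos t).smul_const p.1).add ((Real.hasDerivAt_sin t).smul_const p.2)

omit [CompleteSpace E] [SecondCountableTopology E] [MeasurableSpace E] [BorelSpace E] in
lemma continuous_rotation {T : Type*} [TopologicalSpace T] {θ : T → ℝ} {u : T → E × E}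
    (hθ : Continuous θ) (hu : Continuous u) :
    Continuous fun q => ContinuousLinearMap.rotation (θ q) (u q) := by
  simp only [ContinuousLinearMap.rotation_apply]
  fun_prop

/-- `dG (x, y)` is the derivative of `G` at `x` in the direction `y`. -/
def HasCurveDeriv {F : Type*} [NormedAddCommGroup F] [NormedSpace ℝ F] (G : E → F)
    (dG : E × E → F) : Prop :=
  ∀ (c : ℝ → E) (c' : E) (t : ℝ), HasDerivAt c c' t →
    HasDerivAt (fun s => G (c s)) (dG (c t, c')) t

/-- Gaussian integration by parts. -/
theorem integral_dual_mul (hμ : μ[id] = 0) (L : StrongDual ℝ E) {G : E → ℂ} {dG : E × E → ℂ}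
    (hGc : Continuous G) (hdGc : Continuous dG) (hG : PolyGrowth G) (hdG : PolyGrowth dG)
    (hderiv : HasCurveDeriv G dG) :
    ∫ x, (L x : ℂ) * G x ∂μ = ∫ p, (L p.2 : ℂ) * dG p ∂(μ.prod μ) := by
  obtain ⟨C, m, hC, hdG'⟩ := hdG.exists_nonneg
  set R := fun (t : ℝ) (p : E × E) => ContinuousLinearMap.rotation t p with hR
  have hRc : ∀ t, Continuous (R t) := fun t => by fun_prop
  have hL1 : ∫ x, (L x : ℂ) ∂μ = 0 := by
    have : μ[L] = 0 := by rw [IsGaussian.integral_dual L]; simp at hμ; simp [hμ]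
    rw [integral_complex_ofReal, this]; simp
  -- The expectation of `L y` times `G` of the first component of the rotated pair, differentiated
  -- at angle `0` under the integral, gives the right side of the claim.
  have hd := (hasDerivAt_integral_of_dominated_loc_of_deriv_le (μ := μ.prod μ)
    (F := fun (t : ℝ) p => (L p.2 : ℂ) * G (R t p).1)
    (F' := fun (t : ℝ) p => (L p.2 : ℂ) * dG (R t p)) (s := Set.univ) (x₀ := 0)
    (bound := fun p => ‖L p.2‖ * (C * (1 + 2 * ‖p‖) ^ m)) Filter.univ_mem
    (Eventually.of_forall fun t => by
      have := hRc t
      exact Continuous.aestronglyMeasurable (by fun_prop))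
    (by
      apply PolyGrowth.integrable_of_continuous
      · exact ((PolyGrowth.clm L).comp PolyGrowth.snd).ofReal.mul
          (hG.comp (PolyGrowth.fst.comp (PolyGrowth.clm _)))
      · fun_prop)
    (by have := hRc 0
        exact Continuous.aestronglyMeasurable (by fun_prop))
    (ae_of_all _ fun p t _ => by
      rw [norm_mul, Complex.norm_real]
      gcongr
      refine (hdG' _).trans ?_
      gcongr
      exact norm_rotation_le t p)
    (by
      apply PolyGrowth.integrable_of_continuous
      · refine (((PolyGrowth.clm L).comp PolyGrowth.snd).of_norm_le (by simp)).mul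
          ((PolyGrowth.const C).mul (PolyGrowth.pow ?_ m))
        exact (PolyGrowth.const 1).add
          ((PolyGrowth.const 2).mul (PolyGrowth.id.of_norm_le (by simp)))
      · fun_prop)
    (ae_of_all _ fun p t _ => by
      refine HasDerivAt.const_mul _ ?_
      exact hderiv _ _ t (hasDerivAt_rotation_fst p t))).2
  have hrot0 : ∀ p : E × E, R 0 p = p := by intro p; simp [hR, ContinuousLinearMap.rotation_apply]
  simp only [hrot0] at hd
  have hint1 : Integrable (fun p : E × E => (L p.1 : ℂ) * G p.1) (μ.prod μ) :=
    PolyGrowth.integrable_of_continuous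
      (((PolyGrowth.clm L).comp PolyGrowth.fst).ofReal.mul (hG.comp PolyGrowth.fst)) (by fun_prop)
  have hint2 : Integrable (fun p : E × E => G p.1 * (L p.2 : ℂ)) (μ.prod μ) :=
    PolyGrowth.integrable_of_continuous
      ((hG.comp PolyGrowth.fst).mul ((PolyGrowth.clm L).comp PolyGrowth.snd).ofReal) (by fun_prop)
  -- The same expectation computed by rotating back: `y` becomes `sin t` times the first plus `cos
  -- t` times the second new component, and the second contributes nothing by independence and `E L
  -- = 0`. The derivative at `0` is now the left side of the claim.
  have hval : ∀ t, ∫ p, (L p.2 : ℂ) * G (R t p).1 ∂(μ.prod μ)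
      = Real.sin t * ∫ x, (L x : ℂ) * G x ∂μ := by
    intro t
    have h1 : ∀ p : E × E, (L p.2 : ℂ) * G (R t p).1 =
        (fun q : E × E => (Real.sin t : ℂ) * ((L q.1 : ℂ) * G q.1) +
          (Real.cos t : ℂ) * (G q.1 * (L q.2 : ℂ))) (R t p) := by
      intro p
      have : L p.2 = Real.sin t * L (R t p).1 + Real.cos t * L (R t p).2 := by
        simp only [hR, ContinuousLinearMap.rotation_apply, map_add, map_smul, smul_eq_mul]
        linear_combination (-L p.2) * Real.sin_sq_add_cos_sq t
      simp only
      rw [this]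
      push_cast
      ring
    simp_rw [h1]
    simp only [hR]
    rw [integral_comp_rotation hμ t (f := fun q : E × E =>
      (Real.sin t : ℂ) * ((L q.1 : ℂ) * G q.1) + (Real.cos t : ℂ) * (G q.1 * (L q.2 : ℂ)))
      (by fun_prop), integral_add (hint1.const_mul _) (hint2.const_mul _),
      integral_const_mul, integral_const_mul, integral_prod_mul G (fun x => (L x : ℂ)), hL1]
    have := integral_prod_mul (μ := μ) (ν := μ) (fun x => (L x : ℂ) * G x) (fun _ => (1 : ℂ))
    simp only [mul_one, integral_const, probReal_univ, one_smul] at this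
    rw [this]
    simp
  simp_rw [hval] at hd
  have hs : HasDerivAt (fun t : ℝ => (Real.sin t : ℂ) * ∫ x, (L x : ℂ) * G x ∂μ)
      ((Real.cos 0 : ℂ) * ∫ x, (L x : ℂ) * G x ∂μ) 0 :=
    (Real.hasDerivAt_sin 0).ofReal_comp.mul_const _
  simpa using hs.unique hd

lemma sq_intervalIntegral_le {g : ℝ → ℝ} (hg : Continuous g) {T : ℝ} (hT : 0 < T) :
    (∫ t in 0..T, g t) ^ 2 ≤ T * ∫ t in 0..T, g t ^ 2 := by
  set c := (∫ t in 0..T, g t) / T with hc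
  have h : 0 ≤ ∫ t in 0..T, (g t - c) ^ 2 :=
    intervalIntegral.integral_nonneg hT.le fun t _ => sq_nonneg _
  have h2 : ∫ t in 0..T, (g t - c) ^ 2 =
      (∫ t in 0..T, g t ^ 2) - 2 * c * (∫ t in 0..T, g t) + T * c ^ 2 := by
    have : ∀ t, (g t - c) ^ 2 = g t ^ 2 - 2 * c * g t + c ^ 2 := fun t => by ring
    simp_rw [this]
    rw [intervalIntegral.integral_add, intervalIntegral.integral_sub,
      intervalIntegral.integral_const_mul, intervalIntegral.integral_const]
    · simp
    all_goals exact Continuous.intervalIntegrable (by fun_prop) _ _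
  have h3 : ∫ t in 0..T, g t = c * T := by rw [hc]; field_simp
  rw [h2, h3] at h
  rw [h3]
  nlinarith

/-- A Poincaré inequality for Gaussian measures, by rotation. -/
theorem integral_sq_sub_le (hμ : μ[id] = 0) {f : E → ℝ} {df : E × E → ℝ}
    (hfc : Continuous f) (hdfc : Continuous df) (hf : PolyGrowth f) (hdf : PolyGrowth df)
    (hderiv : HasCurveDeriv f df) :
    ∫ p, (f p.1 - f p.2) ^ 2 ∂(μ.prod μ) ≤ (π / 2) ^ 2 * ∫ p, df p ^ 2 ∂(μ.prod μ) := by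
  obtain ⟨C, m, hC, hdf'⟩ := hdf.exists_nonneg
  -- A quarter turn carries the first component from `x` to `y`, so `f y - f x` is the integral of
  -- `df` along it. Cauchy–Schwarz costs one factor `π / 2`; the length of the interval gives the
  -- other after Fubini and rotation invariance.
  have hpt : ∀ p : E × E, (f p.1 - f p.2) ^ 2 ≤ π / 2 * ∫ t in 0..(π / 2), df (ContinuousLinearMap.rotation t p) ^ 2 := by
    intro p
    have hcont : Continuous fun t : ℝ => df (ContinuousLinearMap.rotation t p) :=
      hdfc.comp (continuous_rotation continuous_id continuous_const)
    have h1 : ∫ t in 0..(π / 2), df (ContinuousLinearMap.rotation t p) = f p.2 - f p.1 := by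
      have := intervalIntegral.integral_eq_sub_of_hasDerivAt (a := 0) (b := π / 2)
        (f := fun t => f (ContinuousLinearMap.rotation t p).1) (f' := fun t => df (ContinuousLinearMap.rotation t p))
        (fun t _ => hderiv _ _ t (hasDerivAt_rotation_fst p t)) (hcont.intervalIntegrable _ _)
      rw [this]
      simp [ContinuousLinearMap.rotation_apply]
    calc (f p.1 - f p.2) ^ 2 = (∫ t in 0..(π / 2), df (ContinuousLinearMap.rotation t p)) ^ 2 := by rw [h1]; ring
      _ ≤ _ := sq_intervalIntegral_le hcont (by positivity)
  have hint : Integrable (fun q : (E × E) × ℝ => df (ContinuousLinearMap.rotation q.2 q.1) ^ 2)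
      ((μ.prod μ).prod (volume.restrict (Set.Ioc 0 (π / 2)))) := by
    have hb : Integrable (fun p : E × E => (C * (1 + 2 * ‖p‖) ^ m) ^ 2) (μ.prod μ) := by
      apply PolyGrowth.integrable_of_continuous
      · refine PolyGrowth.pow ((PolyGrowth.const C).mul (PolyGrowth.pow ?_ m)) 2
        exact (PolyGrowth.const 1).add
          ((PolyGrowth.const 2).mul (PolyGrowth.id.of_norm_le (by simp)))
      · fun_prop
    have hb2 := hb.mul_prod (integrable_const (1 : ℝ) (μ := volume.restrict (Set.Ioc 0 (π / 2))))
    refine hb2.mono' ?_ (ae_of_all _ fun q => ?_)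
    · exact ((hdfc.comp (continuous_rotation continuous_snd continuous_fst)).pow
        2).aestronglyMeasurable
    · rw [norm_pow, mul_one]
      gcongr
      refine (hdf' _).trans ?_
      gcongr
      exact norm_rotation_le _ _
  calc ∫ p, (f p.1 - f p.2) ^ 2 ∂(μ.prod μ)
      ≤ ∫ p, (π / 2 * ∫ t in 0..(π / 2), df (ContinuousLinearMap.rotation t p) ^ 2) ∂(μ.prod μ) := by
        refine integral_mono ?_ ?_ hpt
        · exact PolyGrowth.integrable_of_continuous
            (((hf.comp PolyGrowth.fst).sub (hf.comp PolyGrowth.snd)).pow 2) (by fun_prop)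
        · simp_rw [intervalIntegral.integral_of_le (by positivity : (0 : ℝ) ≤ π / 2)]
          exact hint.integral_prod_left.const_mul _
    _ = π / 2 * ∫ t in 0..(π / 2), ∫ p, df (ContinuousLinearMap.rotation t p) ^ 2 ∂(μ.prod μ) := by
        rw [integral_const_mul]
        simp_rw [intervalIntegral.integral_of_le (by positivity : (0 : ℝ) ≤ π / 2)]
        rw [integral_integral_swap hint]
    _ = _ := by
        have : ∀ t, ∫ p, df (ContinuousLinearMap.rotation t p) ^ 2 ∂(μ.prod μ) = ∫ p, df p ^ 2 ∂(μ.prod μ) := fun t =>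
          integral_comp_rotation hμ t (f := fun p => df p ^ 2) (by fun_prop)
        simp_rw [this]
        rw [intervalIntegral.integral_const]
        simp
        ring

end GaussianCalculus

/-! ### Integration by parts in coordinates and the Stein identity for additive statistics. -/

section GaussianVector

variable {ι : Type*} [Fintype ι] {μ : Measure (ι → ℝ)} [IsGaussian μ]

lemma hasCurveDeriv_eval (k : ι) (f : Polynomial ℝ) :
    HasCurveDeriv (fun x : ι → ℝ => f.eval (x k)) (fun p => f.derivative.eval (p.1 k) * p.2 k) := by
  intro c c' t hc
  exact (f.hasDerivAt (c t k)).comp t (hasDerivAt_pi.1 hc k)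

/-- Gaussian integration by parts in coordinates. -/
theorem integral_eval_mul (hμ : μ[id] = 0) (k : ι) {G : (ι → ℝ) → ℂ} {D : ι → (ι → ℝ) → ℂ}
    (hGc : Continuous G) (hG : PolyGrowth G) (hDc : ∀ l, Continuous (D l))
    (hD : ∀ l, PolyGrowth (D l))
    (hderiv : HasCurveDeriv G fun p => ∑ l, D l p.1 * (p.2 l : ℂ)) :
    ∫ x, (x k : ℂ) * G x ∂μ = ∑ l, ((∫ x, x k * x l ∂μ : ℝ) : ℂ) * ∫ x, D l x ∂μ := by
  have h := integral_dual_mul hμ (ContinuousLinearMap.proj (R := ℝ) (φ := fun _ : ι => ℝ) k)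
    (G := G) (dG := fun p => ∑ l, D l p.1 * (p.2 l : ℂ)) hGc (by fun_prop) hG
    (PolyGrowth.sum _ fun l _ => ((hD l).comp PolyGrowth.fst).mul
      ((PolyGrowth.eval l).comp PolyGrowth.snd).ofReal) hderiv
  simp only [ContinuousLinearMap.proj_apply] at h
  rw [h]
  have : ∀ p : (ι → ℝ) × (ι → ℝ), (p.2 k : ℂ) * ∑ l, D l p.1 * (p.2 l : ℂ) =
      ∑ l, D l p.1 * ((p.2 k * p.2 l : ℝ) : ℂ) := by
    intro p
    rw [Finset.mul_sum]
    refine Finset.sum_congr rfl fun l _ => ?_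
    push_cast
    ring
  simp_rw [this]
  rw [integral_finsetSum]
  · refine Finset.sum_congr rfl fun l _ => ?_
    rw [integral_prod_mul (D l) (fun y : ι → ℝ => ((y k * y l : ℝ) : ℂ)), integral_complex_ofReal, mul_comm]
  · intro l _
    apply PolyGrowth.integrable_of_continuous
    · exact ((hD l).comp PolyGrowth.fst).mul
        (((PolyGrowth.eval k).mul (PolyGrowth.eval l)).comp PolyGrowth.snd).ofReal
    · have := hDc l
      fun_prop

lemma polyGrowth_eval_comp (k : ι) (f : Polynomial ℝ) :
    PolyGrowth (fun x : ι → ℝ => f.eval (x k)) :=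
  (PolyGrowth.polynomial f).comp (PolyGrowth.eval k)

open Polynomial in
/-- Integration by parts for products of polynomials of two coordinates. -/
lemma integral_X_mul_eval_mul_eval (hμ : μ[id] = 0) (k l : ι) (f g : ℝ[X]) :
    ∫ x, (X * f).eval (x k) * g.eval (x l) ∂μ =
      (∫ x, x k * x k ∂μ) * (∫ x, f.derivative.eval (x k) * g.eval (x l) ∂μ) +
      (∫ x, x k * x l ∂μ) * ∫ x, f.eval (x k) * g.derivative.eval (x l) ∂μ := by
  classical
  have h := integral_eval_mul hμ k
    (G := fun x => ((f.eval (x k) * g.eval (x l) : ℝ) : ℂ))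
    (D := fun m x => (if m = k then ((f.derivative.eval (x k) * g.eval (x l) : ℝ) : ℂ) else 0) +
      (if m = l then ((f.eval (x k) * g.derivative.eval (x l) : ℝ) : ℂ) else 0))
    (by fun_prop)
    ((polyGrowth_eval_comp k f).mul (polyGrowth_eval_comp l g)).ofReal
    (fun m => by
      split_ifs <;> fun_prop)
    (fun m => by
      refine PolyGrowth.add ?_ ?_
      · split_ifs
        · exact ((polyGrowth_eval_comp k _).mul (polyGrowth_eval_comp l _)).ofReal
        · exact PolyGrowth.const 0
      · split_ifs
        · exact ((polyGrowth_eval_comp k _).mul (polyGrowth_eval_comp l _)).ofReal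
        · exact PolyGrowth.const 0)
    (by
      intro c c' t hc
      have h1 := (hasCurveDeriv_eval k f c c' t hc).mul (hasCurveDeriv_eval l g c c' t hc)
      refine h1.ofReal_comp.congr_deriv ?_
      simp only [add_mul, Finset.sum_add_distrib, ite_mul, zero_mul, Finset.sum_ite_eq',
        Finset.mem_univ, if_true]
      push_cast
      ring)
  have hint : ∀ f g : ℝ[X], Integrable (fun x : ι → ℝ => ((f.eval (x k) * g.eval (x l) : ℝ) : ℂ)) μ :=
    fun f g => PolyGrowth.integrable_of_continuous
      ((polyGrowth_eval_comp k f).mul (polyGrowth_eval_comp l g)).ofReal (by fun_prop)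
  have h2 : ∀ m, ∫ x, ((if m = k then ((f.derivative.eval (x k) * g.eval (x l) : ℝ) : ℂ) else 0) +
      (if m = l then ((f.eval (x k) * g.derivative.eval (x l) : ℝ) : ℂ) else 0)) ∂μ =
      (if m = k then ((∫ x, f.derivative.eval (x k) * g.eval (x l) ∂μ : ℝ) : ℂ) else 0) +
      (if m = l then ((∫ x, f.eval (x k) * g.derivative.eval (x l) ∂μ : ℝ) : ℂ) else 0) := by
    intro m
    rw [integral_add]
    · congr 1
      · split_ifs
        · rw [integral_complex_ofReal]
        · simp
      · split_ifs
        · rw [integral_complex_ofReal]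
        · simp
    · split_ifs
      · exact hint _ _
      · exact integrable_zero _ _ _
    · split_ifs
      · exact hint _ _
      · exact integrable_zero _ _ _
  simp_rw [h2] at h
  simp only [mul_add, Finset.sum_add_distrib, mul_ite, mul_zero, Finset.sum_ite_eq',
        Finset.mem_univ, if_true] at h
  apply Complex.ofReal_injective
  rw [← integral_complex_ofReal]
  simp only [eval_mul, eval_X]
  push_cast at h ⊢
  rw [← h]
  congr 1
  ext x
  ring

/-- The normalized sum `c ∑ p (x_k)`. -/
def addStat (c : ℝ) (p : Polynomial ℝ) (x : ι → ℝ) : ℝ := c * ∑ k, p.eval (x k)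

lemma continuous_addStat (c : ℝ) (p : Polynomial ℝ) :
    Continuous (addStat c p : (ι → ℝ) → ℝ) := by
  unfold addStat
  fun_prop

lemma polyGrowth_addStat (c : ℝ) (p : Polynomial ℝ) :
    PolyGrowth (addStat c p : (ι → ℝ) → ℝ) :=
  (PolyGrowth.const c).mul (PolyGrowth.sum _ fun k _ => polyGrowth_eval_comp k p)

/-- The form `c² ∑ ρ_{kl} q (x_k) r (x_l)`. -/
def formStat (c : ℝ) (ρ : ι → ι → ℝ) (q r : Polynomial ℝ) (x : ι → ℝ) : ℝ :=
  c ^ 2 * ∑ k, ∑ l, ρ k l * (q.eval (x k) * r.eval (x l))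

lemma continuous_formStat (c : ℝ) (ρ : ι → ι → ℝ) (q r : Polynomial ℝ) :
    Continuous (formStat c ρ q r : (ι → ℝ) → ℝ) := by
  unfold formStat
  fun_prop

lemma polyGrowth_formStat (c : ℝ) (ρ : ι → ι → ℝ) (q r : Polynomial ℝ) :
    PolyGrowth (formStat c ρ q r : (ι → ℝ) → ℝ) :=
  (PolyGrowth.const _).mul (PolyGrowth.sum _ fun k _ => PolyGrowth.sum _ fun l _ =>
    (PolyGrowth.const _).mul ((polyGrowth_eval_comp k q).mul (polyGrowth_eval_comp l r)))

lemma norm_cexp_ofReal_mul_I (s a : ℝ) :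
    ‖Complex.exp (Complex.I * s * a)‖ = 1 := by
  have : Complex.I * s * a = ((s * a : ℝ) : ℂ) * Complex.I := by push_cast; ring
  rw [this, Complex.norm_exp_ofReal_mul_I]

lemma hasDerivAt_addStat (c : ℝ) (p : Polynomial ℝ) :
    HasCurveDeriv (addStat c p : (ι → ℝ) → ℝ)
      (fun z => c * ∑ l, p.derivative.eval (z.1 l) * z.2 l) := by
  intro γ γ' t hγ
  exact (HasDerivAt.fun_sum fun l _ => hasCurveDeriv_eval l p γ γ' t hγ).const_mul c

open Polynomial in
/-- The Stein identity for sums of functions of the coordinates. -/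
theorem integral_addStat_mul_cexp (hμ : μ[id] = 0) (hone : ∀ k, ∫ x, x k * x k ∂μ = 1) (c s : ℝ)
    {p q : ℝ[X]} (hpq : X * q - derivative q = p) :
    ∫ x, (addStat c p x : ℂ) * Complex.exp (Complex.I * s * addStat c p x) ∂μ =
      Complex.I * s * ∫ x, (formStat c (fun k l => ∫ x, x k * x l ∂μ) q p.derivative x : ℂ) *
        Complex.exp (Complex.I * s * addStat c p x) ∂μ := by
  classical
  set e : (ι → ℝ) → ℂ := fun x => Complex.exp (Complex.I * s * addStat c p x) with he
  have hGc := continuous_addStat (ι := ι) c p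
  have hec : Continuous e := by fun_prop
  have heb : ∀ x, ‖e x‖ = 1 := fun x => norm_cexp_ofReal_mul_I s _
  have heg : PolyGrowth e := (PolyGrowth.const (1 : ℝ)).of_norm_le fun x => by simp [heb x]
  have hint : ∀ {f : (ι → ℝ) → ℂ}, PolyGrowth f → Continuous f → Integrable f μ :=
    fun hf hc => hf.integrable_of_continuous hc
  set ρ : ι → ι → ℝ := fun k l => ∫ x, x k * x l ∂μ with hρ
  -- Integrate `x_k` by parts against `q (x_k) e`. The derivative falling on `q` has coefficient `E
  -- x_k² = 1` and is cancelled by the term `-q'` of the Stein equation; only the derivative of the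
  -- exponential, which involves every coordinate, remains.
  have key : ∀ k, ∫ x, ((p.eval (x k) : ℝ) : ℂ) * e x ∂μ =
      Complex.I * s * c * ∑ l, (ρ k l : ℂ) *
        ∫ x, ((q.eval (x k) * p.derivative.eval (x l) : ℝ) : ℂ) * e x ∂μ := by
    intro k
    have h := integral_eval_mul hμ k (G := fun x => ((q.eval (x k) : ℝ) : ℂ) * e x)
      (D := fun m x => (if m = k then ((q.derivative.eval (x k) : ℝ) : ℂ) * e x else 0) +
        Complex.I * s * c * (((q.eval (x k) * p.derivative.eval (x m) : ℝ) : ℂ) * e x))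
      (by fun_prop) ((polyGrowth_eval_comp k q).ofReal.mul heg)
      (fun m => by split_ifs <;> fun_prop)
      (fun m => by
        refine PolyGrowth.add ?_ ((PolyGrowth.const _).mul
          (((polyGrowth_eval_comp k q).mul (polyGrowth_eval_comp m _)).ofReal.mul heg))
        split_ifs
        · exact (polyGrowth_eval_comp k _).ofReal.mul heg
        · exact PolyGrowth.const 0)
      (by
        intro γ γ' t hγ
        have h1 := (hasCurveDeriv_eval k q γ γ' t hγ).ofReal_comp
        have h2 := (((hasDerivAt_addStat c p γ γ' t hγ).ofReal_comp).const_mul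
          (Complex.I * s)).cexp
        refine (h1.mul h2).congr_deriv ?_
        simp only [add_mul, Finset.sum_add_distrib, ite_mul, zero_mul, Finset.sum_ite_eq',
          Finset.mem_univ, if_true]
        push_cast
        congr 1
        · simp only [he]; ring
        · simp only [he, Finset.mul_sum]
          refine Finset.sum_congr rfl fun l _ => ?_
          ring)
    have h3 : ∀ m, ∫ x, ((if m = k then ((q.derivative.eval (x k) : ℝ) : ℂ) * e x else 0) +
        Complex.I * s * c * (((q.eval (x k) * p.derivative.eval (x m) : ℝ) : ℂ) * e x)) ∂μ =
        (if m = k then ∫ x, ((q.derivative.eval (x k) : ℝ) : ℂ) * e x ∂μ else 0) +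
        Complex.I * s * c * ∫ x, ((q.eval (x k) * p.derivative.eval (x m) : ℝ) : ℂ) * e x ∂μ := by
      intro m
      have hi := hint (((polyGrowth_eval_comp k q).mul
          (polyGrowth_eval_comp m p.derivative)).ofReal.mul heg) (by fun_prop)
      rw [integral_add _ (hi.const_mul _), integral_const_mul]
      · congr 1
        split_ifs
        · rfl
        · simp
      · split_ifs
        · exact hint ((polyGrowth_eval_comp k _).ofReal.mul heg) (by fun_prop)
        · exact integrable_zero _ _ _
    simp_rw [h3] at h
    simp only [mul_add, Finset.sum_add_distrib, mul_ite, mul_zero, Finset.sum_ite_eq',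
      Finset.mem_univ, if_true, hone k] at h
    have h4 : ∫ x, ((p.eval (x k) : ℝ) : ℂ) * e x ∂μ =
        (∫ x, (x k : ℂ) * (((q.eval (x k) : ℝ) : ℂ) * e x) ∂μ) -
          ∫ x, ((q.derivative.eval (x k) : ℝ) : ℂ) * e x ∂μ := by
      rw [← integral_sub]
      · congr 1
        ext x
        rw [← hpq]
        simp
        ring
      · exact hint ((PolyGrowth.eval k).ofReal.mul
          ((polyGrowth_eval_comp k q).ofReal.mul heg)) (by fun_prop)
      · exact hint ((polyGrowth_eval_comp k _).ofReal.mul heg) (by fun_prop)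
    rw [h4, h, Finset.mul_sum]
    simp only [Complex.ofReal_one, one_mul, add_sub_cancel_left]
    refine Finset.sum_congr rfl fun l _ => ?_
    ring
  have hL : ∫ x, (addStat c p x : ℂ) * e x ∂μ =
      c * ∑ k, ∫ x, ((p.eval (x k) : ℝ) : ℂ) * e x ∂μ := by
    rw [← integral_finsetSum, ← integral_const_mul]
    · congr 1
      ext x
      simp only [addStat]
      push_cast
      rw [← Finset.sum_mul]
      ring
    · exact fun k _ => hint ((polyGrowth_eval_comp k _).ofReal.mul heg) (by fun_prop)
  have hR : ∫ x, (formStat c ρ q p.derivative x : ℂ) * e x ∂μ =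
      c ^ 2 * ∑ k, ∑ l, (ρ k l : ℂ) *
        ∫ x, ((q.eval (x k) * p.derivative.eval (x l) : ℝ) : ℂ) * e x ∂μ := by
    have hi : ∀ k l, Integrable (fun x : ι → ℝ => (ρ k l : ℂ) *
        (((q.eval (x k) * p.derivative.eval (x l) : ℝ) : ℂ) * e x)) μ := fun k l =>
      (hint (((polyGrowth_eval_comp k q).mul
          (polyGrowth_eval_comp l p.derivative)).ofReal.mul heg) (by fun_prop)).const_mul _
    simp_rw [← integral_const_mul]
    have : ∀ k, ∑ l, ∫ x, (ρ k l : ℂ) *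
        (((q.eval (x k) * p.derivative.eval (x l) : ℝ) : ℂ) * e x) ∂μ = ∫ x, ∑ l, (ρ k l : ℂ) *
        (((q.eval (x k) * p.derivative.eval (x l) : ℝ) : ℂ) * e x) ∂μ := fun k => by
      rw [integral_finsetSum _ fun l _ => hi k l]
    simp_rw [this]
    rw [← integral_finsetSum _ fun k _ => integrable_finsetSum _ fun l _ => hi k l,
      ← integral_const_mul]
    congr 1
    ext x
    simp only [formStat]
    push_cast
    rw [mul_assoc, Finset.sum_mul]
    congr 1
    refine Finset.sum_congr rfl fun k _ => ?_
    rw [Finset.sum_mul]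
    refine Finset.sum_congr rfl fun l _ => ?_
    ring
  rw [hL, hR]
  simp_rw [key]
  rw [← Finset.mul_sum]
  ring

end GaussianVector

/-! ### Concentration of the Stein factor `Γ`. -/

section GaussianVariance

variable {ι : Type*} [Fintype ι] {μ : Measure (ι → ℝ)} [IsGaussian μ]

lemma integral_linear_mul_linear (u w : ι → ℝ) :
    ∫ x, (∑ k, u k * x k) * (∑ l, w l * x l) ∂μ =
      ∑ k, ∑ l, u k * w l * ∫ x, x k * x l ∂μ := by
  have hi : ∀ k l, Integrable (fun x : ι → ℝ => u k * w l * (x k * x l)) μ := fun k l =>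
    PolyGrowth.integrable_of_continuous ((PolyGrowth.const _).mul
      ((PolyGrowth.eval k).mul (PolyGrowth.eval l))) (by fun_prop)
  simp_rw [← integral_const_mul]
  have : ∀ k, ∑ l, ∫ x, u k * w l * (x k * x l) ∂μ = ∫ x, ∑ l, u k * w l * (x k * x l) ∂μ :=
    fun k => by rw [integral_finsetSum _ fun l _ => hi k l]
  simp_rw [this]
  rw [← integral_finsetSum _ fun k _ => integrable_finsetSum _ fun l _ => hi k l]
  congr 1
  ext x
  rw [Finset.sum_mul_sum]
  refine Finset.sum_congr rfl fun k _ => Finset.sum_congr rfl fun l _ => ?_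
  ring

/-- For a positive symmetric `ρ`, a bound on the quadratic form bounds the operator norm. With `r =
ρ u` one expands `E (C u·x - r·x)² ≥ 0`, uses `E (r·x)(u·x) = |r|²`, and bounds the two squares by
the hypothesis; no diagonalization is needed. -/
lemma sum_sq_cov_apply_le {C : ℝ} (hC : 0 < C)
    (hcov : ∀ v : ι → ℝ, ∫ x, (∑ k, v k * x k) ^ 2 ∂μ ≤ C * ∑ k, v k ^ 2) (u : ι → ℝ) :
    ∑ k, (∑ l, (∫ x, x k * x l ∂μ) * u l) ^ 2 ≤ C ^ 2 * ∑ k, u k ^ 2 := by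
  set r : ι → ℝ := fun k => ∑ l, (∫ x, x k * x l ∂μ) * u l with hr
  have h1 : ∫ x, (∑ k, r k * x k) * (∑ l, u l * x l) ∂μ = ∑ k, r k ^ 2 := by
    rw [integral_linear_mul_linear]
    refine Finset.sum_congr rfl fun k _ => ?_
    rw [sq]
    conv_rhs => rw [hr]
    simp only
    rw [Finset.mul_sum]
    refine Finset.sum_congr rfl fun l _ => ?_
    ring
  have hlin : ∀ w : ι → ℝ, PolyGrowth (fun x : ι → ℝ => ∑ k, w k * x k) := fun w =>
    PolyGrowth.sum _ fun k _ => (PolyGrowth.const _).mul (PolyGrowth.eval k)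
  have hi : ∀ w w' : ι → ℝ, Integrable (fun x : ι → ℝ =>
      (∑ k, w k * x k) * (∑ k, w' k * x k)) μ := fun w w' =>
    PolyGrowth.integrable_of_continuous ((hlin w).mul (hlin w')) (by fun_prop)
  have h2 : 0 ≤ ∫ x, (C * (∑ l, u l * x l) - ∑ k, r k * x k) ^ 2 ∂μ :=
    integral_nonneg fun x => sq_nonneg _
  have h3 : ∫ x, (C * (∑ l, u l * x l) - ∑ k, r k * x k) ^ 2 ∂μ =
      C ^ 2 * ∫ x, (∑ l, u l * x l) ^ 2 ∂μ - 2 * C * ∑ k, r k ^ 2 +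
        ∫ x, (∑ k, r k * x k) ^ 2 ∂μ := by
    rw [← h1, ← integral_const_mul, ← integral_const_mul, ← integral_sub, ← integral_add]
    · congr 1
      ext x
      ring
    · refine Integrable.sub ?_ ((hi r u).const_mul _)
      exact ((hi u u).const_mul (C ^ 2)).congr (ae_of_all _ fun x => by ring)
    · simpa [sq] using hi r r
    · exact ((hi u u).const_mul (C ^ 2)).congr (ae_of_all _ fun x => by ring)
    · exact (hi r u).const_mul _
  have h4 := hcov u
  have h5 := hcov r
  have h6 : C ^ 2 * ∫ x, (∑ l, u l * x l) ^ 2 ∂μ ≤ C ^ 2 * (C * ∑ k, u k ^ 2) := by gcongr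
  have h7 : C * ∑ k, r k ^ 2 ≤ C * (C ^ 2 * ∑ k, u k ^ 2) := by nlinarith
  exact le_of_mul_le_mul_left h7 hC

/-- Each `u_k²` is at most `(∑ u⁴)^{1/2}`, linearized by `2 u² ≤ S + u⁴ / S`. With `S = √N` the
factor is of order `√N` in mean, which uses only moments of the coordinates and no bound on their
maximum. -/
lemma sum_sq_mul_sq_le {S : ℝ} (hS : 0 < S) (u r : ι → ℝ) :
    ∑ k, u k ^ 2 * r k ^ 2 ≤ (S + (∑ k, u k ^ 4) / S) / 2 * ∑ k, r k ^ 2 := by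
  rw [Finset.mul_sum]
  refine Finset.sum_le_sum fun k _ => ?_
  gcongr
  have h1 : u k ^ 4 ≤ ∑ k, u k ^ 4 :=
    Finset.single_le_sum (f := fun k => u k ^ 4) (fun i _ => by positivity) (Finset.mem_univ k)
  have h2 : u k ^ 4 / S ≤ (∑ k, u k ^ 4) / S := by gcongr
  have h3 : 2 * u k ^ 2 ≤ S + u k ^ 4 / S := by
    rw [← sub_nonneg]
    have : S + u k ^ 4 / S - 2 * u k ^ 2 = (S - u k ^ 2) ^ 2 / S := by field_simp; ring
    rw [this]
    positivity
  linarith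

open Polynomial in
/-- The variance of `N⁻¹ ∑ ρ_{kl} q (x_k) r (x_l)` is of order `N^{-1/2}`. -/
theorem variance_formStat_le [Nonempty ι] (hμ : μ[id] = 0) {C M c : ℝ} (hC : 0 < C)
    (hc : c ^ 2 = 1 / Fintype.card ι)
    (hcov : ∀ v : ι → ℝ, ∫ x, (∑ k, v k * x k) ^ 2 ∂μ ≤ C * ∑ k, v k ^ 2)
    {q r h : ℝ[X]} (h1 : ∀ t, 1 ≤ h.eval t) (hq : ∀ t, |q.eval t| ≤ h.eval t)
    (hr : ∀ t, |r.eval t| ≤ h.eval t) (hq' : ∀ t, |q.derivative.eval t| ≤ h.eval t)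
    (hr' : ∀ t, |r.derivative.eval t| ≤ h.eval t) (hM : ∀ k, ∫ x, h.eval (x k) ^ 8 ∂μ ≤ M) :
    ∫ x, (formStat c (fun k l => ∫ x, x k * x l ∂μ) q r x -
        ∫ x, formStat c (fun k l => ∫ x, x k * x l ∂μ) q r x ∂μ) ^ 2 ∂μ ≤
      8 * C ^ 3 * M / √(Fintype.card ι) := by
  classical
  set ρ : ι → ι → ℝ := fun k l => ∫ x, x k * x l ∂μ with hρ
  have hsymm : ∀ k l, ρ k l = ρ l k := fun k l => by simp only [hρ, mul_comm]
  set Γ : (ι → ℝ) → ℝ := formStat c ρ q r with hΓ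
  set N : ℝ := (Fintype.card ι : ℝ) with hN
  have hNpos : 0 < N := by simp only [hN]; exact_mod_cast Fintype.card_pos
  set S := √N with hS
  have hSpos : 0 < S := Real.sqrt_pos.2 hNpos
  have hSS : S ^ 2 = N := Real.sq_sqrt hNpos.le
  have hΓc : Continuous Γ := continuous_formStat c ρ q r
  have hΓg : PolyGrowth Γ := polyGrowth_formStat c ρ q r
  -- The gradient of `Γ`; the symmetry of `ρ` lets the derivatives in both arguments be collected on
  -- the index `k`.
  set V : ι → (ι → ℝ) → ℝ := fun k x => c ^ 2 * (q.derivative.eval (x k) *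
    (∑ l, ρ k l * r.eval (x l)) + r.derivative.eval (x k) * (∑ l, ρ k l * q.eval (x l))) with hV
  have hVc : ∀ k, Continuous (V k) := fun k => by simp only [hV]; fun_prop
  have hrow : ∀ (k : ι) (f : ℝ[X]), PolyGrowth (fun x : ι → ℝ => ∑ l, ρ k l * f.eval (x l)) :=
    fun k f => PolyGrowth.sum _ fun l _ => (PolyGrowth.const _).mul (polyGrowth_eval_comp l f)
  have hVg : ∀ k, PolyGrowth (V k) := fun k =>
    (PolyGrowth.const _).mul (((polyGrowth_eval_comp k _).mul (hrow k r)).add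
      ((polyGrowth_eval_comp k _).mul (hrow k q)))
  have hderiv : HasCurveDeriv Γ (fun p => ∑ k, V k p.1 * p.2 k) := by
    intro γ γ' t hγ
    have hd := (HasDerivAt.fun_sum fun k (_ : k ∈ Finset.univ) =>
      HasDerivAt.fun_sum fun l (_ : l ∈ Finset.univ) =>
        ((hasCurveDeriv_eval k q γ γ' t hγ).mul
          (hasCurveDeriv_eval l r γ γ' t hγ)).const_mul (ρ k l)).const_mul (c ^ 2)
    refine hd.congr_deriv ?_
    have e1 : ∑ k, ∑ l, ρ k l * (q.eval (γ t k) * (r.derivative.eval (γ t l) * γ' l)) =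
        ∑ k, ∑ l, ρ k l * (q.eval (γ t l) * (r.derivative.eval (γ t k) * γ' k)) := by
      rw [Finset.sum_comm]
      refine Finset.sum_congr rfl fun k _ => Finset.sum_congr rfl fun l _ => ?_
      rw [hsymm]
    simp only [mul_add, Finset.sum_add_distrib]
    rw [e1, ← mul_add, ← Finset.sum_add_distrib, Finset.mul_sum]
    refine Finset.sum_congr rfl fun k _ => ?_
    simp only [hV]
    rw [← Finset.sum_add_distrib]
    simp only [Finset.mul_sum, Finset.sum_mul, ← Finset.sum_add_distrib]
    refine Finset.sum_congr rfl fun l _ => ?_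
    ring
  have hdg : PolyGrowth (fun p : (ι → ℝ) × (ι → ℝ) => ∑ k, V k p.1 * p.2 k) :=
    PolyGrowth.sum _ fun k _ => ((hVg k).comp PolyGrowth.fst).mul
      ((PolyGrowth.eval k).comp PolyGrowth.snd)
  have hdc : Continuous (fun p : (ι → ℝ) × (ι → ℝ) => ∑ k, V k p.1 * p.2 k) := by fun_prop
  have hpoin := integral_sq_sub_le hμ hΓc hdc hΓg hdg hderiv
  have hi : ∀ {f : (ι → ℝ) → ℝ}, PolyGrowth f → Continuous f → Integrable f μ :=
    fun hf hc => hf.integrable_of_continuous hc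
  have hvar : ∫ p, (Γ p.1 - Γ p.2) ^ 2 ∂(μ.prod μ) = 2 * ∫ x, (Γ x - ∫ x, Γ x ∂μ) ^ 2 ∂μ := by
    set m := ∫ x, Γ x ∂μ with hm
    have hΓm : ∫ x, (Γ x - m) ∂μ = 0 := by
      rw [integral_sub (hi hΓg hΓc) (integrable_const _)]
      simp [hm]
    have hg : PolyGrowth fun x => Γ x - m := hΓg.sub (PolyGrowth.const m)
    have hc' : Continuous fun x => Γ x - m := by fun_prop
    have e : ∀ p : (ι → ℝ) × (ι → ℝ), (Γ p.1 - Γ p.2) ^ 2 =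
        (Γ p.1 - m) ^ 2 * 1 + 1 * (Γ p.2 - m) ^ 2 - 2 * ((Γ p.1 - m) * (Γ p.2 - m)) := fun p => by
      ring
    have hi2 : Integrable (fun x => (Γ x - m) ^ 2) μ := hi (hg.pow 2) (by fun_prop)
    simp_rw [e]
    rw [integral_sub, integral_add, integral_const_mul (2 : ℝ),
      integral_prod_mul (fun x => (Γ x - m) ^ 2) (fun _ => (1 : ℝ)),
      integral_prod_mul (fun _ => (1 : ℝ)) (fun x => (Γ x - m) ^ 2),
      integral_prod_mul (fun x => Γ x - m) (fun x => Γ x - m), hΓm]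
    · simp; ring
    · exact hi2.mul_prod (integrable_const _)
    · exact (integrable_const (1 : ℝ)).mul_prod hi2
    · exact (hi2.mul_prod (integrable_const _)).add ((integrable_const (1 : ℝ)).mul_prod hi2)
    · exact ((hi hg hc').mul_prod (hi hg hc')).const_mul _
  -- For fixed `x` the derivative of `Γ` is a linear form in the independent copy, with coefficients
  -- `V k x`, so the covariance bound applies to the inner integral.
  have hfub : ∫ p, (∑ k, V k p.1 * p.2 k) ^ 2 ∂(μ.prod μ) ≤ C * ∫ x, ∑ k, V k x ^ 2 ∂μ := by
    have hI : Integrable (fun p : (ι → ℝ) × (ι → ℝ) => (∑ k, V k p.1 * p.2 k) ^ 2) (μ.prod μ) :=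
      PolyGrowth.integrable_of_continuous (hdg.pow 2) (by fun_prop)
    rw [integral_prod _ hI, ← integral_const_mul]
    refine integral_mono hI.integral_prod_left ?_ fun x => hcov fun k => V k x
    exact (hi (PolyGrowth.sum _ fun k _ => (hVg k).pow 2) (by fun_prop)).const_mul C
  -- The rate: `N⁻²` from `c⁴`, a factor of order `√N` from `sum_sq_mul_sq_le`, and `N` from the sum
  -- of squares, hence `N^{-1/2}` in total.
  have hpt : ∀ x : ι → ℝ, ∑ k, V k x ^ 2 ≤ 2 * C ^ 2 / N ^ 2 *
      ((S + (∑ k, h.eval (x k) ^ 4) / S) * ∑ k, h.eval (x k) ^ 2) := by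
    intro x
    have key : ∀ f g : ℝ[X], (∀ t, |f.eval t| ≤ h.eval t) → (∀ t, |g.eval t| ≤ h.eval t) →
        ∑ k, f.eval (x k) ^ 2 * (∑ l, ρ k l * g.eval (x l)) ^ 2 ≤
        (S + (∑ k, h.eval (x k) ^ 4) / S) / 2 * (C ^ 2 * ∑ k, h.eval (x k) ^ 2) := by
      intro f g hf hg
      have a1 : ∀ k, f.eval (x k) ^ 4 ≤ h.eval (x k) ^ 4 := fun k => by
        have := pow_le_pow_left₀ (abs_nonneg _) (hf (x k)) 4
        rwa [Even.pow_abs (by decide)] at this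
      have a2 : ∀ k, g.eval (x k) ^ 2 ≤ h.eval (x k) ^ 2 := fun k => by
        have := pow_le_pow_left₀ (abs_nonneg _) (hg (x k)) 2
        rwa [sq_abs] at this
      refine (sum_sq_mul_sq_le hSpos _ _).trans ?_
      have b1 : ∑ k, f.eval (x k) ^ 4 ≤ ∑ k, h.eval (x k) ^ 4 := Finset.sum_le_sum fun k _ => a1 k
      have b2 : ∑ k, g.eval (x k) ^ 2 ≤ ∑ k, h.eval (x k) ^ 2 := Finset.sum_le_sum fun k _ => a2 k
      have b3 := sum_sq_cov_apply_le hC hcov (fun l => g.eval (x l))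
      gcongr
      exact b3.trans (by gcongr)
    have k1 := key _ _ hq' hr
    have k2 := key _ _ hr' hq
    have hcc : (c ^ 2) ^ 2 = 1 / N ^ 2 := by rw [hc]; simp
    calc ∑ k, V k x ^ 2 ≤ ∑ k, 2 * (1 / N ^ 2) * (q.derivative.eval (x k) ^ 2 *
          (∑ l, ρ k l * r.eval (x l)) ^ 2 + r.derivative.eval (x k) ^ 2 *
          (∑ l, ρ k l * q.eval (x l)) ^ 2) := by
          refine Finset.sum_le_sum fun k _ => ?_
          rw [← hcc]
          simp only [hV]
          rw [mul_pow]
          have : ∀ a b : ℝ, (a + b) ^ 2 ≤ 2 * (a ^ 2 + b ^ 2) := fun a b => by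
            nlinarith [sq_nonneg (a - b)]
          have t := this (q.derivative.eval (x k) * (∑ l, ρ k l * r.eval (x l)))
            (r.derivative.eval (x k) * (∑ l, ρ k l * q.eval (x l)))
          rw [mul_pow, mul_pow] at t
          have h0 : 0 ≤ (c ^ 2) ^ 2 := by positivity
          nlinarith
      _ ≤ 2 * (1 / N ^ 2) * (2 * ((S + (∑ k, h.eval (x k) ^ 4) / S) / 2 *
          (C ^ 2 * ∑ k, h.eval (x k) ^ 2))) := by
          rw [← Finset.mul_sum, Finset.sum_add_distrib]
          gcongr
          linarith
      _ = _ := by ring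
  have hh : ∀ (k : ι) (n : ℕ), PolyGrowth fun x : ι → ℝ => h.eval (x k) ^ n := fun k n =>
    (polyGrowth_eval_comp k h).pow n
  have hbig : ∫ x, (S + (∑ k, h.eval (x k) ^ 4) / S) * ∑ k, h.eval (x k) ^ 2 ∂μ ≤
      2 * (S * (N * M)) := by
    -- Since `h ≥ 1`, all powers can be raised to the eighth, and mixed products split by `2uv ≤ u²
    -- + v²`; thus a single moment bound `M` suffices.
    have e : ∀ x : ι → ℝ, (S + (∑ k, h.eval (x k) ^ 4) / S) * ∑ k, h.eval (x k) ^ 2 ≤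
        S * ∑ k, h.eval (x k) ^ 8 + 1 / S * ∑ k, ∑ l, (h.eval (x k) ^ 8 + h.eval (x l) ^ 8) / 2 := by
      intro x
      rw [add_mul]
      have p1 : ∀ k, 1 ≤ h.eval (x k) := fun k => h1 _
      refine add_le_add ?_ ?_
      · gcongr with k
        · exact p1 k
        · norm_num
      · rw [div_mul_eq_mul_div, Finset.sum_mul_sum, one_div, div_eq_inv_mul]
        gcongr with k _ l _
        have : h.eval (x l) ^ 2 ≤ h.eval (x l) ^ 4 := pow_le_pow_right₀ (p1 l) (by norm_num)
        have h0 : 0 ≤ h.eval (x k) ^ 4 := by have := p1 k; positivity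
        nlinarith [sq_nonneg (h.eval (x k) ^ 4 - h.eval (x l) ^ 4)]
    have i8 : ∀ k, Integrable (fun x : ι → ℝ => h.eval (x k) ^ 8) μ := fun k =>
      hi (hh k 8) (by fun_prop)
    have i88 : ∀ k l, Integrable (fun x : ι → ℝ => (h.eval (x k) ^ 8 + h.eval (x l) ^ 8) / 2) μ :=
      fun k l => ((i8 k).add (i8 l)).div_const 2
    have iA : Integrable (fun x : ι → ℝ => S * ∑ k, h.eval (x k) ^ 8) μ :=
      (integrable_finsetSum _ fun k _ => i8 k).const_mul _
    have iB : Integrable (fun x : ι → ℝ =>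
        1 / S * ∑ k, ∑ l, (h.eval (x k) ^ 8 + h.eval (x l) ^ 8) / 2) μ :=
      (integrable_finsetSum _ fun k _ => integrable_finsetSum _ fun l _ => i88 k l).const_mul _
    refine (integral_mono (hi ?_ ?_) (iA.add iB) e).trans ?_
    · refine (((PolyGrowth.const S).add ?_).mul (PolyGrowth.sum _ fun k _ => hh k 2))
      simp_rw [div_eq_mul_inv]
      exact (PolyGrowth.sum _ fun k _ => hh k 4).mul (PolyGrowth.const _)
    · fun_prop
    · have s1 : ∑ k, ∫ x, h.eval (x k) ^ 8 ∂μ ≤ N * M := by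
        calc ∑ k, ∫ x, h.eval (x k) ^ 8 ∂μ ≤ ∑ _k : ι, M := Finset.sum_le_sum fun k _ => hM k
          _ = N * M := by simp [hN]
      have s2 : ∑ k, ∑ l, ∫ x, (h.eval (x k) ^ 8 + h.eval (x l) ^ 8) / 2 ∂μ ≤ N * (N * M) := by
        calc _ ≤ ∑ _k : ι, ∑ _l : ι, M := by
              refine Finset.sum_le_sum fun k _ => Finset.sum_le_sum fun l _ => ?_
              rw [integral_div, integral_add (i8 k) (i8 l)]
              linarith [hM k, hM l]
          _ = N * (N * M) := by simp [hN]
      simp only [Pi.add_apply]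
      rw [integral_add iA iB, integral_const_mul, integral_const_mul,
        integral_finsetSum _ fun k _ => i8 k,
        integral_finsetSum _ fun k _ => integrable_finsetSum _ fun l _ => i88 k l]
      simp_rw [integral_finsetSum _ fun l _ => i88 _ l]
      calc S * (∑ k, ∫ x, h.eval (x k) ^ 8 ∂μ) +
          1 / S * ∑ k, ∑ l, ∫ x, (h.eval (x k) ^ 8 + h.eval (x l) ^ 8) / 2 ∂μ
          ≤ S * (N * M) + 1 / S * (N * (N * M)) := by gcongr
        _ = 2 * (S * (N * M)) := by
          rw [← hSS]; field_simp; ring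
  have hfin : ∫ x, ∑ k, V k x ^ 2 ∂μ ≤ 4 * C ^ 2 * M / S := by
    calc ∫ x, ∑ k, V k x ^ 2 ∂μ ≤ ∫ x, 2 * C ^ 2 / N ^ 2 *
      ((S + (∑ k, h.eval (x k) ^ 4) / S) * ∑ k, h.eval (x k) ^ 2) ∂μ := by
          refine integral_mono (hi (PolyGrowth.sum _ fun k _ => (hVg k).pow 2) (by fun_prop))
            (Integrable.const_mul (hi ?_ (by fun_prop)) _) hpt
          refine (((PolyGrowth.const S).add ?_).mul (PolyGrowth.sum _ fun k _ => hh k 2))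
          simp_rw [div_eq_mul_inv]
          exact (PolyGrowth.sum _ fun k _ => hh k 4).mul (PolyGrowth.const _)
      _ ≤ 2 * C ^ 2 / N ^ 2 * (2 * (S * (N * M))) := by
          rw [integral_const_mul]
          gcongr
      _ = 4 * C ^ 2 * M / S := by
          rw [← hSS]; field_simp; ring
  have hpi : (π / 2) ^ 2 ≤ 4 := by nlinarith [Real.pi_le_four, Real.pi_pos]
  have hnn : 0 ≤ ∫ p, (∑ k, V k p.1 * p.2 k) ^ 2 ∂(μ.prod μ) :=
    integral_nonneg fun p => sq_nonneg _
  calc ∫ x, (Γ x - ∫ x, Γ x ∂μ) ^ 2 ∂μ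
      ≤ 2 * (C * (4 * C ^ 2 * M / S)) := by
        have := mul_le_mul_of_nonneg_left hfin hC.le
        nlinarith
    _ = 8 * C ^ 3 * M / S := by ring

end GaussianVariance

/-! ### From the Stein identity to a quantitative central limit theorem. -/

section CharFun

variable {ι : Type*} [Fintype ι] {μ : Measure (ι → ℝ)} [IsGaussian μ]

lemma hasDerivAt_integral_cexp {G : (ι → ℝ) → ℝ} (hGc : Continuous G) (hG : PolyGrowth G) (s : ℝ) :
    HasDerivAt (fun s : ℝ => ∫ x, Complex.exp (Complex.I * s * G x) ∂μ)
      (Complex.I * ∫ x, (G x : ℂ) * Complex.exp (Complex.I * s * G x) ∂μ) s := by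
  have h := (hasDerivAt_integral_of_dominated_loc_of_deriv_le (μ := μ)
    (F := fun (s : ℝ) x => Complex.exp (Complex.I * s * G x))
    (F' := fun (s : ℝ) x => Complex.I * ((G x : ℂ) * Complex.exp (Complex.I * s * G x)))
    (s := Set.univ) (x₀ := s) (bound := fun x => ‖G x‖) Filter.univ_mem
    (Eventually.of_forall fun t => Continuous.aestronglyMeasurable (by fun_prop))
    (((PolyGrowth.const (1 : ℝ)).of_norm_le
      fun x => by rw [norm_cexp_ofReal_mul_I]; simp).integrable_of_continuous (by fun_prop))
    (Continuous.aestronglyMeasurable (by fun_prop))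
    (ae_of_all _ fun x t _ => by
      rw [norm_mul, norm_mul, norm_cexp_ofReal_mul_I]; simp)
    (hG.integrable_of_continuous hGc).norm
    (ae_of_all _ fun x t _ => by
      have h1 : HasDerivAt (fun t : ℝ => Complex.I * t * G x) (Complex.I * G x) t := by
        have := ((Complex.ofRealCLM.hasDerivAt (x := t)).const_mul Complex.I).mul_const (G x : ℂ)
        simpa using! this
      exact h1.cexp.congr_deriv (by ring))).2
  rwa [integral_const_mul] at h

/-- If `E [G e^{isG}] = i s E [Γ e^{isG}]`, then the law of `G` is nearly Gaussian provided that
`Γ` is nearly constant. -/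
theorem norm_integral_cexp_sub_le {G Γ : (ι → ℝ) → ℝ} (hGc : Continuous G) (hG : PolyGrowth G)
    (hΓc : Continuous Γ) (hΓ : PolyGrowth Γ)
    (hstein : ∀ s : ℝ, ∫ x, (G x : ℂ) * Complex.exp (Complex.I * s * G x) ∂μ =
      Complex.I * s * ∫ x, (Γ x : ℂ) * Complex.exp (Complex.I * s * G x) ∂μ)
    {v : ℝ} (hv : 0 ≤ v) :
    ‖∫ x, Complex.exp (Complex.I * G x) ∂μ - Complex.exp (-v / 2)‖ ≤ ∫ x, |Γ x - v| ∂μ := by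
  set φ : ℝ → ℂ := fun s => ∫ x, Complex.exp (Complex.I * s * G x) ∂μ with hφ
  -- `D` would be constant if `φ` were the characteristic function of `N(0, v)`. The Stein identity
  -- gives `φ' = -s E [Γ e^{isG}]`, so `D' = -s e^{s²v/2} E [(Γ - v) e^{isG}]`, and the mean value
  -- inequality on `[0, 1]` yields the claim.
  set D : ℝ → ℂ := fun s => φ s * Complex.exp (s ^ 2 * v / 2) with hD
  have hei : ∀ s : ℝ, Integrable (fun x => Complex.exp (Complex.I * s * G x)) μ := fun s =>
    ((PolyGrowth.const (1 : ℝ)).of_norm_le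
      fun x => by rw [norm_cexp_ofReal_mul_I]; simp).integrable_of_continuous (by fun_prop)
  have hΓi : Integrable Γ μ := hΓ.integrable_of_continuous hΓc
  have hΓe : ∀ s : ℝ, Integrable (fun x => (Γ x : ℂ) * Complex.exp (Complex.I * s * G x)) μ :=
    fun s => (hΓ.of_norm_le fun x => by
      rw [norm_mul, norm_cexp_ofReal_mul_I]; simp).integrable_of_continuous (by fun_prop)
  have hderiv : ∀ s : ℝ, HasDerivAt D (-(s : ℂ) * Complex.exp (s ^ 2 * v / 2) *
      ∫ x, ((Γ x - v : ℝ) : ℂ) * Complex.exp (Complex.I * s * G x) ∂μ) s := by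
    intro s
    have h1 := hasDerivAt_integral_cexp (μ := μ) hGc hG s
    have h2 : HasDerivAt (fun s : ℝ => (s : ℂ) ^ 2 * v / 2) ((s : ℂ) * v) s := by
      have := (((Complex.ofRealCLM.hasDerivAt (x := s)).pow 2).mul_const (v : ℂ)).div_const 2
      refine this.congr_deriv ?_
      simp
      ring
    refine (h1.mul h2.cexp).congr_deriv ?_
    have h3 : ∫ x, ((Γ x - v : ℝ) : ℂ) * Complex.exp (Complex.I * s * G x) ∂μ =
        (∫ x, (Γ x : ℂ) * Complex.exp (Complex.I * s * G x) ∂μ) - v * φ s := by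
      rw [hφ, ← integral_const_mul, ← integral_sub (hΓe s) ((hei s).const_mul _)]
      congr 1
      ext x
      push_cast
      ring
    rw [h3, hstein s]
    have hI : Complex.I * Complex.I = -1 := Complex.I_mul_I
    simp only [hφ]
    linear_combination (s * (∫ x, (Γ x : ℂ) * Complex.exp (Complex.I * s * G x) ∂μ) *
      Complex.exp (s ^ 2 * v / 2)) * hI
  set ε := ∫ x, |Γ x - v| ∂μ with hε
  have hbound : ∀ s ∈ Set.Ico (0 : ℝ) 1, ‖-(s : ℂ) * Complex.exp (s ^ 2 * v / 2) *
      ∫ x, ((Γ x - v : ℝ) : ℂ) * Complex.exp (Complex.I * s * G x) ∂μ‖ ≤ Real.exp (v / 2) * ε := by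
    intro s hs
    have e1 : Complex.exp ((s : ℂ) ^ 2 * v / 2) = (Real.exp (s ^ 2 * v / 2) : ℂ) := by push_cast; rfl
    have e2 : Real.exp (s ^ 2 * v / 2) ≤ Real.exp (v / 2) := by
      rw [Real.exp_le_exp]
      have : s ^ 2 ≤ 1 := by nlinarith [hs.1, hs.2]
      nlinarith
    have e3 : ‖∫ x, ((Γ x - v : ℝ) : ℂ) * Complex.exp (Complex.I * s * G x) ∂μ‖ ≤ ε := by
      refine (norm_integral_le_integral_norm _).trans (le_of_eq ?_)
      rw [hε]
      congr 1
      ext x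
      rw [norm_mul, norm_cexp_ofReal_mul_I, Complex.norm_real, Real.norm_eq_abs, mul_one]
    rw [norm_mul, norm_mul, norm_neg, e1, Complex.norm_real, Complex.norm_real,
      Real.norm_of_nonneg hs.1, Real.norm_of_nonneg (Real.exp_pos _).le]
    have hε0 : 0 ≤ ε := integral_nonneg fun x => abs_nonneg _
    have e4 : s * Real.exp (s ^ 2 * v / 2) ≤ Real.exp (v / 2) := by
      have := Real.exp_pos (s ^ 2 * v / 2)
      nlinarith [hs.1, hs.2]
    exact mul_le_mul e4 e3 (norm_nonneg _) (Real.exp_pos _).le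
  have hmv := norm_image_sub_le_of_norm_deriv_le_segment_01' (f := D)
    (fun s _ => (hderiv s).hasDerivWithinAt) hbound
  have hD1 : D 1 = (∫ x, Complex.exp (Complex.I * G x) ∂μ) * Complex.exp (v / 2) := by
    simp [hD, hφ]
  have hD0 : D 0 = 1 := by simp [hD, hφ]
  have hprod : (∫ x, Complex.exp (Complex.I * G x) ∂μ) - Complex.exp (-v / 2) =
      Complex.exp (-v / 2) * (D 1 - D 0) := by
    rw [hD1, hD0, mul_sub, mul_one, mul_left_comm, ← Complex.exp_add]
    ring_nf
    simp
  rw [hprod, norm_mul]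
  have e5 : ‖Complex.exp (-(v : ℂ) / 2)‖ = Real.exp (-v / 2) := by
    have : -(v : ℂ) / 2 = ((-v / 2 : ℝ) : ℂ) := by push_cast; rfl
    rw [this, ← Complex.ofReal_exp, Complex.norm_real, Real.norm_of_nonneg (Real.exp_pos _).le]
  rw [e5]
  calc Real.exp (-v / 2) * ‖D 1 - D 0‖ ≤ Real.exp (-v / 2) * (Real.exp (v / 2) * ε) := by gcongr
    _ = ε := by rw [← mul_assoc, ← Real.exp_add]; ring_nf; simp

open Polynomial

/-- `x H₃ + y (X⁴ - 3)`. -/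
noncomputable def statPoly (x y : ℝ) : ℝ[X] := C x * (X ^ 3 - C 3 * X) + C y * (X ^ 4 - C 3)

/-- The solution `q` of the Stein equation `X q - q' = x H₃ + y (X⁴ - 3)`. -/
noncomputable def steinPoly (x y : ℝ) : ℝ[X] := C x * (X ^ 2 - 1) + C y * (X ^ 3 + C 3 * X)

lemma derivative_steinPoly (x y : ℝ) :
    derivative (steinPoly x y) = C (2 * x) * X + C y * (C 3 * X ^ 2 + C 3) := by
  refine Polynomial.funext fun t => ?_
  simp [steinPoly]
  ring

lemma X_mul_steinPoly_sub (x y : ℝ) :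
    X * steinPoly x y - derivative (steinPoly x y) = statPoly x y := by
  refine Polynomial.funext fun t => ?_
  rw [derivative_steinPoly]
  simp [steinPoly, statPoly]
  ring

lemma derivative_statPoly (x y : ℝ) :
    derivative (statPoly x y) = C (3 * x) * (X ^ 2 - 1) + C (4 * y) * X ^ 3 := by
  refine Polynomial.funext fun t => ?_
  simp [statPoly]
  ring

lemma derivative_derivative_statPoly (x y : ℝ) :
    derivative (derivative (statPoly x y)) = C (6 * x) * X + C (12 * y) * X ^ 2 := by
  rw [derivative_statPoly]
  refine Polynomial.funext fun t => ?_
  simp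
  ring

/-- Multiplied by `ρ`, the right side is the covariance of `p (x_k)` and `p (x_l)`: since `E H_n H_n
= n! ρ^n` and `X⁴ - 3 = H₄ + 6 H₂`, the coefficients are `3! = 6`, `4! = 24` and `36 · 2! = 72`.
There is no `ab` term because `H₃` is orthogonal to `H₂` and `H₄`. The proof lowers the degree of
the left factor by repeated integration by parts (`hX`). -/
lemma integral_stein_mul_derivative_stat (hμ : μ[id] = 0) (hone : ∀ k, ∫ x, x k * x k ∂μ = 1)
    (k l : ι) (a b : ℝ) :
    ∫ x, (steinPoly a b).eval (x k) * (derivative (statPoly a b)).eval (x l) ∂μ =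
      6 * a ^ 2 * (∫ x, x k * x l ∂μ) ^ 2 +
        b ^ 2 * (24 * (∫ x, x k * x l ∂μ) ^ 3 + 72 * ∫ x, x k * x l ∂μ) := by
  set ρ := ∫ x, x k * x l ∂μ with hρ
  set A : ℝ[X] → ℝ[X] → ℝ := fun f g => ∫ x, f.eval (x k) * g.eval (x l) ∂μ with hA
  have hi : ∀ f g : ℝ[X], Integrable (fun x : ι → ℝ => f.eval (x k) * g.eval (x l)) μ := fun f g =>
    ((polyGrowth_eval_comp k f).mul (polyGrowth_eval_comp l g)).integrable_of_continuous
      (by fun_prop)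
  have hX : ∀ f g, A (X * f) g = A (derivative f) g + ρ * A f (derivative g) := by
    intro f g
    have := integral_X_mul_eval_mul_eval hμ k l f g
    rw [hone k, one_mul] at this
    exact this
  have hadd : ∀ f f' g, A (f + f') g = A f g + A f' g := by
    intro f f' g
    simp only [hA]
    rw [← integral_add (hi f g) (hi f' g)]
    simp only [eval_add, add_mul]
  have hC : ∀ (c : ℝ) f g, A (C c * f) g = c * A f g := by
    intro c f g
    simp only [hA]
    rw [← integral_const_mul]
    simp only [eval_mul, eval_C, mul_assoc]
  have hadd' : ∀ f g g', A f (g + g') = A f g + A f g' := by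
    intro f g g'
    simp only [hA]
    rw [← integral_add (hi f g) (hi f g')]
    simp only [eval_add, mul_add]
  have hC' : ∀ (c : ℝ) f g, A f (C c * g) = c * A f g := by
    intro c f g
    simp only [hA]
    rw [← integral_const_mul]
    simp only [eval_mul, eval_C, mul_left_comm]
  have h11 : A 1 1 = 1 := by simp [hA]
  have h1X : A 1 X = 0 := by
    have := IsGaussian.integral_dual (μ := μ)
      (ContinuousLinearMap.proj (R := ℝ) (φ := fun _ : ι => ℝ) l)
    simp only [id] at hμ
    rw [hμ] at this
    simpa [hA] using this
  have h1XX : A 1 (X ^ 2) = 1 := by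
    have := hone l
    simpa [hA, sq] using this
  have hA0 : ∀ g, A 0 g = 0 := fun g => by simp [hA]
  have hA0' : ∀ f, A f 0 = 0 := fun g => by simp [hA]
  have hH1 : ∀ g, A X g = ρ * A 1 (derivative g) := fun g => by
    have := hX 1 g
    simpa [hA0] using this
  have hH2 : ∀ g, A (X ^ 2) g = A 1 g + ρ ^ 2 * A 1 (derivative (derivative g)) := fun g => by
    have := hX X g
    rw [sq, this, hH1]
    simp
    ring
  have hH3 : ∀ g, A (X ^ 3) g = 3 * (ρ * A 1 (derivative g)) +
      ρ ^ 3 * A 1 (derivative (derivative (derivative g))) := fun g => by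
    have := hX (X ^ 2) g
    rw [show (X : ℝ[X]) ^ 3 = X * X ^ 2 by ring, this, hH2]
    have h2 : derivative (X ^ 2 : ℝ[X]) = C 2 * X := by
      refine Polynomial.funext fun t => ?_
      simp
      norm_num
    rw [h2, hC, hH1]
    ring
  set g := derivative (statPoly a b) with hg
  have hg1 : derivative g = C (6 * a) * X + C (12 * b) * X ^ 2 :=
    derivative_derivative_statPoly a b
  have hg2 : derivative (derivative g) = C (6 * a) * 1 + C (24 * b) * X := by
    rw [hg1]
    refine Polynomial.funext fun t => ?_
    simp
    ring
  have hg3 : derivative (derivative (derivative g)) = C (24 * b) * 1 := by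
    rw [hg2]
    simp
  have hq : steinPoly a b = C a * X ^ 2 + (C (-a) * 1 + (C b * X ^ 3 + C (3 * b) * X)) := by
    simp only [steinPoly, map_mul, map_neg]
    ring
  change A (steinPoly a b) g = _
  rw [hq, hadd, hadd, hadd, hC, hC, hC, hC, hH2, hH3, hH1, hg3, hg2, hg1]
  simp only [hadd', hC', h11, h1X, h1XX]
  ring

lemma integral_formStat (hμ : μ[id] = 0) (hone : ∀ k, ∫ x, x k * x k ∂μ = 1) (c a b : ℝ) :
    ∫ x, formStat c (fun k l => ∫ x, x k * x l ∂μ) (steinPoly a b)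
        (derivative (statPoly a b)) x ∂μ =
      c ^ 2 * ∑ k, ∑ l, (6 * a ^ 2 * (∫ x, x k * x l ∂μ) ^ 3 +
        b ^ 2 * (72 * (∫ x, x k * x l ∂μ) ^ 2 + 24 * (∫ x, x k * x l ∂μ) ^ 4)) := by
  have hi : ∀ k l, Integrable (fun x : ι → ℝ => (∫ x, x k * x l ∂μ) *
      ((steinPoly a b).eval (x k) * (derivative (statPoly a b)).eval (x l))) μ := fun k l =>
    (((polyGrowth_eval_comp k _).mul (polyGrowth_eval_comp l _)).integrable_of_continuous
      (by fun_prop)).const_mul _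
  simp only [formStat]
  rw [integral_const_mul, integral_finsetSum _ fun k _ => integrable_finsetSum _ fun l _ => hi k l]
  simp_rw [integral_finsetSum _ fun l _ => hi _ l, integral_const_mul,
    integral_stein_mul_derivative_stat hμ hone]
  congr 1
  refine Finset.sum_congr rfl fun k _ => Finset.sum_congr rfl fun l _ => ?_
  ring

/-- A quantitative central limit theorem for sums of `a H₃ (x_k) + b (x_k⁴ - 3)` over a Gaussian
vector with a bounded covariance operator. -/
theorem exists_norm_charFun_addStat_sub_le {B : ℝ} (hB : 1 ≤ B) {C₀ : ℝ} (hC₀ : 0 < C₀) :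
    ∃ K : ℝ, ∀ (ι : Type) [Fintype ι] [Nonempty ι] (μ : Measure (ι → ℝ)) [IsGaussian μ],
      μ[id] = 0 → (∀ k, ∫ x, x k * x k ∂μ = 1) →
      (∀ v : ι → ℝ, ∫ x, (∑ k, v k * x k) ^ 2 ∂μ ≤ C₀ * ∑ k, v k ^ 2) →
      ∀ a b v : ℝ, |a| ≤ B → |b| ≤ B → 0 ≤ v →
      1 / (Fintype.card ι : ℝ) * ∑ k, ∑ l, (6 * a ^ 2 * (∫ x, x k * x l ∂μ) ^ 3 +
        b ^ 2 * (72 * (∫ x, x k * x l ∂μ) ^ 2 + 24 * (∫ x, x k * x l ∂μ) ^ 4)) = v →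
      ‖∫ x, Complex.exp (Complex.I * addStat (1 / √(Fintype.card ι)) (statPoly a b) x) ∂μ -
        Complex.exp (-v / 2)‖ ≤ √(K / √(Fintype.card ι)) := by
  -- A common majorant: `q`, `p'`, `q'`, `p''` have degree at most three, with absolute coefficient
  -- sums at most `18 B`, and `|t|^i ≤ (1 + t²)²` for `i ≤ 3`. Its moment `M` depends on `B` alone
  -- because every coordinate is standard normal, so the constant is uniform in the vector.
  set h : ℝ[X] := C (24 * B) * (1 + X ^ 2) ^ 2 with hh
  have heval : ∀ t, h.eval t = 24 * B * (1 + t ^ 2) ^ 2 := fun t => by simp [hh]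
  set M := ∫ t, h.eval t ^ 8 ∂(gaussianReal 0 1) with hM
  refine ⟨8 * C₀ ^ 3 * M, ?_⟩
  intro ι _ _ μ _ hμ hone hcov a b v ha hb hv hval
  set c : ℝ := 1 / √(Fintype.card ι) with hc
  have hc2 : c ^ 2 = 1 / (Fintype.card ι : ℝ) := by
    rw [hc, div_pow, Real.sq_sqrt (by positivity)]
    simp
  set ρ : ι → ι → ℝ := fun k l => ∫ x, x k * x l ∂μ with hρ
  have hEΓ := integral_formStat hμ hone c a b
  rw [hc2, hval] at hEΓ
  have hmarg : ∀ k, ∫ x, h.eval (x k) ^ 8 ∂μ = M := by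
    intro k
    have hL := IsGaussian.map_eq_gaussianReal (μ := μ)
      (ContinuousLinearMap.proj (R := ℝ) (φ := fun _ : ι => ℝ) k)
    have hm : μ[ContinuousLinearMap.proj (R := ℝ) (φ := fun _ : ι => ℝ) k] = 0 := by
      rw [IsGaussian.integral_dual]
      simp only [id] at hμ
      rw [hμ, map_zero]
    have hvar : Var[ContinuousLinearMap.proj (R := ℝ) (φ := fun _ : ι => ℝ) k; μ] = 1 := by
      rw [variance_of_integral_eq_zero (by fun_prop) hm, ← hone k]
      simp [sq]
    rw [hm, hvar, Real.toNNReal_one] at hL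
    rw [hM, ← hL, integral_map (by fun_prop) (by fun_prop)]
    simp
  have w1 : ∀ t : ℝ, 1 ≤ (1 + t ^ 2) ^ 2 ∧ |t| ≤ (1 + t ^ 2) ^ 2 ∧ |t| ^ 2 ≤ (1 + t ^ 2) ^ 2 ∧
      |t| ^ 3 ≤ (1 + t ^ 2) ^ 2 := by
    intro t
    rw [← sq_abs t]
    have := abs_nonneg t
    set u := |t|
    refine ⟨by nlinarith [sq_nonneg u], by nlinarith [sq_nonneg (u - 1), sq_nonneg (u ^ 2)],
      by nlinarith [sq_nonneg u, sq_nonneg (u ^ 2)], ?_⟩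
    nlinarith [sq_nonneg u, sq_nonneg (u ^ 2 - u), sq_nonneg (u ^ 2)]
  have habs : ∀ n : ℝ, 0 ≤ n → ∀ z : ℝ, |n * z| = n * |z| := fun n hn z => by
    rw [abs_mul, abs_of_nonneg hn]
  have w3 : ∀ t : ℝ, ∀ α β γ δ : ℝ, |α| + |β| + |γ| + |δ| ≤ 24 * B →
      |α + β * t + γ * t ^ 2 + δ * t ^ 3| ≤ h.eval t := by
    intro t α β γ δ hs
    rw [heval]
    obtain ⟨q0, q1, q2, q3⟩ := w1 t
    calc |α + β * t + γ * t ^ 2 + δ * t ^ 3| ≤ |α| + |β * t| + |γ * t ^ 2| + |δ * t ^ 3| := by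
          refine (abs_add_le _ _).trans (add_le_add ((abs_add_le _ _).trans
            (add_le_add (abs_add_le _ _) le_rfl)) le_rfl)
      _ = |α| * 1 + |β| * |t| + |γ| * |t| ^ 2 + |δ| * |t| ^ 3 := by
          simp only [abs_mul, abs_pow, mul_one]
      _ ≤ |α| * (1 + t ^ 2) ^ 2 + |β| * (1 + t ^ 2) ^ 2 + |γ| * (1 + t ^ 2) ^ 2 +
          |δ| * (1 + t ^ 2) ^ 2 := by gcongr
      _ = (|α| + |β| + |γ| + |δ|) * (1 + t ^ 2) ^ 2 := by ring
      _ ≤ _ := by gcongr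
  have hvarΓ := variance_formStat_le (q := steinPoly a b) (r := derivative (statPoly a b))
    (h := h) (M := M) hμ hC₀ hc2 hcov
    (fun t => by rw [heval]; nlinarith [(w1 t).1])
    (fun t => by
      have := w3 t (-a) (3 * b) a b (by
        rw [abs_neg, habs 3 (by norm_num)]; linarith)
      convert this using 2
      simp [steinPoly]; ring)
    (fun t => by
      rw [derivative_statPoly]
      have := w3 t (-(3 * a)) 0 (3 * a) (4 * b) (by
        rw [abs_neg, habs 3 (by norm_num), habs 4 (by norm_num), abs_zero]; linarith)
      convert this using 2
      simp; ring)
    (fun t => by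
      rw [derivative_steinPoly]
      have := w3 t (3 * b) (2 * a) (3 * b) 0 (by
        rw [habs 3 (by norm_num), habs 2 (by norm_num), abs_zero]; linarith)
      convert this using 2
      simp; ring)
    (fun t => by
      rw [derivative_derivative_statPoly]
      have := w3 t 0 (6 * a) (12 * b) 0 (by
        rw [habs 6 (by norm_num), habs 12 (by norm_num), abs_zero]; linarith)
      convert this using 2
      simp)
    (fun k => (hmarg k).le)
  rw [hEΓ] at hvarΓ
  set Γ : (ι → ℝ) → ℝ := formStat c ρ (steinPoly a b) (derivative (statPoly a b)) with hΓ
  have hΓc : Continuous Γ := continuous_formStat _ _ _ _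
  have hΓg : PolyGrowth Γ := polyGrowth_formStat _ _ _ _
  refine (norm_integral_cexp_sub_le (continuous_addStat _ _) (polyGrowth_addStat _ _) hΓc hΓg
    (fun s => integral_addStat_mul_cexp hμ hone c s (X_mul_steinPoly_sub a b)) hv).trans ?_
  -- The mean of `Γ` is `v`, so `E |Γ - v|` is at most the square root of the variance just bounded.
  refine Real.le_sqrt_of_sq_le (le_trans ?_ hvarΓ)
  have hmem : MemLp (fun x => |Γ x - v|) 2 μ := by
    rw [memLp_two_iff_integrable_sq (by fun_prop)]
    simp_rw [sq_abs]
    exact ((hΓg.sub (PolyGrowth.const v)).pow 2).integrable_of_continuous (by fun_prop)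
  have hvv := variance_nonneg (fun x => |Γ x - v|) μ
  rw [variance_eq_sub hmem] at hvv
  simp only [Pi.pow_apply, sq_abs] at hvv
  linarith

end CharFun

/-! ### Integrals of the field against test functions; orthogonality of the Fourier coefficients. -/

section FieldIntegral

open AddCircle

variable {Ω : Type*} [MeasurableSpace Ω] {P : Measure Ω} {X : Torus → Ω → ℝ}

/-- `∫ f (ϑ) X (ϑ) dϑ / 2π` for a complex-valued test function `f`. -/
noncomputable def fieldInt (X : Torus → Ω → ℝ) (f : Torus → ℂ) (ω : Ω) : ℂ :=
  ∫ θ : Torus, f θ * (X θ ω : ℂ) ∂haarAddCircle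

/-- `∫ f (ϑ) X (ϑ) dϑ / 2π` for a real-valued test function `f`. -/
noncomputable def fieldIntReal (X : Torus → Ω → ℝ) (f : Torus → ℝ) (ω : Ω) : ℝ :=
  ∫ θ : Torus, f θ * X θ ω ∂haarAddCircle

lemma fieldInt_ofReal (f : Torus → ℝ) (ω : Ω) :
    fieldInt X (fun θ => (f θ : ℂ)) ω = (fieldIntReal X f ω : ℂ) := by
  rw [fieldInt, fieldIntReal, ← integral_complex_ofReal]
  simp

lemma coeff_eq_fieldInt (l : ℤ) (ω : Ω) : coeff X l ω = fieldInt X (fun θ => fourier (-l) θ) ω := by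
  simp [coeff, fourierCoeff, fieldInt]

lemma exists_norm_le_of_continuous {E : Type*} [NormedAddCommGroup E] {f : Torus → E}
    (hf : Continuous f) : ∃ B, 0 ≤ B ∧ ∀ θ, ‖f θ‖ ≤ B := by
  obtain ⟨B, hB⟩ := isCompact_univ.exists_bound_of_continuousOn (hf.continuousOn (s := Set.univ))
  exact ⟨|B|, abs_nonneg _, fun θ => (hB θ (Set.mem_univ _)).trans (le_abs_self B)⟩

/-- The covariance function of the field. -/
noncomputable def fieldCov (P : Measure Ω) (X : Torus → Ω → ℝ) (θ θ' : Torus) : ℝ :=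
  ∫ ω, X θ ω * X θ' ω ∂P

namespace IsIsotropicField

variable (hX : IsIsotropicField P X)
include hX

lemma fieldCov_add (θ θ' h : Torus) : fieldCov P X (θ + h) (θ' + h) = fieldCov P X θ θ' := by
  have := ((hX.isotropic h 2 ![θ, θ']).comp (u := fun x : Fin 2 → ℝ => x 0 * x 1)
    (by fun_prop)).integral_eq
  simpa [Function.comp_def, fieldCov] using this

lemma integral_apply_eq (θ : Torus) : ∫ ω, X θ ω ∂P = ∫ ω, X 0 ω ∂P := by
  have := ((hX.isotropic θ 1 ![0]).comp (u := fun x : Fin 1 → ℝ => x 0) (by fun_prop)).integral_eq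
  simpa [Function.comp_def] using this

variable [IsProbabilityMeasure P]

/-- By isotropy `E X(θ)²` is the same for all `θ`, so it is integrable over the torus; Fubini then
makes almost every path square integrable. -/
lemma memLp_uncurry : MemLp (fun p : Torus × Ω => X p.1 p.2) 2 (haarAddCircle.prod P) := by
  rw [memLp_two_iff_integrable_sq hX.measurable.aestronglyMeasurable]
  rw [integrable_prod_iff (hX.measurable.pow_const 2).aestronglyMeasurable]
  refine ⟨ae_of_all _ fun θ => (hX.memLp θ).integrable_sq, ?_⟩
  have : ∀ θ, ∫ ω, ‖X θ ω ^ 2‖ ∂P = fieldCov P X 0 0 := by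
    intro θ
    rw [← hX.fieldCov_add 0 0 θ]
    simp [fieldCov, sq]
  simp_rw [this]
  exact integrable_const _

lemma ae_memLp : ∀ᵐ ω ∂P, MemLp (fun θ => X θ ω) 2 (haarAddCircle : Measure Torus) := by
  filter_upwards [hX.memLp_uncurry.integrable_sq.prod_left_ae] with ω hω
  have hm : Measurable fun θ => X θ ω := hX.measurable.comp measurable_prodMk_right
  exact (memLp_two_iff_integrable_sq hm.aestronglyMeasurable).2 hω

/-- One null set serves all test functions. On it a Bochner integral may take its default value `0`,
which is why linearity in the test function is asserted below only almost surely. -/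
lemma ae_integrable_mul : ∀ᵐ ω ∂P, ∀ f : Torus → ℂ, Continuous f →
    Integrable (fun θ => f θ * (X θ ω : ℂ)) (haarAddCircle : Measure Torus) := by
  filter_upwards [hX.ae_memLp] with ω hω f hf
  obtain ⟨B, -, hB⟩ := exists_norm_le_of_continuous hf
  exact (hω.integrable (by norm_num)).ofReal.bdd_mul hf.aestronglyMeasurable (ae_of_all _ hB)

lemma measurable_fieldInt {f : Torus → ℂ} (hf : Continuous f) : Measurable (fieldInt X f) := by
  have : StronglyMeasurable fun p : Torus × Ω => f p.1 * (X p.1 p.2 : ℂ) :=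
    ((hf.measurable.comp measurable_fst).mul
      (Complex.measurable_ofReal.comp hX.measurable)).stronglyMeasurable
  exact (this.integral_prod_left (μ := haarAddCircle)).measurable

lemma memLp_fieldInt {f : Torus → ℂ} (hf : Continuous f) : MemLp (fieldInt X f) 2 P := by
  obtain ⟨B, hB0, hB⟩ := exists_norm_le_of_continuous hf
  have hi : Integrable (fun ω => B ^ 2 * ∫ θ, X θ ω ^ 2 ∂(haarAddCircle : Measure Torus)) P :=
    hX.memLp_uncurry.integrable_sq.integral_prod_right.const_mul _
  rw [memLp_two_iff_integrable_sq_norm (hX.measurable_fieldInt hf).aestronglyMeasurable]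
  refine hi.mono' ((hX.measurable_fieldInt hf).norm.pow_const 2).aestronglyMeasurable ?_
  filter_upwards [hX.ae_memLp] with ω hω
  rw [norm_pow, norm_norm, ← Real.sqrt_le_sqrt_iff (by positivity), Real.sqrt_sq (norm_nonneg _),
    Real.sqrt_mul (by positivity), Real.sqrt_sq hB0]
  have h1 : ‖fieldInt X f ω‖ ≤ ∫ θ, B * |X θ ω| ∂(haarAddCircle : Measure Torus) := by
    refine norm_integral_le_of_norm_le ((hω.integrable (by norm_num)).abs.const_mul B)
      (ae_of_all _ fun θ => ?_)
    rw [norm_mul, Complex.norm_real, Real.norm_eq_abs]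
    gcongr
    exact hB θ
  refine h1.trans ?_
  rw [integral_const_mul]
  gcongr
  refine Real.le_sqrt_of_sq_le ?_
  have h2 := variance_nonneg (fun θ => |X θ ω|) (haarAddCircle : Measure Torus)
  have h3 : MemLp (fun θ => |X θ ω|) 2 (haarAddCircle : Measure Torus) := hω.abs
  rw [variance_eq_sub h3] at h2
  simp only [Pi.pow_apply, sq_abs] at h2
  linarith

lemma integral_mul_fieldInt {f : Torus → ℂ} (hf : Continuous f) {Y : Ω → ℂ} (hY : MemLp Y 2 P) :
    ∫ ω, Y ω * fieldInt X f ω ∂P =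
      ∫ θ : Torus, f θ * ∫ ω, Y ω * (X θ ω : ℂ) ∂P ∂haarAddCircle := by
  obtain ⟨B, hB0, hB⟩ := exists_norm_le_of_continuous hf
  have hY' : MemLp (fun p : Torus × Ω => Y p.2) 2 (haarAddCircle.prod P) :=
    hY.comp_measurePreserving measurePreserving_snd
  have hX' : MemLp (fun p : Torus × Ω => (X p.1 p.2 : ℂ)) 2 (haarAddCircle.prod P) :=
    hX.memLp_uncurry.ofReal
  have hi : Integrable (fun p : Torus × Ω => f p.1 * (Y p.2 * (X p.1 p.2 : ℂ)))
      (haarAddCircle.prod P) := by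
    refine (hY'.integrable_mul hX').bdd_mul ?_ (ae_of_all _ fun p => hB p.1)
    exact (hf.measurable.comp measurable_fst).aestronglyMeasurable
  simp_rw [fieldInt, ← integral_const_mul]
  rw [integral_integral_swap (f := fun θ ω => f θ * (Y ω * (X θ ω : ℂ))) hi]
  simp_rw [mul_left_comm]

/-- Isotropy makes `E X(θ)` constant in `θ`, and `E w_0 = 0` says that this constant is zero. -/
lemma integral_fieldInt {f : Torus → ℂ} (hf : Continuous f) :
    ∫ ω, fieldInt X f ω ∂P = 0 := by
  have h : ∀ f : Torus → ℂ, Continuous f → ∫ ω, fieldInt X f ω ∂P =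
      (∫ θ : Torus, f θ ∂haarAddCircle) * ((∫ ω, X 0 ω ∂P : ℝ) : ℂ) := by
    intro f hf
    have := hX.integral_mul_fieldInt hf (Y := fun _ => 1) (memLp_const 1)
    simp only [one_mul] at this
    rw [this]
    simp_rw [integral_complex_ofReal, hX.integral_apply_eq]
    rw [integral_mul_const]
  have h0 := hX.mean_zero 0
  simp_rw [coeff_eq_fieldInt] at h0
  rw [h _ (by fun_prop)] at h0
  simp only [neg_zero, fourier_zero, integral_const, probReal_univ, one_smul, one_mul] at h0
  rw [h f hf, h0, mul_zero]

lemma integral_apply (θ : Torus) : ∫ ω, X θ ω ∂P = 0 := by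
  have h := hX.integral_fieldInt (f := fun _ => 1) continuous_const
  have := hX.integral_mul_fieldInt (f := fun _ => 1) continuous_const (Y := fun _ => 1)
    (memLp_const 1)
  simp only [one_mul, integral_complex_ofReal, hX.integral_apply_eq, integral_const, probReal_univ,
    one_smul] at this
  rw [h] at this
  rw [hX.integral_apply_eq]
  exact_mod_cast this.symm

omit [IsProbabilityMeasure P] in
omit hX in
lemma coeff_neg (l : ℤ) (ω : Ω) : coeff X (-l) ω = starRingEnd ℂ (coeff X l ω) := by
  simp only [coeff, fourierCoeff, smul_eq_mul, neg_neg]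
  rw [← integral_conj]
  simp

omit [IsProbabilityMeasure P] in
omit hX in
lemma powerSpectrum_neg (l : ℤ) : powerSpectrum P X (-l) = powerSpectrum P X l := by
  simp [powerSpectrum, coeff_neg]

lemma measurable_coeff (l : ℤ) : Measurable (coeff X l) := by
  have : coeff X l = fieldInt X (fun θ => fourier (-l) θ) := funext fun ω => coeff_eq_fieldInt l ω
  rw [this]
  exact hX.measurable_fieldInt (by fun_prop)

lemma memLp_coeff (l : ℤ) : MemLp (coeff X l) 2 P := by
  have : coeff X l = fieldInt X (fun θ => fourier (-l) θ) := funext fun ω => coeff_eq_fieldInt l ω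
  rw [this]
  exact hX.memLp_fieldInt (by fun_prop)

/-- Stationarity: translating the integration variable gives `E [w_l X(θ')] = e^{-ilθ'} κ`, and
integrating against `e^{-imθ'}` leaves the mean of a nontrivial character. -/
lemma integral_coeff_mul_coeff_of_ne {l m : ℤ} (h : l + m ≠ 0) :
    ∫ ω, coeff X l ω * coeff X m ω ∂P = 0 := by
  set κ : ℂ := ∫ θ : Torus, fourier (-l) θ * (fieldCov P X θ 0 : ℂ) ∂haarAddCircle with hκ
  have h1 : ∀ θ' : Torus, ∫ ω, coeff X l ω * (X θ' ω : ℂ) ∂P = fourier (-l) θ' * κ := by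
    intro θ'
    have := hX.integral_mul_fieldInt (f := fun θ => fourier (-l) θ) (by fun_prop)
      (Y := fun ω => (X θ' ω : ℂ)) (hX.memLp θ').ofReal
    have e : ∀ ω, coeff X l ω * (X θ' ω : ℂ) = X θ' ω * fieldInt X (fun θ => fourier (-l) θ) ω :=
      fun ω => by rw [coeff_eq_fieldInt, mul_comm]
    simp_rw [e]
    rw [this]
    have e2 : ∀ θ, ∫ ω, (X θ' ω : ℂ) * (X θ ω : ℂ) ∂P = (fieldCov P X θ θ' : ℂ) := by
      intro θ
      rw [fieldCov, ← integral_complex_ofReal]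
      congr 1
      ext ω
      push_cast
      ring
    simp_rw [e2]
    rw [← integral_add_right_eq_self _ θ', hκ, ← integral_const_mul]
    congr 1
    ext θ
    have e3 : fourier (-l) (θ + θ') = fourier (-l) θ' * (fourier (-l) θ : ℂ) := by
      simp only [fourier_apply, smul_add, toCircle_add, Circle.coe_mul]
      ring
    have e4 := hX.fieldCov_add θ 0 θ'
    rw [zero_add] at e4
    rw [e3, e4]
    ring
  have h2 := hX.integral_mul_fieldInt (f := fun θ => fourier (-m) θ) (by fun_prop)
    (hX.memLp_coeff l)
  simp_rw [coeff_eq_fieldInt m]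
  rw [h2]
  simp_rw [h1]
  have e : ∀ θ : Torus, fourier (-m) θ * (fourier (-l) θ * κ) = fourier (-(l + m)) θ * κ := by
    intro θ
    rw [neg_add, fourier_add]
    ring
  simp_rw [e]
  rw [integral_mul_const]
  have hz : ∫ θ : Torus, fourier (-(l + m)) θ ∂haarAddCircle = 0 :=
    integral_eq_zero_of_add_right_eq_neg
      (fourier_add_half_inv_index (neg_ne_zero.2 h) Real.two_pi_pos)
  rw [hz, zero_mul]

lemma integral_coeff_mul_coeff (l m : ℤ) :
    ∫ ω, coeff X l ω * coeff X m ω ∂P = if m = -l then (powerSpectrum P X l : ℂ) else 0 := by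
  split_ifs with h
  · rw [h, powerSpectrum, ← integral_complex_ofReal]
    congr 1
    ext ω
    rw [coeff_neg, Complex.mul_conj, Complex.normSq_eq_norm_sq]
  · exact hX.integral_coeff_mul_coeff_of_ne fun h' => h (by linarith)

end IsIsotropicField

end FieldIntegral

/-! ### Integrals of a Gaussian field are jointly Gaussian. -/

section GaussianField

open AddCircle

variable {Ω : Type*} [MeasurableSpace Ω] {P : Measure Ω} {X : Torus → Ω → ℝ}

lemma integral_abs_le_sqrt [IsProbabilityMeasure P] {f : Ω → ℝ} (hf : MemLp f 2 P) :
    ∫ ω, |f ω| ∂P ≤ √(∫ ω, f ω ^ 2 ∂P) := by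
  refine Real.le_sqrt_of_sq_le ?_
  have h := variance_nonneg (fun ω => |f ω|) P
  have hf' : MemLp (fun ω => |f ω|) 2 P := hf.abs
  rw [variance_eq_sub hf'] at h
  simp only [Pi.pow_apply, sq_abs] at h
  linarith

lemma norm_cexp_I_mul_sub_le (a b : ℝ) :
    ‖Complex.exp (Complex.I * a) - Complex.exp (Complex.I * b)‖ ≤ |a - b| := by
  have h : Complex.exp (Complex.I * a) - Complex.exp (Complex.I * b) =
      Complex.exp (Complex.I * b) * (Complex.exp (Complex.I * (a - b : ℝ)) - 1) := by
    rw [mul_sub, ← Complex.exp_add, mul_one]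
    push_cast
    ring_nf
  rw [h, norm_mul, mul_comm Complex.I (b : ℂ), Complex.norm_exp_ofReal_mul_I, one_mul]
  exact Real.norm_exp_I_mul_ofReal_sub_one_le

/-- The characteristic function at `1` is continuous on `L²`. -/
lemma continuous_integral_cexp_Lp [IsProbabilityMeasure P] :
    Continuous fun g : Lp ℝ 2 P => ∫ ω, Complex.exp (Complex.I * g ω) ∂P := by
  refine LipschitzWith.continuous (K := 1) (LipschitzWith.of_dist_le_mul fun g g' => ?_)
  have hi : ∀ g : Lp ℝ 2 P, Integrable (fun ω => Complex.exp (Complex.I * g ω)) P := fun g => by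
    refine Integrable.of_bound (C := 1) ?_ (ae_of_all _ fun ω => ?_)
    · have := (Lp.stronglyMeasurable g).measurable
      exact Measurable.aestronglyMeasurable (by fun_prop)
    · rw [mul_comm, Complex.norm_exp_ofReal_mul_I]
  rw [dist_eq_norm, ← integral_sub (hi g) (hi g'), NNReal.coe_one, one_mul, dist_eq_norm]
  have hm := Lp.memLp (g - g')
  have h1 : ‖g - g'‖ = √(∫ ω, (g - g') ω ^ 2 ∂P) := by
    rw [← Real.sqrt_sq (norm_nonneg (g - g')), ← real_inner_self_eq_norm_sq, L2.inner_def]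
    simp [sq]
  rw [h1]
  refine le_trans ?_ (integral_abs_le_sqrt hm)
  refine norm_integral_le_of_norm_le (hm.integrable (by norm_num)).abs ?_
  filter_upwards [Lp.coeFn_sub g g'] with ω hω
  rw [hω]
  exact norm_cexp_I_mul_sub_le _ _

lemma integral_cexp_I_mul_of_hasGaussianLaw {Y : Ω → ℝ} (hY : HasGaussianLaw Y P)
    (hm : ∫ ω, Y ω ∂P = 0) :
    ∫ ω, Complex.exp (Complex.I * Y ω) ∂P = Complex.exp (-((∫ ω, Y ω ^ 2 ∂P : ℝ) : ℂ) / 2) := by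
  have h := hY.map_eq_gaussianReal
  have h2 := congrArg (fun μ => charFun μ (1 : ℝ)) h
  simp only [charFun_gaussianReal] at h2
  rw [charFun_apply_real, integral_map hY.aemeasurable (by fun_prop)] at h2
  rw [hm, variance_of_integral_eq_zero hY.aemeasurable hm,
    Real.coe_toNNReal _ (integral_nonneg fun ω => sq_nonneg _)] at h2
  simp only [Complex.ofReal_one, one_mul, Complex.ofReal_zero, mul_zero, zero_mul, zero_sub,
    one_pow, mul_one] at h2
  simp_rw [mul_comm Complex.I]
  rw [h2, neg_div]

namespace IsIsotropicField

variable (hX : IsIsotropicField P X) [IsProbabilityMeasure P]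
include hX

lemma memLp_fieldIntReal {f : Torus → ℝ} (hf : Continuous f) : MemLp (fieldIntReal X f) 2 P := by
  have h := hX.memLp_fieldInt (f := fun θ => (f θ : ℂ)) (by fun_prop)
  have h2 := h.re
  refine h2.ae_eq (ae_of_all _ fun ω => ?_)
  simp [fieldInt_ofReal]

lemma measurable_fieldIntReal {f : Torus → ℝ} (hf : Continuous f) :
    Measurable (fieldIntReal X f) := by
  have h := Complex.measurable_re.comp
    (hX.measurable_fieldInt (f := fun θ => (f θ : ℂ)) (by fun_prop))
  have e : Complex.re ∘ fieldInt X (fun θ => (f θ : ℂ)) = fieldIntReal X f := by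
    ext ω
    simp [fieldInt_ofReal]
  rwa [e] at h

lemma integral_fieldIntReal {f : Torus → ℝ} (hf : Continuous f) :
    ∫ ω, fieldIntReal X f ω ∂P = 0 := by
  have h := hX.integral_fieldInt (f := fun θ => (f θ : ℂ)) (by fun_prop)
  simp_rw [fieldInt_ofReal, integral_complex_ofReal] at h
  exact_mod_cast h

lemma integral_mul_fieldIntReal {f : Torus → ℝ} (hf : Continuous f) {Y : Ω → ℝ}
    (hY : MemLp Y 2 P) :
    ∫ ω, Y ω * fieldIntReal X f ω ∂P =
      ∫ θ : Torus, f θ * ∫ ω, Y ω * X θ ω ∂P ∂haarAddCircle := by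
  have h := hX.integral_mul_fieldInt (f := fun θ => (f θ : ℂ)) (by fun_prop) hY.ofReal
  simp_rw [fieldInt_ofReal] at h
  apply Complex.ofReal_injective
  rw [← integral_complex_ofReal, ← integral_complex_ofReal]
  simp_rw [Complex.ofReal_mul, ← integral_complex_ofReal, Complex.ofReal_mul]
  exact h

/-- By Fubini, a variable orthogonal to every `X θ` is orthogonal to the integral, so the integral
lies in the double orthogonal complement of the span. No continuity of paths and no Riemann sums are
involved. -/
lemma toLp_fieldIntReal_mem {f : Torus → ℝ} (hf : Continuous f) :
    (hX.memLp_fieldIntReal hf).toLp ∈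
      (Submodule.span ℝ (Set.range fun θ => (hX.memLp θ).toLp)).topologicalClosure := by
  rw [← Submodule.orthogonal_orthogonal_eq_closure, Submodule.mem_orthogonal]
  intro Y hY
  rw [L2.inner_def]
  have h1 : ∀ θ, ∫ ω, Y ω * X θ ω ∂P = 0 := by
    intro θ
    have := (Submodule.mem_orthogonal _ _).1 hY _ (Submodule.subset_span ⟨θ, rfl⟩)
    rw [L2.inner_def] at this
    rw [← this]
    refine integral_congr_ae ?_
    filter_upwards [(hX.memLp θ).coeFn_toLp] with ω hω
    simp [hω]
  have h2 := hX.integral_mul_fieldIntReal hf (Lp.memLp Y)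
  simp only [h1, mul_zero, integral_zero] at h2
  rw [← h2]
  refine integral_congr_ae ?_
  filter_upwards [(hX.memLp_fieldIntReal hf).coeFn_toLp] with ω hω
  rw [hω]
  simp [mul_comm]

lemma integral_cexp_Lp_of_mem_span (hB : IsGaussianProcess X P) {g : Lp ℝ 2 P}
    (hg : g ∈ Submodule.span ℝ (Set.range fun θ => (hX.memLp θ).toLp)) :
    ∫ ω, Complex.exp (Complex.I * g ω) ∂P = Complex.exp (-((‖g‖ ^ 2 : ℝ) : ℂ) / 2) := by
  obtain ⟨c, hc⟩ := Finsupp.mem_span_range_iff_exists_finsupp.1 hg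
  have hcoe : (fun ω => ∑ θ ∈ c.support, c θ * X θ ω) =ᵐ[P] g := by
    rw [← hc, Finsupp.sum]
    have h1 := Lp.coeFn_finsetSum (p := 2) (μ := P) c.support
      (fun θ => c θ • (hX.memLp θ).toLp)
    have h2 : ∀ᵐ ω ∂P, ∀ θ ∈ c.support, (c θ • (hX.memLp θ).toLp : Lp ℝ 2 P) ω = c θ * X θ ω := by
      rw [Filter.eventually_all_finset]
      intro θ _
      filter_upwards [Lp.coeFn_smul (c θ) ((hX.memLp θ).toLp), (hX.memLp θ).coeFn_toLp] with ω h3 h4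
      rw [h3, Pi.smul_apply, h4, smul_eq_mul]
    filter_upwards [h1, h2] with ω h3 h4
    rw [h3, Finset.sum_apply]
    exact Finset.sum_congr rfl fun θ hθ => (h4 θ hθ).symm
  have hG : HasGaussianLaw (fun ω => ∑ θ ∈ c.support, c θ * X θ ω) P :=
    (hB.smul c).hasGaussianLaw_fun_sum (I := c.support)
  have hmean : ∫ ω, ∑ θ ∈ c.support, c θ * X θ ω ∂P = 0 := by
    rw [integral_finsetSum _ fun θ _ => ((hX.memLp θ).integrable (by norm_num)).const_mul _]
    refine Finset.sum_eq_zero fun θ _ => ?_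
    rw [integral_const_mul, hX.integral_apply, mul_zero]
  have h := integral_cexp_I_mul_of_hasGaussianLaw hG hmean
  have h5 : ∫ ω, (∑ θ ∈ c.support, c θ * X θ ω) ^ 2 ∂P = ‖g‖ ^ 2 := by
    rw [← real_inner_self_eq_norm_sq, L2.inner_def]
    refine integral_congr_ae ?_
    filter_upwards [hcoe] with ω hω
    rw [hω]
    simp [sq]
  rw [h5] at h
  rw [← h]
  refine integral_congr_ae ?_
  filter_upwards [hcoe] with ω hω
  rw [hω]

/-- The identity `E e^{ig} = e^{-‖g‖²/2}` is a closed condition on `g ∈ L²`, true on the span of the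
field since finite combinations are centred Gaussian, hence true on its closure. -/
lemma integral_cexp_fieldIntReal (hB : IsGaussianProcess X P) {f : Torus → ℝ}
    (hf : Continuous f) :
    ∫ ω, Complex.exp (Complex.I * fieldIntReal X f ω) ∂P =
      Complex.exp (-((∫ ω, fieldIntReal X f ω ^ 2 ∂P : ℝ) : ℂ) / 2) := by
  have hclosed : IsClosed {g : Lp ℝ 2 P | ∫ ω, Complex.exp (Complex.I * g ω) ∂P =
      Complex.exp (-((‖g‖ ^ 2 : ℝ) : ℂ) / 2)} :=
    isClosed_eq continuous_integral_cexp_Lp (by fun_prop)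
  have hmem : ∫ ω, Complex.exp (Complex.I * ((hX.memLp_fieldIntReal hf).toLp : Lp ℝ 2 P) ω) ∂P =
      Complex.exp (-((‖(hX.memLp_fieldIntReal hf).toLp‖ ^ 2 : ℝ) : ℂ) / 2) := closure_minimal (fun g hg => hX.integral_cexp_Lp_of_mem_span hB hg) hclosed
    (hX.toLp_fieldIntReal_mem hf)
  have hcoe := (hX.memLp_fieldIntReal hf).coeFn_toLp
  have h5 : ‖(hX.memLp_fieldIntReal hf).toLp‖ ^ 2 = ∫ ω, fieldIntReal X f ω ^ 2 ∂P := by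
    rw [← real_inner_self_eq_norm_sq, L2.inner_def]
    refine integral_congr_ae ?_
    filter_upwards [hcoe] with ω hω
    rw [hω]
    simp [sq]
  rw [h5] at hmem
  rw [← hmem]
  refine integral_congr_ae ?_
  filter_upwards [hcoe] with ω hω
  rw [hω]

/-- Integrals of the field against continuous functions are centered Gaussian variables. -/
theorem map_fieldIntReal (hB : IsGaussianProcess X P) {f : Torus → ℝ} (hf : Continuous f) :
    P.map (fieldIntReal X f) =
      gaussianReal 0 (∫ ω, fieldIntReal X f ω ^ 2 ∂P).toNNReal := by
  have hm := hX.measurable_fieldIntReal hf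
  have : IsProbabilityMeasure (P.map (fieldIntReal X f)) :=
    Measure.isProbabilityMeasure_map hm.aemeasurable
  refine Measure.ext_of_charFun ?_
  ext t
  -- The argument `t` of the characteristic function is absorbed into the test function.
  have h := hX.integral_cexp_fieldIntReal hB (f := fun θ => t * f θ) (by fun_prop)
  have e : ∀ ω, fieldIntReal X (fun θ => t * f θ) ω = t * fieldIntReal X f ω := fun ω => by
    simp only [fieldIntReal, mul_assoc, integral_const_mul]
  simp_rw [e, mul_pow, integral_const_mul] at h
  rw [charFun_apply_real, integral_map hm.aemeasurable (by fun_prop), charFun_gaussianReal,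
    Real.coe_toNNReal _ (integral_nonneg fun ω => sq_nonneg _)]
  have e2 : ∀ ω, (t : ℂ) * (fieldIntReal X f ω : ℂ) * Complex.I =
      Complex.I * ((t * fieldIntReal X f ω : ℝ) : ℂ) := fun ω => by
    push_cast
    ring
  simp_rw [e2]
  rw [h]
  congr 1
  push_cast
  ring

lemma ae_sum_mul_fieldIntReal {ι : Type*} [Fintype ι] {f : ι → Torus → ℝ}
    (hf : ∀ i, Continuous (f i)) (c : ι → ℝ) :
    (fun ω => ∑ i, c i * fieldIntReal X (f i) ω) =ᵐ[P]
      fieldIntReal X (fun θ => ∑ i, c i * f i θ) := by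
  filter_upwards [hX.ae_integrable_mul] with ω hω
  have hi : ∀ i, Integrable (fun θ => c i * (f i θ * X θ ω)) (haarAddCircle : Measure Torus) := by
    intro i
    have h := (hω (fun θ => (f i θ : ℂ)) (Complex.continuous_ofReal.comp (hf i))).re
    refine (h.congr (ae_of_all _ fun θ => ?_)).const_mul (c i)
    simp
  simp only [fieldIntReal, ← integral_const_mul]
  rw [← integral_finsetSum _ fun i _ => hi i]
  congr 1
  ext θ
  rw [Finset.sum_mul]
  exact Finset.sum_congr rfl fun i _ => by ring

/-- Integrals of the field against continuous functions are jointly Gaussian. -/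
theorem hasGaussianLaw_fieldIntReal (hB : IsGaussianProcess X P) {ι : Type*} [Fintype ι]
    {f : ι → Torus → ℝ} (hf : ∀ i, Continuous (f i)) :
    HasGaussianLaw (fun ω i => fieldIntReal X (f i) ω) P where
  isGaussian_map := by
    classical
    have hm : Measurable fun ω i => fieldIntReal X (f i) ω :=
      measurable_pi_lambda _ fun i => hX.measurable_fieldIntReal (hf i)
    -- Cramér–Wold: a linear functional of the vector is almost surely the integral of the field
    -- against one combination of the test functions.
    refine isGaussian_of_map_eq_gaussianReal fun L => ?_
    refine ⟨0, (∫ ω, fieldIntReal X (fun θ => ∑ i, L (Pi.single i 1) * f i θ) ω ^ 2 ∂P).toNNReal, ?_⟩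
    rw [← hX.map_fieldIntReal hB (by have := hf; fun_prop), Measure.map_map (by fun_prop) hm]
    refine Measure.map_congr ?_
    filter_upwards [hX.ae_sum_mul_fieldIntReal hf fun i => L (Pi.single i 1)] with ω hω
    rw [← hω, Function.comp_apply]
    conv_lhs => rw [pi_eq_sum_univ' (fun i => fieldIntReal X (f i) ω)]
    rw [map_sum]
    refine Finset.sum_congr rfl fun i _ => ?_
    rw [map_smul, smul_eq_mul, mul_comm]

end IsIsotropicField

end GaussianField

/-! ### Independence and moments of the normalized periodogram ordinates. -/

section Coefficients

open AddCircle

variable {Ω : Type*} [MeasurableSpace Ω] {P : Measure Ω} {X : Torus → Ω → ℝ}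

/-- The real and imaginary parts of `e^{-ilϑ}`. -/
noncomputable def trig (l : ℤ) (j : Fin 2) (θ : Torus) : ℝ :=
  ![(fourier (-l) θ : ℂ).re, (fourier (-l) θ : ℂ).im] j

lemma continuous_trig (l : ℤ) (j : Fin 2) : Continuous (trig l j) := by
  fin_cases j
  · exact Complex.continuous_re.comp (fourier (-l)).continuous
  · exact Complex.continuous_im.comp (fourier (-l)).continuous

/-- `|w_l|² / C_l`. -/
noncomputable def specRatio (P : Measure Ω) (X : Torus → Ω → ℝ) (l : ℤ) (ω : Ω) : ℝ :=
  ‖coeff X l ω‖ ^ 2 / powerSpectrum P X l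

lemma specRatio_nonneg (l : ℤ) (ω : Ω) : 0 ≤ specRatio P X l ω :=
  div_nonneg (sq_nonneg _) (integral_nonneg fun _ => sq_nonneg _)

/-- The field is real, so `w_{-l}` is the conjugate of `w_l`; the independent family is therefore
indexed by `ℕ` and signed frequencies enter through `natAbs`. -/
lemma specRatio_natAbs (l : ℤ) (ω : Ω) : specRatio P X (l.natAbs : ℤ) ω = specRatio P X l ω := by
  rcases Int.natAbs_eq l with h | h
  · rw [← h]
  · have h2 : (l.natAbs : ℤ) = -l := by omega
    rw [h2, specRatio, IsIsotropicField.powerSpectrum_neg, IsIsotropicField.coeff_neg,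
      RCLike.norm_conj, specRatio]

/-- Absolute moments of the standard Gaussian law. -/
noncomputable def gaussMoment (n : ℕ) : ℝ := ∫ x, x ^ (2 * n) ∂(gaussianReal 0 1)

namespace IsIsotropicField

variable (hX : IsIsotropicField P X) [IsProbabilityMeasure P]
include hX

lemma ae_coeff_eq : ∀ᵐ ω ∂P, ∀ l, (coeff X l ω).re = fieldIntReal X (trig l 0) ω ∧
    (coeff X l ω).im = fieldIntReal X (trig l 1) ω := by
  filter_upwards [hX.ae_integrable_mul] with ω hω l
  have hi := hω (fun θ => fourier (-l) θ) (by fun_prop)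
  have hre := integral_re hi
  have him := integral_im hi
  rw [coeff_eq_fieldInt]
  simp only [fieldInt, fieldIntReal, trig]
  refine ⟨?_, ?_⟩
  · rw [← RCLike.re_eq_complex_re, ← hre]
    simp
  · rw [← RCLike.im_eq_complex_im, ← him]
    simp

lemma integrable_mul_fieldIntReal {f g : Torus → ℝ} (hf : Continuous f) (hg : Continuous g) :
    Integrable (fun ω => fieldIntReal X f ω * fieldIntReal X g ω) P :=
  (hX.memLp_fieldIntReal hf).integrable_mul (hX.memLp_fieldIntReal hg)

/-- The real and imaginary parts of `E w_l w_m` and `E w_l w_{-m}` are four linear equations for the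
four covariances. -/
lemma integral_trig_mul_trig (l m : ℤ) :
    (∫ ω, fieldIntReal X (trig l 0) ω * fieldIntReal X (trig m 0) ω ∂P =
      ((if m = -l then powerSpectrum P X l else 0) + if m = l then powerSpectrum P X l else 0) / 2) ∧
    (∫ ω, fieldIntReal X (trig l 1) ω * fieldIntReal X (trig m 1) ω ∂P =
      ((if m = l then powerSpectrum P X l else 0) - if m = -l then powerSpectrum P X l else 0) / 2) ∧
    (∫ ω, fieldIntReal X (trig l 0) ω * fieldIntReal X (trig m 1) ω ∂P = 0) ∧
    (∫ ω, fieldIntReal X (trig l 1) ω * fieldIntReal X (trig m 0) ω ∂P = 0) := by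
  have h1 := hX.integral_coeff_mul_coeff l m
  have h2 := hX.integral_coeff_mul_coeff l (-m)
  have hi := fun j k => hX.integrable_mul_fieldIntReal (continuous_trig l j) (continuous_trig m k)
  have i1 : Integrable (fun ω => coeff X l ω * coeff X m ω) P :=
    (hX.memLp_coeff l).integrable_mul (hX.memLp_coeff m)
  have i2 : Integrable (fun ω => coeff X l ω * coeff X (-m) ω) P :=
    (hX.memLp_coeff l).integrable_mul (hX.memLp_coeff (-m))
  have r1 := integral_re i1
  have s1 := integral_im i1
  have r2 := integral_re i2
  have s2 := integral_im i2
  rw [h1] at r1 s1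
  rw [h2] at r2 s2
  have e1 : ∫ ω, RCLike.re (coeff X l ω * coeff X m ω) ∂P =
      (∫ ω, fieldIntReal X (trig l 0) ω * fieldIntReal X (trig m 0) ω ∂P) -
      ∫ ω, fieldIntReal X (trig l 1) ω * fieldIntReal X (trig m 1) ω ∂P := by
    rw [← integral_sub (hi 0 0) (hi 1 1)]
    refine integral_congr_ae ?_
    filter_upwards [hX.ae_coeff_eq] with ω hω
    simp [(hω l).1, (hω l).2, (hω m).1, (hω m).2]
  have e2 : ∫ ω, RCLike.im (coeff X l ω * coeff X m ω) ∂P =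
      (∫ ω, fieldIntReal X (trig l 0) ω * fieldIntReal X (trig m 1) ω ∂P) +
      ∫ ω, fieldIntReal X (trig l 1) ω * fieldIntReal X (trig m 0) ω ∂P := by
    rw [← integral_add (hi 0 1) (hi 1 0)]
    refine integral_congr_ae ?_
    filter_upwards [hX.ae_coeff_eq] with ω hω
    simp [(hω l).1, (hω l).2, (hω m).1, (hω m).2]
  have e3 : ∫ ω, RCLike.re (coeff X l ω * coeff X (-m) ω) ∂P =
      (∫ ω, fieldIntReal X (trig l 0) ω * fieldIntReal X (trig m 0) ω ∂P) +
      ∫ ω, fieldIntReal X (trig l 1) ω * fieldIntReal X (trig m 1) ω ∂P := by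
    rw [← integral_add (hi 0 0) (hi 1 1)]
    refine integral_congr_ae ?_
    filter_upwards [hX.ae_coeff_eq] with ω hω
    simp [coeff_neg, (hω l).1, (hω l).2, (hω m).1, (hω m).2]
  have e4 : ∫ ω, RCLike.im (coeff X l ω * coeff X (-m) ω) ∂P =
      (∫ ω, fieldIntReal X (trig l 1) ω * fieldIntReal X (trig m 0) ω ∂P) -
      ∫ ω, fieldIntReal X (trig l 0) ω * fieldIntReal X (trig m 1) ω ∂P := by
    rw [← integral_sub (hi 1 0) (hi 0 1)]
    refine integral_congr_ae ?_
    filter_upwards [hX.ae_coeff_eq] with ω hω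
    simp [coeff_neg, (hω l).1, (hω l).2, (hω m).1, (hω m).2]
    ring
  rw [e1] at r1
  rw [e2] at s1
  rw [e3] at r2
  rw [e4] at s2
  have n1 : RCLike.re (if m = -l then (powerSpectrum P X l : ℂ) else 0) =
      if m = -l then powerSpectrum P X l else 0 := by split_ifs <;> simp
  have n2 : RCLike.im (if m = -l then (powerSpectrum P X l : ℂ) else 0) = 0 := by
    split_ifs <;> simp
  have n3 : RCLike.re (if -m = -l then (powerSpectrum P X l : ℂ) else 0) =
      if m = l then powerSpectrum P X l else 0 := by simp only [neg_inj]; split_ifs <;> simp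
  have n4 : RCLike.im (if -m = -l then (powerSpectrum P X l : ℂ) else 0) = 0 := by
    split_ifs <;> simp
  rw [n1] at r1
  rw [n2] at s1
  rw [n3] at r2
  rw [n4] at s2
  refine ⟨by linarith, by linarith, by linarith, by linarith⟩

lemma isGaussianProcess_fieldIntReal (hB : IsGaussianProcess X P) {T : Type*}
    {f : T → Torus → ℝ} (hf : ∀ t, Continuous (f t)) :
    IsGaussianProcess (fun t => fieldIntReal X (f t)) P where
  hasGaussianLaw I := hX.hasGaussianLaw_fieldIntReal hB (f := fun t : I => f t) fun t => hf t

/-- Distinct naturals are neither equal nor opposite integers, so the pairs of real and imaginary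
parts are uncorrelated, hence independent by joint Gaussianity. -/
lemma iIndepFun_specRatio (hB : IsGaussianProcess X P) :
    iIndepFun (fun n : ℕ => specRatio P X (n : ℤ)) P := by
  have hG : IsGaussianProcess (fun (p : (_n : ℕ) × Fin 2) ω =>
      fieldIntReal X (trig (p.1 : ℤ) p.2) ω) P :=
    hX.isGaussianProcess_fieldIntReal hB fun p => continuous_trig _ _
  have h := IsGaussianProcess.iIndepFun_of_covariance_eq_zero
    (X := fun (n : ℕ) (j : Fin 2) ω => fieldIntReal X (trig (n : ℤ) j) ω) hG
    (fun n j => (hX.measurable_fieldIntReal (continuous_trig _ _)).aemeasurable)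
    (by
      intro l m hlm j k
      rw [covariance_eq_sub (hX.memLp_fieldIntReal (continuous_trig _ _))
        (hX.memLp_fieldIntReal (continuous_trig _ _)),
        hX.integral_fieldIntReal (continuous_trig _ _), zero_mul, sub_zero]
      obtain ⟨a1, a2, a3, a4⟩ := hX.integral_trig_mul_trig (l : ℤ) (m : ℤ)
      have b1 : ¬ (m : ℤ) = -(l : ℤ) := by omega
      have b2 : ¬ (m : ℤ) = (l : ℤ) := by omega
      rw [if_neg b1, if_neg b2] at a1 a2
      simp only [Pi.mul_apply]
      fin_cases j <;> fin_cases k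
      · simpa using a1
      · simpa using a3
      · simpa using a4
      · simpa using a2)
  have h2 := h.comp (fun (n : ℕ) (v : Fin 2 → ℝ) => (v 0 ^ 2 + v 1 ^ 2) / powerSpectrum P X n)
    (fun n => by fun_prop)
  refine h2.congr fun n => ?_
  filter_upwards [hX.ae_coeff_eq] with ω hω
  simp only [Function.comp_apply, specRatio]
  rw [← Complex.normSq_eq_norm_sq, Complex.normSq_apply, (hω n).1, (hω n).2]
  ring

lemma measurable_specRatio (l : ℤ) : Measurable (specRatio P X l) :=
  ((hX.measurable_coeff l).norm.pow_const 2).div_const _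

lemma integral_specRatio {l : ℤ} (hC : powerSpectrum P X l ≠ 0) :
    ∫ ω, specRatio P X l ω ∂P = 1 := by
  simp only [specRatio]
  rw [integral_div]
  exact div_self hC

lemma integral_trig_pow (hB : IsGaussianProcess X P) {l : ℤ} (hl : l ≠ 0) (j : Fin 2) (n : ℕ) :
    Integrable (fun ω => fieldIntReal X (trig l j) ω ^ (2 * n)) P ∧
    ∫ ω, fieldIntReal X (trig l j) ω ^ (2 * n) ∂P =
      (powerSpectrum P X l / 2) ^ n * gaussMoment n := by
  have hm := hX.measurable_fieldIntReal (continuous_trig l j)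
  have hvar : ∫ ω, fieldIntReal X (trig l j) ω ^ 2 ∂P = powerSpectrum P X l / 2 := by
    obtain ⟨a1, a2, -, -⟩ := hX.integral_trig_mul_trig l l
    have b1 : ¬ l = -l := by omega
    rw [if_neg b1, if_pos rfl] at a1 a2
    simp_rw [sq]
    fin_cases j
    · simpa using a1
    · simpa using a2
  have hmap := hX.map_fieldIntReal hB (continuous_trig l j)
  have hC : 0 ≤ powerSpectrum P X l := integral_nonneg fun _ => sq_nonneg _
  have hscale : gaussianReal 0 (powerSpectrum P X l / 2).toNNReal =
      (gaussianReal 0 1).map (fun x => √(powerSpectrum P X l / 2) * x) := by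
    rw [gaussianReal_map_const_mul]
    congr 1
    · simp
    · ext
      simp [Real.coe_toNNReal _ (by positivity : 0 ≤ powerSpectrum P X l / 2)]
      rw [div_pow, Real.sq_sqrt hC, Real.sq_sqrt (by norm_num)]
  rw [hvar, hscale] at hmap
  have hint : Integrable (fun x : ℝ => (√(powerSpectrum P X l / 2) * x) ^ (2 * n))
      (gaussianReal 0 1) :=
    (((PolyGrowth.const _).mul PolyGrowth.id).pow _).integrable_of_continuous (by fun_prop)
  constructor
  · have : Integrable (fun x : ℝ => x ^ (2 * n)) (P.map (fieldIntReal X (trig l j))) := by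
      rw [hmap, integrable_map_measure (by fun_prop) (by fun_prop)]
      exact hint
    rw [integrable_map_measure (by fun_prop) hm.aemeasurable] at this
    exact this
  · have h1 : ∫ ω, fieldIntReal X (trig l j) ω ^ (2 * n) ∂P =
        ∫ x, x ^ (2 * n) ∂(P.map (fieldIntReal X (trig l j))) := by
      rw [integral_map hm.aemeasurable (by fun_prop)]
    rw [h1, hmap, integral_map (by fun_prop) (by fun_prop), gaussMoment]
    simp_rw [mul_pow]
    rw [integral_const_mul, pow_mul, Real.sq_sqrt (by positivity)]

/-- For `l ≠ 0` the real and imaginary parts are `N(0, C_l / 2)`; convexity of the `n`-th power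
separates them and `C_l` cancels, so the bound is uniform in `l`. -/
lemma integral_specRatio_pow_le (hB : IsGaussianProcess X P) {l : ℤ} (hl : l ≠ 0)
    (hC : powerSpectrum P X l ≠ 0) (n : ℕ) :
    Integrable (fun ω => specRatio P X l ω ^ n) P ∧
      ∫ ω, specRatio P X l ω ^ n ∂P ≤ gaussMoment n := by
  have hC0 : 0 < powerSpectrum P X l :=
    lt_of_le_of_ne (integral_nonneg fun _ => sq_nonneg _) (Ne.symm hC)
  set c := powerSpectrum P X l with hc
  obtain ⟨i0, m0⟩ := hX.integral_trig_pow hB hl 0 n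
  obtain ⟨i1, m1⟩ := hX.integral_trig_pow hB hl 1 n
  set A := fun ω => fieldIntReal X (trig l 0) ω
  set B := fun ω => fieldIntReal X (trig l 1) ω
  have hb : ∀ᵐ ω ∂P, specRatio P X l ω ^ n ≤
      (2 / c) ^ n * ((A ω ^ (2 * n) + B ω ^ (2 * n)) / 2) := by
    filter_upwards [hX.ae_coeff_eq] with ω hω
    have e : specRatio P X l ω = (A ω ^ 2 + B ω ^ 2) / c := by
      rw [specRatio, ← Complex.normSq_eq_norm_sq, Complex.normSq_apply, (hω l).1, (hω l).2]
      simp only [A, B, hc]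
      ring
    rcases n with _ | n
    · simp
    have h := add_pow_le (sq_nonneg (A ω)) (sq_nonneg (B ω)) (n + 1)
    rw [e, div_pow, div_pow, pow_mul, pow_mul, div_mul_eq_mul_div]
    gcongr
    simp only [Nat.add_sub_cancel] at h
    calc (A ω ^ 2 + B ω ^ 2) ^ (n + 1) ≤ _ := h
      _ = _ := by rw [pow_succ]; ring
  have hi : Integrable (fun ω => (2 / c) ^ n * ((A ω ^ (2 * n) + B ω ^ (2 * n)) / 2)) P :=
    ((i0.add i1).div_const 2).const_mul _
  have hint : Integrable (fun ω => specRatio P X l ω ^ n) P := by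
    refine hi.mono' ((hX.measurable_specRatio l).pow_const n).aestronglyMeasurable ?_
    filter_upwards [hb] with ω hω
    rwa [Real.norm_of_nonneg (pow_nonneg (specRatio_nonneg _ _) _)]
  refine ⟨hint, (integral_mono_ae hint hi hb).trans (le_of_eq ?_)⟩
  rw [integral_const_mul, integral_div, integral_add i0 i1, m0, m1]
  have : (2 / c) ^ n * (c / 2) ^ n = 1 := by
    rw [← mul_pow]
    field_simp
    simp
  linear_combination gaussMoment n * this

end IsIsotropicField

end Coefficients

/-! ### Variance of weighted sums of products of independent variables. -/

section IndependentProducts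

variable {Ω : Type*} [MeasurableSpace Ω] {P : Measure Ω} [IsProbabilityMeasure P]
  {ε : ℕ → Ω → ℝ} {S : Set ℕ} {m : ℕ → ℝ} {ι κ : Type*} [Fintype ι] [Fintype κ]

/-- A family of independent nonnegative variables which, for indices in `S`, have mean one and
uniformly bounded moments. -/
structure IsUnitFamily (P : Measure Ω) (ε : ℕ → Ω → ℝ) (S : Set ℕ) (m : ℕ → ℝ) : Prop where
  indep : iIndepFun ε P
  measurable : ∀ n, Measurable (ε n)
  nonneg : ∀ n ω, 0 ≤ ε n ω
  integrable : ∀ n ∈ S, ∀ k, Integrable (fun ω => ε n ω ^ k) P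
  mean : ∀ n ∈ S, ∫ ω, ε n ω ∂P = 1
  moment : ∀ n ∈ S, ∀ k, ∫ ω, ε n ω ^ k ∂P ≤ m k

lemma prod_le_sum_pow [Nonempty ι] {x : ι → ℝ} (hx : ∀ i, 0 ≤ x i) :
    ∏ i, x i ≤ ∑ i, x i ^ Fintype.card ι := by
  obtain ⟨j, -, hj⟩ := Finset.exists_max_image Finset.univ x Finset.univ_nonempty
  calc ∏ i, x i ≤ ∏ _i : ι, x j :=
        Finset.prod_le_prod (fun i _ => hx i) fun i _ => hj i (Finset.mem_univ i)
    _ = x j ^ Fintype.card ι := by simp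
    _ ≤ _ := Finset.single_le_sum (f := fun i => x i ^ Fintype.card ι)
        (fun i _ => pow_nonneg (hx i) _) (Finset.mem_univ j)

namespace IsUnitFamily

variable (h : IsUnitFamily P ε S m)
include h

lemma integrable_prod {u : ι → ℕ} (hu : ∀ i, u i ∈ S) :
    Integrable (fun ω => ∏ i, ε (u i) ω) P := by
  rcases isEmpty_or_nonempty ι with hι | hι
  · simp
  · have hi : Integrable (fun ω => ∑ i, ε (u i) ω ^ Fintype.card ι) P :=
      integrable_finsetSum _ fun i _ => h.integrable _ (hu i) _
    refine hi.mono' ?_ (ae_of_all _ fun ω => ?_)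
    · exact (Finset.measurable_fun_prod _ fun i _ => h.measurable (u i)).aestronglyMeasurable
    · rw [Real.norm_of_nonneg (Finset.prod_nonneg fun i _ => h.nonneg _ _)]
      exact prod_le_sum_pow fun i => h.nonneg _ _

lemma integral_prod_le [Nonempty ι] {u : ι → ℕ} (hu : ∀ i, u i ∈ S) :
    ∫ ω, ∏ i, ε (u i) ω ∂P ≤ Fintype.card ι * m (Fintype.card ι) := by
  have hi : ∀ i, Integrable (fun ω => ε (u i) ω ^ Fintype.card ι) P :=
    fun i => h.integrable _ (hu i) _
  calc ∫ ω, ∏ i, ε (u i) ω ∂P ≤ ∫ ω, ∑ i, ε (u i) ω ^ Fintype.card ι ∂P :=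
        integral_mono (h.integrable_prod hu) (integrable_finsetSum _ fun i _ => hi i)
          fun ω => prod_le_sum_pow fun i => h.nonneg _ _
    _ = ∑ i, ∫ ω, ε (u i) ω ^ Fintype.card ι ∂P := integral_finsetSum _ fun i _ => hi i
    _ ≤ ∑ _i : ι, m (Fintype.card ι) :=
        Finset.sum_le_sum fun i _ => h.moment _ (hu i) _
    _ = _ := by simp

lemma one_le_integral_pow {n : ℕ} (hn : n ∈ S) (k : ℕ) : 1 ≤ ∫ ω, ε n ω ^ k ∂P := by
  have hi : Integrable (ε n) P := by simpa using h.integrable n hn 1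
  have hs : Integrable (fun ω => ε n ω - 1) P := hi.sub (integrable_const _)
  have h1 : ∫ ω, (1 + k * (ε n ω - 1)) ∂P = 1 := by
    rw [integral_add (integrable_const _) (hs.const_mul _), integral_const_mul, integral_sub hi (integrable_const _), h.mean n hn]
    simp
  rw [← h1]
  refine integral_mono ((integrable_const _).add (hs.const_mul _))
    (h.integrable n hn k) fun ω => ?_
  have := one_add_mul_le_pow (a := ε n ω - 1) (by linarith [h.nonneg n ω]) k
  simpa using this

/-- Grouping equal indices factors the expectation into moments of single variables of mean one,
each at least one by Bernoulli's inequality. Hence `δ ≥ 1`, and dividing by it never enlarges a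
bound. -/
lemma one_le_integral_prod {u : ι → ℕ} (hu : ∀ i, u i ∈ S) :
    1 ≤ ∫ ω, ∏ i, ε (u i) ω ∂P := by
  classical
  set s : Finset ℕ := Finset.univ.image u with hs
  set k : ℕ → ℕ := fun b => (Finset.univ.filter fun i => u i = b).card with hk
  have e : ∀ ω, ∏ i, ε (u i) ω = ∏ b : s, ε b ω ^ k b := by
    intro ω
    rw [Finset.prod_comp (fun n => ε n ω) u, ← Finset.prod_coe_sort]
  simp_rw [e]
  have hind : iIndepFun (fun (b : s) ω => ε b ω) P := h.indep.precomp Subtype.val_injective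
  have hind2 := hind.comp (fun b x => x ^ k b) (fun b => by fun_prop)
  have := hind2.integral_fun_prod_eq_prod_integral
    (fun b => ((h.measurable b).pow_const (k b)).aestronglyMeasurable)
  simp only [Function.comp_apply] at this
  rw [this]
  have hb : ∀ b : s, 1 ≤ ∫ ω, ε b ω ^ k b ∂P := by
    rintro ⟨b, hb⟩
    obtain ⟨i, -, rfl⟩ := Finset.mem_image.1 hb
    exact h.one_le_integral_pow (hu i) _
  calc (1 : ℝ) = ∏ _b : s, 1 := by simp
    _ ≤ _ := Finset.prod_le_prod (fun _ _ => zero_le_one) fun b _ => hb b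

lemma integral_prod_mul_prod_of_disjoint {u : ι → ℕ} {v : κ → ℕ} (huv : ∀ i j, u i ≠ v j) :
    ∫ ω, (∏ i, ε (u i) ω) * ∏ j, ε (v j) ω ∂P =
      (∫ ω, ∏ i, ε (u i) ω ∂P) * ∫ ω, ∏ j, ε (v j) ω ∂P := by
  classical
  set s : Finset ℕ := Finset.univ.image u with hs
  set t : Finset ℕ := Finset.univ.image v with ht
  have hst : Disjoint s t := by
    rw [Finset.disjoint_left]
    intro a ha hb
    obtain ⟨i, -, rfl⟩ := Finset.mem_image.1 ha
    obtain ⟨j, -, hj⟩ := Finset.mem_image.1 hb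
    exact huv i j hj.symm
  have hind := h.indep.indepFun_finset s t hst h.measurable
  have hind2 := hind.comp
    (φ := fun x : s → ℝ => ∏ i, x ⟨u i, Finset.mem_image_of_mem u (Finset.mem_univ i)⟩)
    (ψ := fun x : t → ℝ => ∏ j, x ⟨v j, Finset.mem_image_of_mem v (Finset.mem_univ j)⟩)
    (by fun_prop) (by fun_prop)
  exact hind2.integral_fun_mul_eq_mul_integral
    (Finset.measurable_fun_prod _ fun i _ => h.measurable (u i)).aestronglyMeasurable
    (Finset.measurable_fun_prod _ fun i _ => h.measurable (v i)).aestronglyMeasurable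

open Classical in
/-- The variance of `∑ c_t Y_t / E Y_t` for products `Y_t` of independent variables is controlled
by the pairs of products that have a factor in common. -/
theorem variance_sum_prod_le [Nonempty ι] {τ : Type*} (T : Finset τ) {u : τ → ι → ℕ}
    (hu : ∀ t ∈ T, ∀ i, u t i ∈ S) {c : τ → ℝ} (hc : ∀ t ∈ T, 0 ≤ c t) :
    Integrable (fun ω => (∑ t ∈ T, c t * ((∏ i, ε (u t i) ω) / ∫ ω, ∏ i, ε (u t i) ω ∂P) -
      ∑ t ∈ T, c t) ^ 2) P ∧
    ∫ ω, (∑ t ∈ T, c t * ((∏ i, ε (u t i) ω) / ∫ ω, ∏ i, ε (u t i) ω ∂P) - ∑ t ∈ T, c t) ^ 2 ∂P ≤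
      (2 * Fintype.card ι * m (2 * Fintype.card ι)) *
        ∑ t ∈ T, ∑ t' ∈ T, if ∃ i j, u t i = u t' j then c t * c t' else 0 := by
  set δ : τ → ℝ := fun t => ∫ ω, ∏ i, ε (u t i) ω ∂P with hδ
  set Y : τ → Ω → ℝ := fun t ω => ∏ i, ε (u t i) ω with hY
  have hYi : ∀ t ∈ T, Integrable (Y t) P := fun t ht => h.integrable_prod (hu t ht)
  have hδ1 : ∀ t ∈ T, 1 ≤ δ t := fun t ht => h.one_le_integral_prod (hu t ht)
  have hYY : ∀ t ∈ T, ∀ t' ∈ T, Integrable (fun ω => Y t ω * Y t' ω) P := by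
    intro t ht t' ht'
    have := h.integrable_prod (u := Sum.elim (u t) (u t')) (by
      rintro (i | i)
      · exact hu t ht i
      · exact hu t' ht' i)
    simpa [Fintype.prod_sum_type] using this
  have hYYle : ∀ t ∈ T, ∀ t' ∈ T, ∫ ω, Y t ω * Y t' ω ∂P ≤
      2 * Fintype.card ι * m (2 * Fintype.card ι) := by
    intro t ht t' ht'
    have := h.integral_prod_le (u := Sum.elim (u t) (u t')) (by
      rintro (i | i)
      · exact hu t ht i
      · exact hu t' ht' i)
    rw [Fintype.card_sum, ← two_mul] at this
    simpa [Fintype.prod_sum_type] using this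
  have e : ∀ ω, (∑ t ∈ T, c t * (Y t ω / δ t) - ∑ t ∈ T, c t) ^ 2 =
      ∑ t ∈ T, ∑ t' ∈ T, c t * c t' * ((Y t ω / δ t - 1) * (Y t' ω / δ t' - 1)) := by
    intro ω
    rw [← Finset.sum_sub_distrib, sq, Finset.sum_mul_sum]
    refine Finset.sum_congr rfl fun t _ => Finset.sum_congr rfl fun t' _ => ?_
    ring
  have hi : ∀ t ∈ T, ∀ t' ∈ T,
      Integrable (fun ω => (Y t ω / δ t - 1) * (Y t' ω / δ t' - 1)) P := by
    intro t ht t' ht'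
    have e2 : ∀ ω, (Y t ω / δ t - 1) * (Y t' ω / δ t' - 1) =
        Y t ω * Y t' ω / (δ t * δ t') - Y t ω / δ t - Y t' ω / δ t' + 1 := fun ω => by
      field_simp
      ring
    simp_rw [e2]
    exact ((((hYY t ht t' ht').div_const _).sub ((hYi t ht).div_const _)).sub
      ((hYi t' ht').div_const _)).add (integrable_const _)
  have hcov : ∀ t ∈ T, ∀ t' ∈ T, ∫ ω, (Y t ω / δ t - 1) * (Y t' ω / δ t' - 1) ∂P =
      (∫ ω, Y t ω * Y t' ω ∂P) / (δ t * δ t') - 1 := by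
    intro t ht t' ht'
    have d1 : δ t ≠ 0 := by linarith [hδ1 t ht]
    have d2 : δ t' ≠ 0 := by linarith [hδ1 t' ht']
    have e2 : ∀ ω, (Y t ω / δ t - 1) * (Y t' ω / δ t' - 1) =
        Y t ω * Y t' ω / (δ t * δ t') - Y t ω / δ t - Y t' ω / δ t' + 1 := fun ω => by
      field_simp
      ring
    simp_rw [e2]
    rw [integral_add, integral_sub, integral_sub, integral_div, integral_div, integral_div]
    · change _ / _ - δ t / δ t - δ t' / δ t' + _ = _
      rw [div_self d1, div_self d2]
      simp
    · exact (hYY t ht t' ht').div_const _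
    · exact (hYi t ht).div_const _
    · exact ((hYY t ht t' ht').div_const _).sub ((hYi t ht).div_const _)
    · exact (hYi t' ht').div_const _
    · exact (((hYY t ht t' ht').div_const _).sub ((hYi t ht).div_const _)).sub
        ((hYi t' ht').div_const _)
    · exact integrable_const _
  have hI : ∀ t ∈ T, Integrable (fun ω => ∑ t' ∈ T, c t * c t' *
      ((Y t ω / δ t - 1) * (Y t' ω / δ t' - 1))) P := fun t ht =>
    integrable_finsetSum _ fun t' ht' => (hi t ht t' ht').const_mul _
  change Integrable (fun ω => (∑ t ∈ T, c t * (Y t ω / δ t) - ∑ t ∈ T, c t) ^ 2) P ∧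
    ∫ ω, (∑ t ∈ T, c t * (Y t ω / δ t) - ∑ t ∈ T, c t) ^ 2 ∂P ≤ _
  simp_rw [e]
  refine ⟨integrable_finsetSum _ hI, ?_⟩
  rw [integral_finsetSum _ hI, Finset.mul_sum]
  refine Finset.sum_le_sum fun t ht => ?_
  rw [integral_finsetSum _ fun t' ht' => (hi t ht t' ht').const_mul _, Finset.mul_sum]
  refine Finset.sum_le_sum fun t' ht' => ?_
  rw [integral_const_mul, hcov t ht t' ht']
  have hcc : 0 ≤ c t * c t' := mul_nonneg (hc t ht) (hc t' ht')
  have d1 := hδ1 t ht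
  have d2 := hδ1 t' ht'
  -- With a common factor the covariance is at most `E [Y Y']`, since `δ ≥ 1`; without one,
  -- independence makes it zero.
  split_ifs with hs
  · rw [mul_comm]
    gcongr
    have h0 : 0 ≤ ∫ ω, Y t ω * Y t' ω ∂P := integral_nonneg fun ω =>
      mul_nonneg (Finset.prod_nonneg fun i _ => h.nonneg _ _)
        (Finset.prod_nonneg fun i _ => h.nonneg _ _)
    have : (∫ ω, Y t ω * Y t' ω ∂P) / (δ t * δ t') ≤ ∫ ω, Y t ω * Y t' ω ∂P :=
      div_le_self h0 (by nlinarith)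
    linarith [hYYle t ht t' ht']
  · push Not at hs
    have h1 : ∫ ω, Y t ω * Y t' ω ∂P = δ t * δ t' := h.integral_prod_mul_prod_of_disjoint hs
    rw [h1, div_self (by positivity)]
    simp

end IsUnitFamily

end IndependentProducts

/-! ### Counting resonant tuples of frequencies. -/

section Counting

variable {N p : ℕ}

lemma mem_freqs {l : ℤ} : l ∈ freqs N ↔ (N : ℤ) ≤ 8 * |l| ∧ 2 * |l| ≤ N := by
  simp only [freqs, Finset.mem_filter, Finset.mem_Icc, and_iff_right_iff_imp]
  rintro ⟨-, h⟩
  have := le_abs_self l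
  have := neg_abs_le l
  have := abs_nonneg l
  omega

lemma neg_mem_freqs {l : ℤ} : -l ∈ freqs N ↔ l ∈ freqs N := by
  simp [mem_freqs]

lemma card_freqs_le (hN : 0 < N) : (freqs N).card ≤ 3 * N := by
  refine (Finset.card_filter_le _ _).trans ?_
  rw [Int.card_Icc]
  omega

/-- The tuples of frequencies whose sum is a multiple of `N`. -/
noncomputable def resonant (N p : ℕ) : Finset (Fin p → ℤ) :=
  (Fintype.piFinset fun _ : Fin p => freqs N).filter fun l => (N : ℤ) ∣ ∑ i, l i

lemma mem_freqs_of_mem_resonant {l : Fin p → ℤ} (hl : l ∈ resonant N p) (i : Fin p) :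
    l i ∈ freqs N :=
  Fintype.mem_piFinset.1 (Finset.mem_filter.1 hl).1 i

/-- The residue of `l` modulo `N` is prescribed and `l / N ∈ {-1, 0}`. Two solutions can occur, at
the endpoints `± N / 2`. -/
lemma card_filter_dvd_add_le (hN : 0 < N) (s : ℤ) :
    ((freqs N).filter fun l => (N : ℤ) ∣ l + s).card ≤ 2 := by
  have hc : (Finset.Icc (-1 : ℤ) 0).card = 2 := by simp
  rw [← hc]
  refine Finset.card_le_card_of_injOn (fun l => l / N) ?_ ?_
  · intro l hl
    have h := (mem_freqs.1 (Finset.mem_filter.1 hl).1).2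
    have h1 := le_abs_self l
    have h2 := neg_abs_le l
    simp only [Finset.coe_Icc, Set.mem_Icc]
    constructor
    · rw [Int.le_ediv_iff_mul_le (by omega)]
      omega
    · have : l / (N : ℤ) < 1 := Int.ediv_lt_of_lt_mul (by omega) (by omega)
      omega
  · intro l hl l' hl' h
    have d1 := (Finset.mem_filter.1 hl).2
    have d2 := (Finset.mem_filter.1 hl').2
    have d3 : (N : ℤ) ∣ l - l' := by simpa using dvd_sub d1 d2
    have e : l % N = l' % N :=
      Int.emod_eq_emod_iff_emod_sub_eq_zero.2 (Int.emod_eq_zero_of_dvd d3)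
    simp only at h
    rw [← Int.emod_add_mul_ediv l N, ← Int.emod_add_mul_ediv l' N, e, h]

/-- Besides the fixed coordinate `j`, choose another `j₀`: the remaining `p - 2` coordinates are
free, with at most `3N` values each, and the congruence leaves at most two values for coordinate
`j₀`. -/
lemma card_resonant_fiber_le (hN : 0 < N) (hp : 2 ≤ p) (j : Fin p) (v : ℤ) :
    ((resonant N p).filter fun l => l j = v).card ≤ 2 * (3 * N) ^ (p - 2) := by
  have : Nontrivial (Fin p) := Fin.nontrivial_iff_two_le.2 hp
  obtain ⟨j₀, hj⟩ := exists_ne j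
  set U := (resonant N p).filter fun l => l j = v with hU
  refine (Finset.card_le_mul_card_image (f := fun l => Function.update l j₀ 0) U 2 ?_).trans ?_
  · intro b _
    refine (Finset.card_le_card_of_injOn (fun l : Fin p → ℤ => l j₀) ?_ ?_).trans
      (card_filter_dvd_add_le hN (∑ i, b i))
    · intro l hl
      obtain ⟨h1, h2⟩ := Finset.mem_filter.1 hl
      have h3 := (Finset.mem_filter.1 h1).1
      refine Finset.mem_coe.2 (Finset.mem_filter.2 ⟨mem_freqs_of_mem_resonant h3 _, ?_⟩)
      have h4 := (Finset.mem_filter.1 h3).2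
      rw [← h2, Finset.sum_update_of_mem (Finset.mem_univ _), zero_add]
      simpa [Finset.sdiff_singleton_eq_erase, Finset.add_sum_erase] using h4
    · intro l hl l' hl' h
      have e := ((Finset.mem_filter.1 hl).2).trans (Finset.mem_filter.1 hl').2.symm
      funext i
      by_cases hi : i = j₀
      · subst hi; exact h
      · simpa [hi] using congrFun e i
  · refine Nat.mul_le_mul_left _ ?_
    have hsub : U.image (fun l => Function.update l j₀ 0) ⊆ Fintype.piFinset
        (fun i => if i = j₀ then {0} else if i = j then {v} else freqs N) := by
      intro b hb
      obtain ⟨l, hl, rfl⟩ := Finset.mem_image.1 hb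
      obtain ⟨h1, h2⟩ := Finset.mem_filter.1 hl
      refine Fintype.mem_piFinset.2 fun i => ?_
      by_cases hi : i = j₀
      · simp [hi]
      · by_cases hij : i = j
        · subst hij; simp [hi, h2]
        · simpa [hi, hij] using mem_freqs_of_mem_resonant h1 i
    refine (Finset.card_le_card hsub).trans ?_
    rw [Fintype.card_piFinset]
    calc ∏ i, (if i = j₀ then {0} else if i = j then {v} else freqs N : Finset ℤ).card
        ≤ ∏ i, if i ∈ ({j₀, j} : Finset (Fin p)) then 1 else 3 * N := by
          refine Finset.prod_le_prod' fun i _ => ?_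
          by_cases hi : i = j₀
          · simp [hi]
          · by_cases hij : i = j
            · subst hij; simp [hi]
            · simpa [hi, hij] using card_freqs_le hN
      _ = (3 * N) ^ (p - 2) := by
          rw [Finset.prod_ite, Finset.prod_const_one, one_mul, Finset.prod_const]
          congr 1
          rw [← Finset.compl_filter, Finset.card_compl, Fintype.card_fin]
          congr 1
          have : (Finset.univ.filter fun i => i ∈ ({j₀, j} : Finset (Fin p))) = {j₀, j} := by
            ext; simp
          rw [this, Finset.card_pair hj]

/-- The sum over the pairs of tuples that share a frequency up to sign. -/
lemma sum_share_le [NeZero p] (hN : 0 < N) {T : Finset (Fin p → ℤ)}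
    (hT : ∀ t ∈ T, ∀ i, t i ∈ freqs N) {A : ℕ} (hA₀ : 0 < A)
    (hA : ∀ j v, (T.filter fun t => t j = v).card ≤ A) {c : (Fin p → ℤ) → ℝ} {D : ℝ}
    (hc₀ : ∀ t ∈ T, 0 ≤ c t) (hc : ∀ t ∈ T, c t ≤ D / (N * A))
    [∀ t t' : Fin p → ℤ, Decidable (∃ i j, (t i).natAbs = (t' j).natAbs)] :
    ∑ t ∈ T, ∑ t' ∈ T, (if ∃ i j, (t i).natAbs = (t' j).natAbs then c t * c t' else 0) ≤
      6 * p ^ 2 * D ^ 2 / N := by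
  classical
  have hN' : (0 : ℝ) < N := by exact_mod_cast hN
  have hA' : (0 : ℝ) < A := by exact_mod_cast hA₀
  have h1 : T.card ≤ A * (3 * N) := by
    refine (Finset.card_le_mul_card_image_of_maps_to (f := fun t => t 0) (t := freqs N)
      (fun t ht => hT t ht 0) A fun v _ => hA 0 v).trans ?_
    exact Nat.mul_le_mul_left _ (card_freqs_le hN)
  -- There are `p²` choices of the two positions and two signs. With `T.card ≤ 3 N A` there are at
  -- most `6 p² N A²` pairs, each contributing at most `(D / (N A))²`.
  have h2 : ∀ t : Fin p → ℤ, (T.filter fun t' => ∃ i j, (t i).natAbs = (t' j).natAbs).card ≤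
      p * p * (2 * A) := by
    intro t
    have : (T.filter fun t' => ∃ i j, (t i).natAbs = (t' j).natAbs) ⊆
        (Finset.univ : Finset (Fin p × Fin p)).biUnion fun x =>
          (T.filter fun t' => t' x.2 = t x.1) ∪ (T.filter fun t' => t' x.2 = -t x.1) := by
      intro t' ht'
      obtain ⟨h, i, j, hij⟩ := Finset.mem_filter.1 ht'
      refine Finset.mem_biUnion.2 ⟨(i, j), Finset.mem_univ _, ?_⟩
      rcases Int.natAbs_eq_natAbs_iff.1 hij.symm with e | e
      · exact Finset.mem_union_left _ (Finset.mem_filter.2 ⟨h, e⟩)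
      · exact Finset.mem_union_right _ (Finset.mem_filter.2 ⟨h, e⟩)
    refine (Finset.card_le_card this).trans ((Finset.card_biUnion_le_card_mul _ _ (2 * A) ?_).trans ?_)
    · intro x _
      refine (Finset.card_union_le _ _).trans ?_
      have := hA x.2 (t x.1)
      have := hA x.2 (-t x.1)
      omega
    · simp
  have hcc : ∀ t ∈ T, ∀ t' ∈ T, c t * c t' ≤ (D / (N * A)) ^ 2 := fun t ht t' ht' => by
    rw [sq]
    exact mul_le_mul (hc t ht) (hc t' ht') (hc₀ t' ht') ((hc₀ t ht).trans (hc t ht))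
  calc _ ≤ ∑ t ∈ T, ∑ t' ∈ T.filter (fun t' => ∃ i j, (t i).natAbs = (t' j).natAbs),
        (D / (N * A)) ^ 2 := by
        refine Finset.sum_le_sum fun t ht => ?_
        rw [Finset.sum_filter]
        refine Finset.sum_le_sum fun t' ht' => ?_
        split_ifs
        · exact hcc t ht t' ht'
        · exact le_rfl
    _ ≤ ∑ t ∈ T, ((p * p * (2 * A) : ℕ) : ℝ) * (D / (N * A)) ^ 2 := by
        refine Finset.sum_le_sum fun t ht => ?_
        rw [Finset.sum_const, nsmul_eq_mul]
        gcongr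
        exact h2 t
    _ ≤ ((A * (3 * N) : ℕ) : ℝ) * (((p * p * (2 * A) : ℕ) : ℝ) * (D / (N * A)) ^ 2) := by
        rw [Finset.sum_const, nsmul_eq_mul]
        gcongr
    _ = _ := by
        push_cast
        field_simp
        ring

end Counting

/-! ### Orthogonality of characters on the grid. -/

section RootsOfUnity

variable {N : ℕ}

/-- The primitive `N`-th root of unity `e^{2πi/N}`. -/
noncomputable def zeta (N : ℕ) : ℂ := Complex.exp (2 * π * Complex.I / N)

lemma isPrimitiveRoot_zeta (hN : 0 < N) : IsPrimitiveRoot (zeta N) N :=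
  Complex.isPrimitiveRoot_exp N hN.ne'

lemma zeta_ne_zero : zeta N ≠ 0 := Complex.exp_ne_zero _

lemma zeta_zpow_sum {ι : Type*} (s : Finset ι) (f : ι → ℤ) :
    zeta N ^ (∑ i ∈ s, f i) = ∏ i ∈ s, zeta N ^ f i := by
  classical
  induction s using Finset.induction_on with
  | empty => simp
  | insert i s hi ih => rw [Finset.sum_insert hi, Finset.prod_insert hi, zpow_add₀ zeta_ne_zero, ih]

lemma norm_zeta_zpow (m : ℤ) : ‖zeta N ^ m‖ = 1 := by
  have : zeta N = Complex.exp ((2 * π / N : ℝ) * Complex.I) := by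
    rw [zeta]; congr 1; push_cast; ring
  rw [norm_zpow, this, Complex.norm_exp_ofReal_mul_I, one_zpow]

lemma conj_zeta_zpow (m : ℤ) : starRingEnd ℂ (zeta N ^ m) = zeta N ^ (-m) := by
  rw [zpow_neg, Complex.inv_def, Complex.normSq_eq_norm_sq, norm_zeta_zpow]
  simp

lemma sum_range_zeta (hN : 0 < N) (m : ℤ) (c : ℕ) :
    ∑ k ∈ Finset.range (c * N), zeta N ^ (m * k) = if (N : ℤ) ∣ m then (c * N : ℂ) else 0 := by
  have hz := isPrimitiveRoot_zeta hN
  simp_rw [zpow_mul, zpow_natCast]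
  split_ifs with h
  · rw [(hz.zpow_eq_one_iff_dvd m).2 h]
    simp
  · have h1 : zeta N ^ m ≠ 1 := fun h1 => h ((hz.zpow_eq_one_iff_dvd m).1 h1)
    rw [geom_sum_eq h1, mul_comm c N, pow_mul, ← zpow_natCast (zeta N ^ m) N, zpow_comm,
      zpow_natCast, hz.pow_eq_one]
    simp

lemma sum_Icc_zeta (hN : 0 < N) (m : ℤ) :
    ∑ k ∈ Finset.Icc 1 N, zeta N ^ (m * (k : ℤ)) = if (N : ℤ) ∣ m then (N : ℂ) else 0 := by
  have h := sum_range_zeta hN m 1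
  have e : ∑ k ∈ Finset.Icc 1 N, zeta N ^ (m * (k : ℤ)) =
      zeta N ^ m * ∑ k ∈ Finset.range (1 * N), zeta N ^ (m * k) := by
    rw [Finset.mul_sum, one_mul, ← Finset.Ico_add_one_right_eq_Icc, Finset.sum_Ico_eq_sum_range]
    refine Finset.sum_congr rfl fun k _ => ?_
    rw [← zpow_add₀ zeta_ne_zero]
    congr 1
    push_cast
    ring
  rw [e, h]
  split_ifs with hd
  · rw [((isPrimitiveRoot_zeta hN).zpow_eq_one_iff_dvd m).2 hd]
    simp
  · simp

lemma sum_Ico_zeta (hN : 0 < N) (m : ℤ) :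
    ∑ l ∈ Finset.Ico (-(N : ℤ)) N, zeta N ^ (m * l) =
      if (N : ℤ) ∣ m then (2 * N : ℂ) else 0 := by
  have h := sum_range_zeta hN m 2
  have e : ∑ l ∈ Finset.Ico (-(N : ℤ)) N, zeta N ^ (m * l) =
      zeta N ^ (m * (-N)) * ∑ k ∈ Finset.range (2 * N), zeta N ^ (m * k) := by
    rw [Finset.mul_sum]
    refine Finset.sum_nbij' (fun l => (l + N).toNat) (fun k => (k : ℤ) - N) ?_ ?_ ?_ ?_ ?_
    · intro l hl
      simp only [Finset.mem_Ico, Finset.mem_range] at hl ⊢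
      omega
    · intro l hl
      simp only [Finset.mem_Ico, Finset.mem_range] at hl ⊢
      omega
    · intro l hl
      simp only [Finset.mem_Ico] at hl ⊢
      omega
    · intro l hl
      simp only [Finset.mem_range] at hl ⊢
      omega
    · intro l hl
      simp only [Finset.mem_Ico] at hl
      rw [← zpow_add₀ zeta_ne_zero]
      congr 1
      rw [Int.toNat_of_nonneg (by omega)]
      ring
  rw [e, h]
  split_ifs with hd
  · rw [((isPrimitiveRoot_zeta hN).zpow_eq_one_iff_dvd _).2 (Dvd.dvd.mul_right hd _)]
    simp
  · simp

/-- This is what restricts `F_{p,N}` to the tuples in `resonant N p`: at grid frequencies the kernel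
is a complete sum of powers of a root of unity. -/
lemma fejer_eq (hN : 0 < N) (m : ℤ) :
    fejer N (2 * π / N * m) = if (N : ℤ) ∣ m then N / (2 * π) else 0 := by
  have e : ∀ k : ℕ, Complex.exp (Complex.I * (2 * π / N * m : ℝ) * k) = zeta N ^ (m * (k : ℤ)) := by
    intro k
    rw [zeta, ← Complex.exp_int_mul]
    congr 1
    push_cast
    ring
  rw [fejer]
  simp_rw [e]
  rw [sum_Icc_zeta hN]
  have : (N : ℝ) ≠ 0 := by positivity
  split_ifs
  · simp
    field_simp
  · simp

lemma fourier_grid (l : ℤ) (k : ℕ) :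
    fourier l ((k * (2 * π / N) : ℝ) : Torus) = zeta N ^ (l * (k : ℤ)) := by
  rw [fourier_coe_apply, zeta, ← Complex.exp_int_mul]
  congr 1
  have : (π : ℂ) ≠ 0 := by simp [Real.pi_ne_zero]
  push_cast
  field_simp

/-- Bessel's inequality for the characters with frequencies in `[-N, N)`. -/
lemma sum_freqs_norm_sq_le (hN : 0 < N) (v : Finset.Icc 1 N → ℝ) :
    ∑ l ∈ freqs N, ‖∑ k, (v k : ℂ) * zeta N ^ (l * ((k : ℕ) : ℤ))‖ ^ 2 ≤ 2 * N * ∑ k, v k ^ 2 := by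
  -- The frequencies may include both endpoints `± N / 2`, so one period is not enough; `[-N, N)`
  -- consists of two full periods, whence the factor `2`.
  have hsub : freqs N ⊆ Finset.Ico (-(N : ℤ)) N := by
    intro l hl
    have h := (mem_freqs.1 hl).2
    have h1 := le_abs_self l
    have h2 := neg_abs_le l
    rw [Finset.mem_Ico]
    omega
  refine (Finset.sum_le_sum_of_subset_of_nonneg hsub fun _ _ _ => by positivity).trans_eq ?_
  have key : (∑ l ∈ Finset.Ico (-(N : ℤ)) N,
      ((‖∑ k, (v k : ℂ) * zeta N ^ (l * ((k : ℕ) : ℤ))‖ ^ 2 : ℝ) : ℂ)) =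
      2 * N * ∑ k, (v k : ℂ) ^ 2 := by
    have e : ∀ l : ℤ, ((‖∑ k, (v k : ℂ) * zeta N ^ (l * ((k : ℕ) : ℤ))‖ ^ 2 : ℝ) : ℂ) =
        ∑ k, ∑ k', (v k : ℂ) * v k' * zeta N ^ ((((k : ℕ) : ℤ) - ((k' : ℕ) : ℤ)) * l) := by
      intro l
      rw [← Complex.normSq_eq_norm_sq, ← Complex.mul_conj, map_sum, Finset.sum_mul_sum]
      refine Finset.sum_congr rfl fun k _ => Finset.sum_congr rfl fun k' _ => ?_
      rw [map_mul, Complex.conj_ofReal, conj_zeta_zpow, sub_mul, sub_eq_add_neg,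
        zpow_add₀ zeta_ne_zero, mul_comm l, mul_comm l]
      ring
    simp_rw [e]
    rw [Finset.sum_comm, Finset.mul_sum]
    refine Finset.sum_congr rfl fun k _ => ?_
    rw [Finset.sum_comm]
    simp_rw [← Finset.mul_sum, sum_Ico_zeta hN]
    rw [Finset.sum_eq_single k]
    · simp; ring
    · intro k' _ hk
      rw [if_neg, mul_zero]
      intro hd
      apply hk
      have h1 := Finset.mem_Icc.1 k.2
      have h2 := Finset.mem_Icc.1 k'.2
      have := Int.eq_zero_of_abs_lt_dvd hd (by rw [abs_lt]; omega)
      exact Subtype.ext (by omega)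
    · simp
  exact_mod_cast key

end RootsOfUnity

/-! ### Correlations of the wavelet coefficients in spectral form. -/

section Correlation

variable {Ω : Type*} [MeasurableSpace Ω] {P : Measure Ω} [IsProbabilityMeasure P]
  {X : Torus → Ω → ℝ} {a : ℝ → ℝ} {N : ℕ}

lemma ofReal_psi (ha : ∀ ξ, a (-ξ) = a ξ) (N : ℕ) (t : Torus) :
    (psi a N t : ℂ) = ((1 / √N : ℝ) : ℂ) *
      ∑ l ∈ freqs N, ((a (4 * l / N) : ℝ) : ℂ) * fourier l t := by
  rw [psi, Complex.conj_eq_iff_re.1]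
  rw [map_mul, Complex.conj_ofReal, map_sum]
  congr 1
  refine Finset.sum_nbij' (fun l => -l) (fun l => -l) ?_ ?_ ?_ ?_ ?_
  · intro l hl; exact neg_mem_freqs.2 hl
  · intro l hl; exact neg_mem_freqs.2 hl
  · simp
  · simp
  · intro l _
    rw [map_mul, Complex.conj_ofReal, ← fourier_neg]
    have : a (4 * ((-l : ℤ) : ℝ) / N) = a (4 * l / N) := by
      push_cast
      rw [mul_neg, neg_div, ha]
    rw [this]

lemma continuous_psi (a : ℝ → ℝ) (N : ℕ) : Continuous (psi a N) := by
  unfold psi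
  fun_prop

lemma beta_eq_fieldIntReal (k : ℕ) :
    beta a X N k = fieldIntReal X fun θ => psi a N (θ - ((k * (2 * π / N) : ℝ) : Torus)) := by
  funext ω
  simp only [beta, fieldIntReal, mul_comm]

/-- The normalized spectral weight `C_l a² (4 l / N) / σ_N²`. -/
noncomputable def specWeight (a : ℝ → ℝ) (P : Measure Ω) (X : Torus → Ω → ℝ) (N : ℕ) (l : ℤ) : ℝ :=
  powerSpectrum P X l * a (4 * l / N) ^ 2 / sigmaSq a P X N

lemma powerSpectrum_nonneg (l : ℤ) : 0 ≤ powerSpectrum P X l :=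
  integral_nonneg fun _ => sq_nonneg _

lemma sigmaSq_nonneg : 0 ≤ sigmaSq a P X N :=
  mul_nonneg (by positivity) (Finset.sum_nonneg fun _ _ =>
    mul_nonneg (powerSpectrum_nonneg _) (sq_nonneg _))

lemma specWeight_nonneg (l : ℤ) : 0 ≤ specWeight a P X N l :=
  div_nonneg (mul_nonneg (powerSpectrum_nonneg _) (sq_nonneg _)) sigmaSq_nonneg

lemma sum_specWeight (hN : 0 < N) (hσ : sigmaSq a P X N ≠ 0) :
    ∑ l ∈ freqs N, specWeight a P X N l = N := by
  have : (N : ℝ) ≠ 0 := by positivity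
  simp only [specWeight]
  rw [← Finset.sum_div, div_eq_iff hσ, sigmaSq]
  field_simp

/-- The correlation of two normalized wavelet coefficients. -/
noncomputable def corr (a : ℝ → ℝ) (P : Measure Ω) (X : Torus → Ω → ℝ) (N k k' : ℕ) : ℝ :=
  ∫ ω, betaHat a P X N k ω * betaHat a P X N k' ω ∂P

variable (hX : IsIsotropicField P X)
include hX

lemma ae_beta_eq (ha : ∀ ξ, a (-ξ) = a ξ) :
    ∀ᵐ ω ∂P, ∀ k, (beta a X N k ω : ℂ) = ((1 / √N : ℝ) : ℂ) *
      ∑ l ∈ freqs N, ((a (4 * l / N) : ℝ) : ℂ) * zeta N ^ (-l * (k : ℤ)) * coeff X (-l) ω := by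
  filter_upwards [hX.ae_integrable_mul] with ω hω k
  have hi : ∀ l : ℤ, Integrable (fun θ : Torus => ((a (4 * l / N) : ℝ) : ℂ) *
      zeta N ^ (-l * (k : ℤ)) * (fourier l θ * (X θ ω : ℂ))) AddCircle.haarAddCircle :=
    fun l => (hω _ (fourier l).continuous).const_mul _
  have e : ∀ θ : Torus, (psi a N (θ - ((k * (2 * π / N) : ℝ) : Torus)) : ℂ) * (X θ ω : ℂ) =
      ((1 / √N : ℝ) : ℂ) * ∑ l ∈ freqs N, ((a (4 * l / N) : ℝ) : ℂ) *
        zeta N ^ (-l * (k : ℤ)) * (fourier l θ * (X θ ω : ℂ)) := by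
    intro θ
    rw [ofReal_psi ha, mul_assoc, Finset.sum_mul]
    congr 1
    refine Finset.sum_congr rfl fun l _ => ?_
    have : fourier l (θ - ((k * (2 * π / N) : ℝ) : Torus)) =
        fourier l θ * zeta N ^ (-l * (k : ℤ)) := by
      rw [← fourier_grid]
      simp [sub_eq_add_neg, fourier_apply, AddCircle.toCircle_add]
    rw [this]
    ring
  rw [beta_eq_fieldIntReal, ← fieldInt_ofReal, fieldInt]
  simp_rw [e]
  rw [integral_const_mul, integral_finsetSum _ fun l _ => hi l]
  congr 1
  refine Finset.sum_congr rfl fun l _ => ?_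
  rw [integral_const_mul, coeff_eq_fieldInt, fieldInt, neg_neg]

lemma integral_beta_mul_beta (ha : ∀ ξ, a (-ξ) = a ξ) (k k' : ℕ) :
    ((∫ ω, beta a X N k ω * beta a X N k' ω ∂P : ℝ) : ℂ) =
      1 / N * ∑ l ∈ freqs N, ((powerSpectrum P X l * a (4 * l / N) ^ 2 : ℝ) : ℂ) *
        zeta N ^ (l * ((k' : ℤ) - k)) := by
  rw [← integral_complex_ofReal]
  have e : (fun ω => ((beta a X N k ω * beta a X N k' ω : ℝ) : ℂ)) =ᵐ[P] fun ω =>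
      (1 / N : ℂ) * ∑ l ∈ freqs N, ∑ m ∈ freqs N,
        ((a (4 * l / N) : ℝ) : ℂ) * ((a (4 * m / N) : ℝ) : ℂ) *
          zeta N ^ (-l * (k : ℤ)) * zeta N ^ (-m * (k' : ℤ)) *
          (coeff X (-l) ω * coeff X (-m) ω) := by
    filter_upwards [ae_beta_eq (N := N) hX ha] with ω hω
    rw [Complex.ofReal_mul, hω k, hω k', mul_mul_mul_comm, Finset.sum_mul_sum]
    congr 1
    · rw [← Complex.ofReal_mul, div_mul_div_comm, Real.mul_self_sqrt (by positivity)]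
      simp
    · refine Finset.sum_congr rfl fun l _ => Finset.sum_congr rfl fun m _ => ?_
      ring
  rw [integral_congr_ae e, integral_const_mul]
  have hi : ∀ l m : ℤ, Integrable (fun ω => ((a (4 * l / N) : ℝ) : ℂ) *
      ((a (4 * m / N) : ℝ) : ℂ) * zeta N ^ (-l * (k : ℤ)) * zeta N ^ (-m * (k' : ℤ)) *
          (coeff X (-l) ω * coeff X (-m) ω)) P := fun l m =>
    ((hX.memLp_coeff (-l)).integrable_mul (hX.memLp_coeff (-m))).const_mul _
  rw [integral_finsetSum _ fun l _ => integrable_finsetSum _ fun m _ => hi l m]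
  congr 1
  refine Finset.sum_congr rfl fun l hl => ?_
  rw [integral_finsetSum _ fun m _ => hi l m, Finset.sum_eq_single (-l)]
  · rw [integral_const_mul, hX.integral_coeff_mul_coeff, if_pos rfl, IsIsotropicField.powerSpectrum_neg]
    have : a (4 * ((-l : ℤ) : ℝ) / N) = a (4 * l / N) := by
      push_cast
      rw [mul_neg, neg_div, ha]
    rw [this, mul_sub, neg_neg, sub_eq_neg_add, zpow_add₀ zeta_ne_zero, neg_mul]
    push_cast
    ring
  · intro m _ hm
    rw [integral_const_mul, hX.integral_coeff_mul_coeff, if_neg, mul_zero]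
    omega
  · intro h
    exact absurd (neg_mem_freqs.2 hl) h

lemma corr_eq (ha : ∀ ξ, a (-ξ) = a ξ) (k k' : ℕ) :
    (corr a P X N k k' : ℂ) = 1 / N * ∑ l ∈ freqs N, (specWeight a P X N l : ℂ) *
        zeta N ^ (l * ((k' : ℤ) - k)) := by
  have e : corr a P X N k k' =
      (∫ ω, beta a X N k ω * beta a X N k' ω ∂P) / sigmaSq a P X N := by
    rw [corr, ← integral_div]
    congr 1
    funext ω
    rw [betaHat, betaHat, div_mul_div_comm, Real.mul_self_sqrt sigmaSq_nonneg]
  rw [e, Complex.ofReal_div, integral_beta_mul_beta hX ha, mul_div_assoc, Finset.sum_div]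
  congr 1
  refine Finset.sum_congr rfl fun l _ => ?_
  rw [specWeight]
  push_cast
  ring

lemma corr_self (ha : ∀ ξ, a (-ξ) = a ξ) (hN : 0 < N) (hσ : sigmaSq a P X N ≠ 0) (k : ℕ) :
    corr a P X N k k = 1 := by
  have h := corr_eq (P := P) (N := N) hX ha k k
  simp only [sub_self, mul_zero, zpow_zero, mul_one] at h
  rw [← Complex.ofReal_sum, sum_specWeight hN hσ] at h
  have : (N : ℂ) ≠ 0 := by exact_mod_cast hN.ne'
  rw [Complex.ofReal_natCast, one_div_mul_cancel this] at h
  exact_mod_cast h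

/-- `p`-th powers of the correlations, summed. -/
lemma sum_corr_pow (ha : ∀ ξ, a (-ξ) = a ξ) (hN : 0 < N) (p : ℕ) :
    1 / (N : ℝ) * ∑ k ∈ Finset.Icc 1 N, ∑ k' ∈ Finset.Icc 1 N, corr a P X N k k' ^ p =
      ∑ t ∈ resonant N p, N * ∏ i, (specWeight a P X N (t i) / N) := by
  have hN' : (N : ℂ) ≠ 0 := by exact_mod_cast hN.ne'
  -- The `p`-th power of a character sum is a sum over `p`-tuples. Each of the sums over `k` and
  -- `k'` then gives `N` or `0` according to whether `N` divides the sum of the tuple.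
  have e : ∀ k k' : ℕ, (corr a P X N k k' : ℂ) ^ p =
      ∑ t ∈ Fintype.piFinset fun _ : Fin p => freqs N,
        (∏ i, ((specWeight a P X N (t i) : ℂ) / N)) *
          (zeta N ^ (-(∑ i, t i) * (k : ℤ)) * zeta N ^ ((∑ i, t i) * (k' : ℤ))) := by
    intro k k'
    have : (corr a P X N k k' : ℂ) ^ p = ∏ _i : Fin p, (corr a P X N k k' : ℂ) := by simp
    rw [this, corr_eq hX ha, Finset.mul_sum, Finset.prod_univ_sum]
    refine Finset.sum_congr rfl fun t _ => ?_
    have e3 : -(∑ i, t i) * (k : ℤ) + (∑ i, t i) * (k' : ℤ) = ∑ i, t i * ((k' : ℤ) - k) := by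
      rw [← Finset.sum_mul]
      ring
    rw [← zpow_add₀ zeta_ne_zero, e3, zeta_zpow_sum, ← Finset.prod_mul_distrib]
    refine Finset.prod_congr rfl fun i _ => ?_
    ring
  have key : (1 / (N : ℂ)) * ∑ k ∈ Finset.Icc 1 N, ∑ k' ∈ Finset.Icc 1 N,
      (corr a P X N k k' : ℂ) ^ p =
      ∑ t ∈ resonant N p, N * ∏ i, ((specWeight a P X N (t i) : ℂ) / N) := by
    simp_rw [e]
    have e2 : ∀ k ∈ Finset.Icc 1 N, ∑ k' ∈ Finset.Icc 1 N,
        ∑ t ∈ Fintype.piFinset fun _ : Fin p => freqs N,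
        (∏ i, ((specWeight a P X N (t i) : ℂ) / N)) *
          (zeta N ^ (-(∑ i, t i) * (k : ℤ)) * zeta N ^ ((∑ i, t i) * (k' : ℤ))) =
        ∑ t ∈ Fintype.piFinset fun _ : Fin p => freqs N,
        (∏ i, ((specWeight a P X N (t i) : ℂ) / N)) *
          (zeta N ^ (-(∑ i, t i) * (k : ℤ)) * if (N : ℤ) ∣ ∑ i, t i then (N : ℂ) else 0) := by
      intro k _
      rw [Finset.sum_comm]
      refine Finset.sum_congr rfl fun t _ => ?_
      rw [← Finset.mul_sum, ← Finset.mul_sum, sum_Icc_zeta hN]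
    rw [Finset.sum_congr rfl e2, Finset.sum_comm, resonant, Finset.sum_filter, Finset.mul_sum]
    refine Finset.sum_congr rfl fun t _ => ?_
    rw [← Finset.mul_sum, ← Finset.sum_mul, sum_Icc_zeta hN]
    simp only [dvd_neg]
    split_ifs
    · field_simp
    · simp
  apply Complex.ofReal_injective
  simpa using key

/-- The covariance form at `v` is `N⁻¹` times the squared moduli of the discrete Fourier transform
of `v`, weighted by `specWeight`. Flat weights and Bessel's inequality therefore bound the
covariance operator independently of `N`. -/
lemma integral_sum_betaHat_sq_le (ha : ∀ ξ, a (-ξ) = a ξ) (hN : 0 < N) {Q : ℝ}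
    (hQ : ∀ l, specWeight a P X N l ≤ Q) (v : Finset.Icc 1 N → ℝ) :
    ∑ k, ∑ k', v k * v k' * corr a P X N k k' ≤ 2 * Q * ∑ k, v k ^ 2 := by
  have hN' : (0 : ℝ) < N := by exact_mod_cast hN
  have e : ∑ k, ∑ k', v k * v k' * corr a P X N k k' = 1 / N * ∑ l ∈ freqs N,
      specWeight a P X N l * ‖∑ k, (v k : ℂ) * zeta N ^ (l * ((k : ℕ) : ℤ))‖ ^ 2 := by
    have : ((∑ k, ∑ k', v k * v k' * corr a P X N k k' : ℝ) : ℂ) =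
        ((1 / N * ∑ l ∈ freqs N, specWeight a P X N l *
          ‖∑ k, (v k : ℂ) * zeta N ^ (l * ((k : ℕ) : ℤ))‖ ^ 2 : ℝ) : ℂ) := by
      push_cast
      have e : ∀ l : ℤ, (‖∑ k, (v k : ℂ) * zeta N ^ (l * ((k : ℕ) : ℤ))‖ : ℂ) ^ 2 =
          ∑ k, ∑ k', (v k : ℂ) * v k' * zeta N ^ (l * (((k' : ℕ) : ℤ) - ((k : ℕ) : ℤ))) := by
        intro l
        rw [← Complex.ofReal_pow, ← Complex.normSq_eq_norm_sq, Complex.normSq_eq_conj_mul_self, map_sum,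
          Finset.sum_mul_sum]
        refine Finset.sum_congr rfl fun k _ => Finset.sum_congr rfl fun k' _ => ?_
        rw [map_mul, Complex.conj_ofReal, conj_zeta_zpow, mul_sub, sub_eq_neg_add,
          zpow_add₀ zeta_ne_zero]
        ring
      simp_rw [e, corr_eq hX ha, Finset.mul_sum]
      rw [Finset.sum_comm (s := freqs N)]
      refine Finset.sum_congr rfl fun k _ => ?_
      rw [Finset.sum_comm]
      refine Finset.sum_congr rfl fun k' _ => Finset.sum_congr rfl fun l _ => ?_
      ring
    exact_mod_cast this
  rw [e]
  calc _ ≤ 1 / N * ∑ l ∈ freqs N, Q * ‖∑ k, (v k : ℂ) * zeta N ^ (l * ((k : ℕ) : ℤ))‖ ^ 2 := by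
        gcongr with l _
        exact hQ l
    _ ≤ 1 / N * (Q * (2 * N * ∑ k, v k ^ 2)) := by
        rw [← Finset.mul_sum]
        have hQ0 : 0 ≤ Q := (specWeight_nonneg 0).trans (hQ 0)
        gcongr
        exact sum_freqs_norm_sq_le hN v
    _ = _ := by field_simp

/-- The wavelet coefficients have mean zero over the grid. -/
lemma ae_sum_beta (ha : ∀ ξ, a (-ξ) = a ξ) (hN : 0 < N) :
    ∀ᵐ ω ∂P, ∑ k ∈ Finset.Icc 1 N, beta a X N k ω = 0 := by
  filter_upwards [ae_beta_eq (N := N) hX ha] with ω hω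
  have : (∑ k ∈ Finset.Icc 1 N, (beta a X N k ω : ℂ)) = 0 := by
    simp_rw [hω]
    rw [← Finset.mul_sum, Finset.sum_comm]
    simp_rw [← Finset.sum_mul, ← Finset.mul_sum, sum_Icc_zeta hN]
    rw [Finset.sum_eq_zero, mul_zero]
    intro l hl
    rw [if_neg]
    · simp
    -- As `|l| ≤ N / 2 < N`, divisibility by `N` would force `l = 0`, which `N ≤ 8 |l|` excludes.
    · intro hd
      have h := mem_freqs.1 hl
      have := Int.eq_zero_of_abs_lt_dvd ((dvd_neg).1 hd) (by omega)
      subst this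
      simp at h
      omega
  exact_mod_cast this

end Correlation

/-! ### Frequencies at which the window is bounded away from zero. -/

section Window

variable {a : ℝ → ℝ} (ha : IsWindow a)
include ha

lemma IsWindow.sq_le_one (ξ : ℝ) : a ξ ^ 2 ≤ 1 := by
  obtain ⟨φ, -, h, -, -, h2⟩ := ha.exists_cutoff
  rw [h2]
  linarith [(h (ξ / 2)).2, (h ξ).1]

lemma IsWindow.mem_of_ne_zero {ξ : ℝ} (hξ : a ξ ≠ 0) : 1 / 2 ≤ |ξ| ∧ |ξ| ≤ 2 := by
  obtain ⟨φ, -, -, h1, h0, h2⟩ := ha.exists_cutoff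
  by_contra hc
  apply hξ
  rw [← pow_eq_zero_iff two_ne_zero, h2]
  have e : |ξ / 2| = |ξ| / 2 := by rw [abs_div, abs_two]
  rcases not_and_or.1 hc with h | h <;> push Not at h
  · rw [h1 _ h.le, h1 _ (by rw [e]; linarith [abs_nonneg ξ]), sub_self]
  · rw [h0 ξ (by linarith), h0 (ξ / 2) (by rw [e]; linarith), sub_self]

lemma IsWindow.mem_freqs {N : ℕ} (hN : 0 < N) {l : ℤ} (hl : a (4 * l / N) ≠ 0) :
    l ∈ freqs N := by
  have hN' : (0 : ℝ) < N := by exact_mod_cast hN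
  have h := ha.mem_of_ne_zero hl
  rw [abs_div, abs_mul, Nat.abs_cast, abs_of_pos (by norm_num : (0 : ℝ) < 4), le_div_iff₀ hN',
    div_le_iff₀ hN'] at h
  rw [Needlet.mem_freqs]
  have h1 : (N : ℝ) ≤ 8 * |(l : ℝ)| := by linarith
  have h2 : 2 * |(l : ℝ)| ≤ N := by linarith
  exact ⟨by exact_mod_cast h1, by exact_mod_cast h2⟩

/-- There are two frequencies in the ratio `1 : 2` near which the window is not small. -/
lemma IsWindow.exists_plateau : ∃ c δ : ℝ, 0 < δ ∧ (∀ ξ, |ξ - c| < δ → 1 / 4 ≤ a ξ ^ 2) ∧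
    ∀ ξ, |ξ - 2 * c| < δ → 1 / 4 ≤ a ξ ^ 2 := by
  obtain ⟨φ, hs, -, h1, h0, h2⟩ := ha.exists_cutoff
  have hφ : Continuous φ := hs.continuous
  have hac : Continuous fun ξ => a ξ ^ 2 := ha.smooth.continuous.pow 2
  -- The cutoff is prescribed to vanish only for `|ξ| > 1`; its value at `1` is a limit from the
  -- right.
  have e1 : φ 1 = 0 := by
    have : Tendsto φ (𝓝[>] 1) (𝓝 (φ 1)) := hφ.continuousAt.tendsto.mono_left nhdsWithin_le_nhds
    refine tendsto_nhds_unique this (tendsto_const_nhds.congr' ?_)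
    filter_upwards [self_mem_nhdsWithin] with x hx
    exact (h0 x (lt_of_lt_of_le hx (le_abs_self x))).symm
  have e2 : φ (1 / 2) = 1 := h1 _ (by rw [abs_of_pos (by norm_num)])
  -- Take `c` with `φ c = 1 / 2`. Then `a(c)² = φ(c/2) - φ(c) = 1 - 1/2` and `a(2c)² = φ(c) - φ(2c)
  -- = 1/2 - 0`, so `c` and `2c` are good simultaneously.
  obtain ⟨c, hc, hφc⟩ := intermediate_value_Icc' (by norm_num : (1 / 2 : ℝ) ≤ 1) hφ.continuousOn
    (show (1 / 2 : ℝ) ∈ Set.Icc (φ 1) (φ (1 / 2)) by rw [e1, e2]; norm_num)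
  have hc2 : 1 / 2 < c := lt_of_le_of_ne hc.1 fun h => by
    rw [← h, e2] at hφc
    norm_num at hφc
  have a1 : a c ^ 2 = 1 / 2 := by
    rw [h2, hφc, h1 (c / 2) (by rw [abs_of_pos (by linarith)]; linarith [hc.2])]
    norm_num
  have a2 : a (2 * c) ^ 2 = 1 / 2 := by
    rw [h2, h0 (2 * c) (by rw [abs_of_pos (by linarith)]; linarith), mul_div_cancel_left₀ _ two_ne_zero, hφc]
    norm_num
  have n1 : ∀ᶠ ξ in 𝓝 c, 1 / 4 ≤ a ξ ^ 2 :=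
    (hac.continuousAt.eventually (lt_mem_nhds (by simp only [a1]; norm_num))).mono fun _ h => h.le
  have n2 : ∀ᶠ ξ in 𝓝 (2 * c), 1 / 4 ≤ a ξ ^ 2 :=
    (hac.continuousAt.eventually (lt_mem_nhds (by simp only [a2]; norm_num))).mono fun _ h => h.le
  obtain ⟨δ₁, hδ₁, H1⟩ := Metric.eventually_nhds_iff.1 n1
  obtain ⟨δ₂, hδ₂, H2⟩ := Metric.eventually_nhds_iff.1 n2
  exact ⟨c, min δ₁ δ₂, lt_min hδ₁ hδ₂, fun ξ h => H1 (lt_of_lt_of_le h (min_le_left _ _)),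
    fun ξ h => H2 (lt_of_lt_of_le h (min_le_right _ _))⟩

/-- A set of frequencies, of positive density, on which and on whose sumset the window is not
small. -/
lemma IsWindow.exists_sum_stable : ∃ κ : ℝ, 0 < κ ∧ ∀ᶠ N : ℕ in atTop, ∃ G : Finset ℤ,
    κ * N ≤ G.card ∧ ∀ l ∈ G, ∀ m ∈ G, 1 / 4 ≤ a (4 * l / N) ^ 2 ∧
      1 / 4 ≤ a (4 * (l + m : ℤ) / N) ^ 2 := by
  obtain ⟨c, δ, hδ, h1, h2⟩ := ha.exists_plateau
  -- The integers `l` with `4 l / N` within `δ / 4` of `c` fill an interval of length `δ N / 8`.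
  -- There are at least `δ N / 8 - 1` of them, which is at least `δ N / 16` once `N ≥ 16 / δ`.
  refine ⟨δ / 16, by positivity, ?_⟩
  filter_upwards [eventually_gt_atTop 0, tendsto_natCast_atTop_atTop.eventually_ge_atTop (16 / δ)]
    with N hN hN2
  have hN' : (0 : ℝ) < N := by exact_mod_cast hN
  rw [div_le_iff₀ hδ] at hN2
  refine ⟨Finset.Icc ⌈(c - δ / 4) * N / 4⌉ ⌊(c + δ / 4) * N / 4⌋, ?_, fun l hl m hm => ?_⟩
  · rw [Int.card_Icc]
    have : (⌊(c + δ / 4) * N / 4⌋ + 1 - ⌈(c - δ / 4) * N / 4⌉ : ℤ) ≤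
        (((⌊(c + δ / 4) * N / 4⌋ + 1 - ⌈(c - δ / 4) * N / 4⌉).toNat : ℤ)) := Int.self_le_toNat _
    have h3 : ((⌊(c + δ / 4) * N / 4⌋ : ℝ) + 1 - ⌈(c - δ / 4) * N / 4⌉) ≤
        (((⌊(c + δ / 4) * N / 4⌋ + 1 - ⌈(c - δ / 4) * N / 4⌉).toNat : ℝ)) := by exact_mod_cast this
    have h4 := Int.lt_floor_add_one ((c + δ / 4) * N / 4)
    have h5 := Int.ceil_lt_add_one ((c - δ / 4) * N / 4)
    nlinarith
  · rw [Finset.mem_Icc, Int.ceil_le, Int.le_floor] at hl hm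
    have key : ∀ l : ℤ, (c - δ / 4) * N / 4 ≤ l ∧ (l : ℝ) ≤ (c + δ / 4) * N / 4 →
        c - δ / 4 ≤ 4 * l / N ∧ 4 * l / N ≤ c + δ / 4 := fun l hl => by
      rw [le_div_iff₀ hN', div_le_iff₀ hN']
      constructor <;> linarith [hl.1, hl.2]
    have kl := key l hl
    have km := key m hm
    refine ⟨h1 _ (abs_lt.2 ⟨by linarith, by linarith⟩), h2 _ ?_⟩
    have : 4 * ((l + m : ℤ) : ℝ) / N = 4 * l / N + 4 * m / N := by push_cast; ring
    rw [this, abs_lt]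
    constructor <;> linarith

end Window

/-! ### Uniform bounds for the spectral weights. -/

section Bounds

variable {Ω : Type*} [MeasurableSpace Ω] {P : Measure Ω} [IsProbabilityMeasure P]
  {X : Torus → Ω → ℝ} {a : ℝ → ℝ}

/-- On the band `|l| / N` stays between `1 / 8` and `1 / 2`, so every `C_l` is comparable to the
common scale `s = N^{-α}`, which cancels in `C_l / σ_N²`. -/
lemma PowerLawSpectrum.exists_bounds (hA1 : PowerLawSpectrum P X) : ∃ B₁ B₂ : ℝ, 0 < B₁ ∧ 0 < B₂ ∧
    ∀ N : ℕ, 0 < N → ∃ s : ℝ, 0 < s ∧ ∀ l ∈ freqs N,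
      B₁ * s ≤ powerSpectrum P X l ∧ powerSpectrum P X l ≤ B₂ * s := by
  obtain ⟨g, c₁, c₂, α, hc₁, hα, hg, hC⟩ := hA1
  have hc₂ : 0 < c₂ := hc₁.trans_le ((hg 1 le_rfl).1.trans (hg 1 le_rfl).2)
  refine ⟨c₁ * 2 ^ α, c₂ * 8 ^ α, by positivity, by positivity, fun N hN => ?_⟩
  have hN' : (0 : ℝ) < N := by exact_mod_cast hN
  refine ⟨(N : ℝ) ^ (-α), by positivity, fun l hl => ?_⟩
  obtain ⟨h1, h2⟩ := mem_freqs.1 hl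
  rw [Int.abs_eq_natAbs] at h1 h2
  have hn : 1 ≤ l.natAbs := by omega
  have e : powerSpectrum P X l = g l.natAbs * (l.natAbs : ℝ) ^ (-α) := by
    rw [← hC _ hn]
    rcases Int.natAbs_eq l with h | h
    · rw [← h]
    · conv_lhs => rw [h]
      exact IsIsotropicField.powerSpectrum_neg _
  have r1 : (N : ℝ) ≤ 8 * l.natAbs := by
    have : N ≤ 8 * l.natAbs := by omega
    exact_mod_cast this
  have r2 : 2 * (l.natAbs : ℝ) ≤ N := by
    have : 2 * l.natAbs ≤ N := by omega
    exact_mod_cast this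
  have hl0 : (0 : ℝ) < l.natAbs := by exact_mod_cast hn
  have p1 : ((N : ℝ) / 2) ^ (-α) ≤ (l.natAbs : ℝ) ^ (-α) :=
    Real.rpow_le_rpow_of_nonpos hl0 (by linarith) (by linarith)
  have p2 : (l.natAbs : ℝ) ^ (-α) ≤ ((N : ℝ) / 8) ^ (-α) :=
    Real.rpow_le_rpow_of_nonpos (by positivity) (by linarith) (by linarith)
  rw [Real.div_rpow hN'.le (by norm_num), Real.rpow_neg (by norm_num : (0 : ℝ) ≤ 2), div_inv_eq_mul]
    at p1
  rw [Real.div_rpow hN'.le (by norm_num), Real.rpow_neg (by norm_num : (0 : ℝ) ≤ 8), div_inv_eq_mul]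
    at p2
  have hgl := hg _ hn
  rw [e]
  constructor
  · calc _ = c₁ * ((N : ℝ) ^ (-α) * 2 ^ α) := by ring
      _ ≤ _ := mul_le_mul hgl.1 p1 (by positivity) (hc₁.le.trans hgl.1)
  · calc _ ≤ c₂ * ((N : ℝ) ^ (-α) * 8 ^ α) := mul_le_mul hgl.2 p2 (by positivity) hc₂.le
      _ = _ := by ring

/-- Uniform bounds for the normalized spectral weights. -/
structure HasSpectralBounds (a : ℝ → ℝ) (P : Measure Ω) (X : Torus → Ω → ℝ) (N : ℕ)
    (Q q₀ κ : ℝ) : Prop where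
  pos : 0 < N
  sigmaSq_pos : 0 < sigmaSq a P X N
  powerSpectrum_ne_zero : ∀ l ∈ freqs N, powerSpectrum P X l ≠ 0
  specWeight_le : ∀ l, specWeight a P X N l ≤ Q
  exists_finset : ∃ G : Finset ℤ, κ * N ≤ G.card ∧ ∀ l ∈ G, ∀ m ∈ G,
    l ∈ freqs N ∧ l + m ∈ freqs N ∧
      q₀ ≤ specWeight a P X N l ∧ q₀ ≤ specWeight a P X N (l + m)

/-- The sum `W = N σ_N²` lies between `κ N B₁ s / 4`, from the good frequencies alone, and `3 N B₂
s`, from the cardinality of the band. Dividing the extreme terms by these gives `Q` and `q₀`. -/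
theorem exists_hasSpectralBounds (ha : IsWindow a) (hA1 : PowerLawSpectrum P X) :
    ∃ Q q₀ κ : ℝ, 0 < Q ∧ 0 < q₀ ∧ 0 < κ ∧
      ∀ᶠ N : ℕ in atTop, HasSpectralBounds a P X N Q q₀ κ := by
  obtain ⟨B₁, B₂, hB₁, hB₂, hB⟩ := hA1.exists_bounds
  obtain ⟨κ, hκ, hG⟩ := ha.exists_sum_stable
  refine ⟨4 * B₂ / (κ * B₁), B₁ / (12 * B₂), κ, by positivity, by positivity, hκ, ?_⟩
  filter_upwards [hG, eventually_gt_atTop 0] with N ⟨G, hGc, hGa⟩ hN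
  obtain ⟨s, hs, hs2⟩ := hB N hN
  have hN' : (0 : ℝ) < N := by exact_mod_cast hN
  have hf : ∀ l : ℤ, 1 / 4 ≤ a (4 * l / N) ^ 2 → l ∈ freqs N := fun l h =>
    ha.mem_freqs hN fun h0 => by rw [h0] at h; norm_num at h
  set W := ∑ l ∈ freqs N, powerSpectrum P X l * a (4 * l / N) ^ 2 with hW
  have hσ : sigmaSq a P X N = W / N := by rw [sigmaSq, ← hW]; ring
  have hW1 : κ * N * (B₁ * s * (1 / 4)) ≤ W := by
    calc κ * N * (B₁ * s * (1 / 4)) ≤ G.card * (B₁ * s * (1 / 4)) := by gcongr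
      _ = ∑ _l ∈ G, B₁ * s * (1 / 4) := by simp
      _ ≤ ∑ l ∈ G, powerSpectrum P X l * a (4 * l / N) ^ 2 := by
          refine Finset.sum_le_sum fun l hl => ?_
          have h := (hGa l hl l hl).1
          exact mul_le_mul (hs2 l (hf l h)).1 h (by norm_num) (powerSpectrum_nonneg _)
      _ ≤ W := Finset.sum_le_sum_of_subset_of_nonneg (fun l hl => hf l (hGa l hl l hl).1)
          fun l _ _ => mul_nonneg (powerSpectrum_nonneg _) (sq_nonneg _)
  have hW2 : W ≤ 3 * N * (B₂ * s) := by
    calc W ≤ ∑ _l ∈ freqs N, B₂ * s := by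
          refine Finset.sum_le_sum fun l hl => ?_
          calc _ ≤ B₂ * s * 1 := mul_le_mul (hs2 l hl).2 (ha.sq_le_one _) (sq_nonneg _)
                (by positivity)
            _ = _ := mul_one _
      _ = (freqs N).card * (B₂ * s) := by simp
      _ ≤ _ := by
          gcongr
          exact_mod_cast card_freqs_le hN
  have hW0 : 0 < W := lt_of_lt_of_le (by positivity) hW1
  have hlow : ∀ l : ℤ, 1 / 4 ≤ a (4 * l / N) ^ 2 → B₁ / (12 * B₂) ≤ specWeight a P X N l := by
    intro l h
    have h1 : B₁ * s * (1 / 4) ≤ powerSpectrum P X l * a (4 * l / N) ^ 2 :=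
      mul_le_mul (hs2 l (hf l h)).1 h (by norm_num) (powerSpectrum_nonneg _)
    rw [specWeight, hσ, div_div_eq_mul_div, div_le_div_iff₀ (by positivity) hW0]
    calc B₁ * W ≤ B₁ * (3 * N * (B₂ * s)) := by gcongr
      _ = B₁ * s * (1 / 4) * N * (12 * B₂) := by ring
      _ ≤ _ := by gcongr
  refine ⟨hN, by rw [hσ]; positivity, fun l hl => ?_, fun l => ?_, G, hGc, fun l hl m hm => ?_⟩
  · exact (lt_of_lt_of_le (by positivity) (hs2 l hl).1).ne'
  · by_cases h0 : a (4 * l / N) = 0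
    · rw [specWeight, h0]
      simp
      positivity
    · have hl := ha.mem_freqs hN h0
      have h1 : powerSpectrum P X l * a (4 * l / N) ^ 2 ≤ B₂ * s * 1 :=
        mul_le_mul (hs2 l hl).2 (ha.sq_le_one _) (sq_nonneg _) (by positivity)
      rw [specWeight, hσ, div_div_eq_mul_div, div_le_div_iff₀ hW0 (by positivity)]
      calc _ ≤ B₂ * s * 1 * N * (κ * B₁) := by gcongr
        _ = 4 * B₂ * (κ * N * (B₁ * s * (1 / 4))) := by ring
        _ ≤ _ := by gcongr
  · obtain ⟨h1, h2⟩ := hGa l hl m hm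
    exact ⟨hf l h1, hf _ h2, hlow l h1, hlow _ h2⟩

end Bounds

/-! ### Convergence in probability to constants. -/

section InMeasure

variable {Ω : Type*} [MeasurableSpace Ω] {P : Measure Ω}

lemma tendstoInMeasure_comp_continuousAt {E F : Type*} [PseudoMetricSpace E] [PseudoMetricSpace F]
    {f : ℕ → Ω → E} {c : E} (hf : TendstoInMeasure P f atTop fun _ => c) {h : E → F}
    (hh : ContinuousAt h c) : TendstoInMeasure P (fun n ω => h (f n ω)) atTop fun _ => h c := by
  rw [tendstoInMeasure_iff_dist] at hf ⊢
  intro ε hε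
  obtain ⟨δ, hδ, H⟩ := Metric.continuousAt_iff.1 hh ε hε
  refine tendsto_of_tendsto_of_tendsto_of_le_of_le tendsto_const_nhds (hf δ hδ)
    (fun _ => zero_le) fun n => measure_mono fun ω hω => ?_
  by_contra hc
  exact absurd (H (not_le.1 hc)) (not_lt.2 hω)

lemma tendstoInMeasure_prodMk {E F : Type*} [PseudoMetricSpace E] [PseudoMetricSpace F]
    {f : ℕ → Ω → E} {g : ℕ → Ω → F} {c : E} {d : F}
    (hf : TendstoInMeasure P f atTop fun _ => c) (hg : TendstoInMeasure P g atTop fun _ => d) :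
    TendstoInMeasure P (fun n ω => (f n ω, g n ω)) atTop fun _ => (c, d) := by
  rw [tendstoInMeasure_iff_dist] at hf hg ⊢
  intro ε hε
  have := (hf ε hε).add (hg ε hε)
  rw [add_zero] at this
  refine tendsto_of_tendsto_of_tendsto_of_le_of_le tendsto_const_nhds this
    (fun _ => zero_le) fun n => (measure_mono fun ω hω => ?_).trans (measure_union_le _ _)
  simpa [Prod.dist_eq] using hω

/-- The weights need not converge. This is used for the kurtosis variance, whose two summands have
no limiting proportion in general. -/
lemma tendstoInMeasure_convex_comb {f g : ℕ → Ω → ℝ} {c : ℝ} {w : ℕ → ℝ}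
    (hf : TendstoInMeasure P f atTop fun _ => c) (hg : TendstoInMeasure P g atTop fun _ => c)
    (hw₀ : ∀ n, 0 ≤ w n) (hw₁ : ∀ n, w n ≤ 1) :
    TendstoInMeasure P (fun n ω => w n * f n ω + (1 - w n) * g n ω) atTop fun _ => c := by
  have h := tendstoInMeasure_prodMk hf hg
  rw [tendstoInMeasure_iff_dist] at h ⊢
  intro ε hε
  refine tendsto_of_tendsto_of_tendsto_of_le_of_le tendsto_const_nhds (h (ε / 2) (by positivity))
    (fun _ => zero_le) fun n => measure_mono fun ω hω => ?_
  by_contra hc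
  replace hc : dist (f n ω, g n ω) (c, c) < ε / 2 := not_le.1 hc
  rw [Prod.dist_eq, max_lt_iff, Real.dist_eq, Real.dist_eq] at hc
  dsimp only at hc
  simp only [Real.dist_eq] at hω
  have e : w n * f n ω + (1 - w n) * g n ω - c = w n * (f n ω - c) + (1 - w n) * (g n ω - c) := by
    ring
  have := hw₀ n
  have := hw₁ n
  refine (not_le.2 ?_ : ¬ ε ≤ |w n * f n ω + (1 - w n) * g n ω - c|) hω
  rw [e]
  rw [abs_lt] at hc ⊢
  have := abs_lt.1 hc.2
  constructor <;> nlinarith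

/-- Chebyshev's inequality; the centring `m n` need only be bounded below, not convergent. -/
lemma tendstoInMeasure_div_of_integral_sq_le [IsFiniteMeasure P] {Y : ℕ → Ω → ℝ} {m r : ℕ → ℝ}
    {b : ℝ} (hb : 0 < b) (hm : ∀ n, b ≤ m n) (hi : ∀ n, Integrable (fun ω => (Y n ω - m n) ^ 2) P)
    (hr : Tendsto r atTop (𝓝 0)) (hY : ∀ n, ∫ ω, (Y n ω - m n) ^ 2 ∂P ≤ r n) :
    TendstoInMeasure P (fun n ω => Y n ω / m n) atTop fun _ => 1 := by
  rw [tendstoInMeasure_iff_measureReal_dist]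
  intro ε hε
  have hlim : Tendsto (fun n => r n / (ε * b) ^ 2) atTop (𝓝 0) := by
    simpa using hr.div_const ((ε * b) ^ 2)
  refine tendsto_of_tendsto_of_tendsto_of_le_of_le tendsto_const_nhds hlim
    (fun _ => measureReal_nonneg) fun n => ?_
  have h := mul_meas_ge_le_integral_of_nonneg (ae_of_all P fun ω => sq_nonneg (Y n ω - m n)) (hi n)
    ((ε * b) ^ 2)
  rw [le_div_iff₀ (by positivity), mul_comm]
  refine le_trans (mul_le_mul_of_nonneg_left (measureReal_mono fun ω hω => ?_) (by positivity))
    (h.trans (hY n))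
  have hmn : 0 < m n := hb.trans_le (hm n)
  simp only [Real.dist_eq, Set.mem_ofPred_eq] at hω ⊢
  have e : Y n ω / m n - 1 = (Y n ω - m n) / m n := by field_simp
  rw [e, abs_div, abs_of_pos hmn, le_div_iff₀ hmn] at hω
  rw [← sq_abs (Y n ω - m n)]
  have := mul_le_mul_of_nonneg_left (hm n) hε.le
  gcongr
  linarith

end InMeasure

/-! ### Consistency and nondegeneracy of the variance estimators. -/

section Estimators

variable {Ω : Type*} [MeasurableSpace Ω] {P : Measure Ω} [IsProbabilityMeasure P]
  {X : Torus → Ω → ℝ} {a : ℝ → ℝ} {N p : ℕ} {Q q₀ κ : ℝ}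

/-- The weight of a tuple of frequencies in the spectral form of the sum of the `p`-th powers of
the correlations. -/
noncomputable def tupleWeight (a : ℝ → ℝ) (P : Measure Ω) (X : Torus → Ω → ℝ) (N : ℕ) {p : ℕ}
    (t : Fin p → ℤ) : ℝ :=
  N * ∏ i, (specWeight a P X N (t i) / N)

/-- `N⁻¹ ∑_{k, k'} ρ (k, k')^p` in spectral form. -/
noncomputable def corrPower (a : ℝ → ℝ) (P : Measure Ω) (X : Torus → Ω → ℝ) (N p : ℕ) : ℝ :=
  ∑ t ∈ resonant N p, tupleWeight a P X N t

/-- The empirical version of `corrPower`. -/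
noncomputable def corrPowerEst (a : ℝ → ℝ) (P : Measure Ω) (X : Torus → Ω → ℝ) (N p : ℕ) (ω : Ω) :
    ℝ :=
  ∑ t ∈ resonant N p, tupleWeight a P X N t * ((∏ i, specRatio P X (t i) ω) / delta P X t)

/-- The ratio `σ̂_N² / σ_N²`. -/
noncomputable def sigmaRatio (a : ℝ → ℝ) (P : Measure Ω) (X : Torus → Ω → ℝ) (N : ℕ) (ω : Ω) : ℝ :=
  sigmaSqEst a X N ω / sigmaSq a P X N

lemma tupleWeight_nonneg (t : Fin p → ℤ) : 0 ≤ tupleWeight a P X N t :=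
  mul_nonneg (Nat.cast_nonneg _) (Finset.prod_nonneg fun _ _ =>
    div_nonneg (specWeight_nonneg _) (Nat.cast_nonneg _))

namespace HasSpectralBounds

variable (hb : HasSpectralBounds a P X N Q q₀ κ)
include hb

lemma norm_coeff_sq_mul {l : ℤ} (hl : l ∈ freqs N) (ω : Ω) :
    ‖coeff X l ω‖ ^ 2 * a (4 * l / N) ^ 2 =
      sigmaSq a P X N * (specWeight a P X N l * specRatio P X l ω) := by
  have h1 := hb.powerSpectrum_ne_zero l hl
  have h2 := hb.sigmaSq_pos.ne'
  rw [specWeight, specRatio]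
  field_simp

lemma fejerSum_eq (ω : Ω) :
    fejerSum a P X p N ω =
      (N * sigmaSq a P X N) ^ p / (2 * π) * corrPowerEst a P X N p ω := by
  have hN := hb.pos
  have hN' : (N : ℝ) ≠ 0 := by positivity
  rw [fejerSum, corrPowerEst, resonant, Finset.sum_filter, Finset.mul_sum]
  refine Finset.sum_congr rfl fun t ht => ?_
  rw [fejer_eq hN]
  split_ifs
  · rw [Finset.prod_congr rfl fun i _ =>
      hb.norm_coeff_sq_mul (Fintype.mem_piFinset.1 ht i) ω, tupleWeight]
    simp only [Finset.prod_mul_distrib, Finset.prod_div_distrib, Finset.prod_const,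
      Finset.card_univ, Fintype.card_fin, mul_pow]
    field_simp
  · simp

lemma skewVarEst_eq (ω : Ω) :
    skewVarEst a P X N ω = 6 * corrPowerEst a P X N 3 ω / sigmaRatio a P X N ω ^ 3 := by
  have hN := hb.pos
  have h2 := hb.sigmaSq_pos.ne'
  rw [skewVarEst, hb.fejerSum_eq, sigmaRatio]
  -- Where `σ̂_N² = 0` both sides vanish, since division by zero gives zero.
  rcases eq_or_ne (sigmaSqEst a X N ω) 0 with h | h
  · simp [h]
  · field_simp
    ring

lemma kurtVarEst_eq (ω : Ω) :
    kurtVarEst a P X N ω = 72 * corrPowerEst a P X N 2 ω / sigmaRatio a P X N ω ^ 2 +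
      24 * corrPowerEst a P X N 4 ω / sigmaRatio a P X N ω ^ 4 := by
  have hN := hb.pos
  have h2 := hb.sigmaSq_pos.ne'
  rw [kurtVarEst, hb.fejerSum_eq, hb.fejerSum_eq, sigmaRatio]
  rcases eq_or_ne (sigmaSqEst a X N ω) 0 with h | h
  · simp [h]
  · field_simp

lemma tupleWeight_le {t : Fin p → ℤ} : tupleWeight a P X N t ≤ N * (Q / N) ^ p := by
  rw [tupleWeight]
  gcongr
  calc ∏ i, specWeight a P X N (t i) / N ≤ ∏ _i : Fin p, Q / N :=
        Finset.prod_le_prod (fun i _ => div_nonneg (specWeight_nonneg _) (Nat.cast_nonneg _))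
          fun i _ => by gcongr; exact hb.specWeight_le _
    _ = _ := by rw [Finset.prod_const, Finset.card_univ, Fintype.card_fin]

omit hb in
lemma isUnitFamily_specRatio (hX : IsIsotropicField P X) (hB : IsGaussianProcess X P) :
    IsUnitFamily P (fun n : ℕ => specRatio P X (n : ℤ))
      {n | n ≠ 0 ∧ powerSpectrum P X (n : ℤ) ≠ 0} gaussMoment where
  indep := hX.iIndepFun_specRatio hB
  measurable n := hX.measurable_specRatio n
  nonneg n ω := specRatio_nonneg _ _
  integrable n hn k := (hX.integral_specRatio_pow_le hB (by exact_mod_cast hn.1) hn.2 k).1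
  mean n hn := hX.integral_specRatio hn.2
  moment n hn k := (hX.integral_specRatio_pow_le hB (by exact_mod_cast hn.1) hn.2 k).2

lemma natAbs_mem {l : ℤ} (hl : l ∈ freqs N) :
    l.natAbs ∈ {n : ℕ | n ≠ 0 ∧ powerSpectrum P X (n : ℤ) ≠ 0} := by
  have hN := hb.pos
  have h1 := hb.powerSpectrum_ne_zero l hl
  refine ⟨fun h0 => ?_, ?_⟩
  · rw [Int.natAbs_eq_zero.1 h0, mem_freqs] at hl
    simp at hl
    omega
  · rcases Int.natAbs_eq l with h | h
    · rwa [← h]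
    · rw [h, IsIsotropicField.powerSpectrum_neg] at h1
      simpa using h1

/-- Mean square error of weighted sums of normalized products of periodogram ordinates. -/
lemma integral_sum_sq_le (hX : IsIsotropicField P X) (hB : IsGaussianProcess X P) [NeZero p]
    {T : Finset (Fin p → ℤ)}
    (hT : ∀ t ∈ T, ∀ i, t i ∈ freqs N) {A : ℕ} (hA₀ : 0 < A)
    (hA : ∀ j v, (T.filter fun t => t j = v).card ≤ A) {c : (Fin p → ℤ) → ℝ} {D : ℝ}
    (hc₀ : ∀ t, 0 ≤ c t) (hc : ∀ t, c t ≤ D / (N * A)) :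
    Integrable (fun ω => (∑ t ∈ T, c t * ((∏ i, specRatio P X (t i) ω) / delta P X t) -
      ∑ t ∈ T, c t) ^ 2) P ∧
    ∫ ω, (∑ t ∈ T, c t * ((∏ i, specRatio P X (t i) ω) / delta P X t) - ∑ t ∈ T, c t) ^ 2 ∂P ≤
      2 * p * gaussMoment (2 * p) * (6 * p ^ 2 * D ^ 2) / N := by
  classical
  have hU := isUnitFamily_specRatio hX hB
  have h := hU.variance_sum_prod_le T (u := fun t i => (t i).natAbs)
    (fun t ht i => hb.natAbs_mem (hT t ht i)) (c := c) fun t _ => hc₀ t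
  simp only [specRatio_natAbs, Fintype.card_fin] at h
  refine ⟨h.1, h.2.trans ?_⟩
  have hs := sum_share_le hb.pos hT hA₀ hA (c := c) (fun t _ => hc₀ t) fun t _ => hc t
  have hm : 0 ≤ gaussMoment (2 * p) := integral_nonneg fun x => (even_two_mul _).pow_nonneg _
  calc _ ≤ 2 * p * gaussMoment (2 * p) * (6 * p ^ 2 * D ^ 2 / N) := by
        refine mul_le_mul_of_nonneg_left (le_trans (le_of_eq ?_) hs) (by positivity)
        refine Finset.sum_congr rfl fun t _ => Finset.sum_congr rfl fun t' _ => ?_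
        congr 1
    _ = _ := by ring

/-- Here `A = 2 (3N)^{p-2}` bounds the fibres of `resonant N p`, and `D = 2 · 3^{p-2} Q^p` is the
value for which `D / (N A)` is exactly the bound `N (Q / N)^p` on a tuple weight. -/
lemma integral_corrPowerEst_sq_le (hX : IsIsotropicField P X) (hB : IsGaussianProcess X P)
    (hp : 2 ≤ p) :
    Integrable (fun ω => (corrPowerEst a P X N p ω - corrPower a P X N p) ^ 2) P ∧
    ∫ ω, (corrPowerEst a P X N p ω - corrPower a P X N p) ^ 2 ∂P ≤
      2 * p * gaussMoment (2 * p) * (6 * p ^ 2 * (2 * 3 ^ (p - 2) * Q ^ p) ^ 2) / N := by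
  have : NeZero p := ⟨by omega⟩
  have hN := hb.pos
  refine hb.integral_sum_sq_le hX hB (T := resonant N p) (A := 2 * (3 * N) ^ (p - 2))
    (fun t ht i => mem_freqs_of_mem_resonant ht i) (by positivity)
    (fun j v => card_resonant_fiber_le hN hp j v) tupleWeight_nonneg
    fun t => hb.tupleWeight_le.trans (le_of_eq ?_)
  obtain ⟨k, rfl⟩ : ∃ k, p = k + 2 := ⟨p - 2, by omega⟩
  have : (N : ℝ) ≠ 0 := by positivity
  push_cast
  rw [mul_pow 3 (N : ℝ), div_pow]
  field_simp
  ring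

omit hb in
lemma sigmaSqEst_eq (ha : ∀ ξ, a (-ξ) = a ξ) (hN : 0 < N) (ω : Ω) :
    sigmaSqEst a X N ω = 1 / N * ∑ l ∈ freqs N, ‖coeff X l ω‖ ^ 2 * a (4 * l / N) ^ 2 := by
  rw [sigmaSqEst, ← Finset.sum_filter_add_sum_filter_not (freqs N) fun l => 0 < l]
  have : ∑ l ∈ (freqs N).filter (fun l => ¬ 0 < l), ‖coeff X l ω‖ ^ 2 * a (4 * l / N) ^ 2 =
      ∑ l ∈ (freqs N).filter (fun l => 0 < l), ‖coeff X l ω‖ ^ 2 * a (4 * l / N) ^ 2 := by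
    refine Finset.sum_nbij' (fun l => -l) (fun l => -l) ?_ ?_ (by simp) (by simp) ?_
    · intro l hl
      obtain ⟨h1, h2⟩ := Finset.mem_filter.1 hl
      refine Finset.mem_filter.2 ⟨neg_mem_freqs.2 h1, ?_⟩
      have := (mem_freqs.1 h1).1
      have : l ≠ 0 := by
        rintro rfl
        simp at this
        omega
      omega
    · intro l hl
      obtain ⟨h1, h2⟩ := Finset.mem_filter.1 hl
      exact Finset.mem_filter.2 ⟨neg_mem_freqs.2 h1, by omega⟩
    · intro l _
      rw [IsIsotropicField.coeff_neg, RCLike.norm_conj]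
      have : a (4 * ((-l : ℤ) : ℝ) / N) = a (4 * l / N) := by
        push_cast
        rw [mul_neg, neg_div, ha]
      rw [this]
  rw [this]
  ring

/-- The case of `1`-tuples without any resonance condition: `A = 1`, `D = Q`, and `δ_l = 1` because
each normalized ordinate has mean one. -/
lemma integral_sigmaRatio_sq_le (ha : ∀ ξ, a (-ξ) = a ξ) (hX : IsIsotropicField P X)
    (hB : IsGaussianProcess X P) :
    Integrable (fun ω => (sigmaRatio a P X N ω - 1) ^ 2) P ∧
    ∫ ω, (sigmaRatio a P X N ω - 1) ^ 2 ∂P ≤ 2 * gaussMoment 2 * (6 * Q ^ 2) / N := by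
  have hN := hb.pos
  have hN' : (N : ℝ) ≠ 0 := by positivity
  have hinj : Function.Injective fun (l : ℤ) (_ : Fin 1) => l := fun l m h => congrFun h 0
  set T : Finset (Fin 1 → ℤ) := (freqs N).map ⟨_, hinj⟩ with hT
  have hT1 : ∀ t ∈ T, ∀ i, t i ∈ freqs N := by
    intro t ht i
    obtain ⟨l, hl, rfl⟩ := Finset.mem_map.1 ht
    exact hl
  have hT2 : ∀ j v, (T.filter fun t => t j = v).card ≤ 1 := by
    intro j v
    refine Finset.card_le_one.2 fun t ht t' ht' => funext fun i => ?_
    rw [Subsingleton.elim i j, (Finset.mem_filter.1 ht).2, (Finset.mem_filter.1 ht').2]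
  have h := hb.integral_sum_sq_le hX hB hT1 one_pos hT2 (c := fun t => specWeight a P X N (t 0) / N)
    (D := Q) (fun t => div_nonneg (specWeight_nonneg _) (Nat.cast_nonneg _)) fun t => by
      rw [Nat.cast_one, mul_one]
      gcongr
      exact hb.specWeight_le _
  have e1 : ∑ t ∈ T, specWeight a P X N (t 0) / N = 1 := by
    rw [hT, Finset.sum_map]
    simp only [Function.Embedding.coeFn_mk]
    rw [← Finset.sum_div, sum_specWeight hN hb.sigmaSq_pos.ne', div_self hN']
  have e2 : ∀ ω, ∑ t ∈ T, specWeight a P X N (t 0) / N * ((∏ i, specRatio P X (t i) ω) / delta P X t) =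
      sigmaRatio a P X N ω := by
    intro ω
    rw [hT, Finset.sum_map, sigmaRatio, sigmaSqEst_eq ha hN, Finset.mul_sum, Finset.sum_div]
    refine Finset.sum_congr rfl fun l hl => ?_
    have hd : delta P X (fun _ : Fin 1 => l) = 1 := by
      rw [delta]
      simpa [specRatio] using hX.integral_specRatio (hb.powerSpectrum_ne_zero l hl)
    have h2 := hb.sigmaSq_pos.ne'
    rw [hb.norm_coeff_sq_mul hl]
    simp only [Function.Embedding.coeFn_mk, Finset.univ_unique, Finset.prod_singleton, hd]
    field_simp
  simp only [e1, e2] at h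
  simpa using h

/-- On the side of the correlations, the diagonal contributes `1` and for even `p` nothing is
negative. -/
lemma one_le_corrPower_of_even (ha : ∀ ξ, a (-ξ) = a ξ) (hX : IsIsotropicField P X)
    (hp : Even p) : 1 ≤ corrPower a P X N p := by
  have hN := hb.pos
  have hN' : (0 : ℝ) < N := by exact_mod_cast hN
  have h := sum_corr_pow hX ha hN p
  simp only [corrPower, tupleWeight]
  rw [← h]
  calc (1 : ℝ) = 1 / N * ∑ k ∈ Finset.Icc 1 N, 1 := by simp; field_simp
    _ ≤ _ := by
      gcongr with k hk
      calc (1 : ℝ) = corr a P X N k k ^ p := by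
            rw [corr_self hX ha hN hb.sigmaSq_pos.ne', one_pow]
        _ ≤ _ := Finset.single_le_sum (f := fun k' => corr a P X N k k' ^ p)
            (fun _ _ => hp.pow_nonneg _) hk

/-- Cubes of correlations may cancel, but in spectral form all terms are nonnegative. The triples
`(l, m, -(l+m))` with `l`, `m` in the good set number at least `κ² N²`, and each has weight at least
`N (q₀ / N)³`. -/
lemma le_corrPower_three (ha : ∀ ξ, a (-ξ) = a ξ) (hq₀ : 0 ≤ q₀) (hκ : 0 ≤ κ) :
    q₀ ^ 3 * κ ^ 2 ≤ corrPower a P X N 3 := by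
  have hN := hb.pos
  have hN' : (0 : ℝ) < N := by exact_mod_cast hN
  obtain ⟨G, hG, hG2⟩ := hb.exists_finset
  have hinj : Function.Injective fun x : ℤ × ℤ => ![x.1, x.2, -(x.1 + x.2)] := fun x y h =>
    Prod.ext (congrFun h 0) (congrFun h 1)
  have hneg : ∀ l, specWeight a P X N (-l) = specWeight a P X N l := by
    intro l
    have : a (4 * ((-l : ℤ) : ℝ) / N) = a (4 * l / N) := by
      push_cast
      rw [mul_neg, neg_div, ha]
    rw [specWeight, IsIsotropicField.powerSpectrum_neg (P := P), this, specWeight]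
  have hsub : (G ×ˢ G).map ⟨_, hinj⟩ ⊆ resonant N 3 := by
    intro t ht
    obtain ⟨⟨l, m⟩, hlm, rfl⟩ := Finset.mem_map.1 ht
    obtain ⟨hl, hm⟩ := Finset.mem_product.1 hlm
    refine Finset.mem_filter.2 ⟨Fintype.mem_piFinset.2 fun i => ?_, ?_⟩
    · fin_cases i
      · exact (hG2 l hl m hm).1
      · exact (hG2 m hm l hl).1
      · exact neg_mem_freqs.2 (hG2 l hl m hm).2.1
    · simp [Fin.sum_univ_three]
  calc q₀ ^ 3 * κ ^ 2 = (κ * N) ^ 2 * (N * (q₀ / N) ^ 3) := by field_simp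
    _ ≤ (G.card : ℝ) ^ 2 * (N * (q₀ / N) ^ 3) := by gcongr
    _ = ∑ _x ∈ G ×ˢ G, N * (q₀ / N) ^ 3 := by simp [sq]
    _ ≤ ∑ x ∈ G ×ˢ G, tupleWeight a P X N ![x.1, x.2, -(x.1 + x.2)] := by
        refine Finset.sum_le_sum fun x hx => ?_
        obtain ⟨hl, hm⟩ := Finset.mem_product.1 hx
        obtain ⟨-, -, h1, h3⟩ := hG2 _ hl _ hm
        have h2 := (hG2 _ hm _ hl).2.2.1
        simp only [tupleWeight, Fin.prod_univ_three, Matrix.cons_val, hneg]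
        rw [pow_three']
        have d1 := div_le_div_of_nonneg_right h1 hN'.le
        have d2 := div_le_div_of_nonneg_right h2 hN'.le
        have d3 := div_le_div_of_nonneg_right h3 hN'.le
        have d0 : 0 ≤ q₀ / N := by positivity
        exact mul_le_mul_of_nonneg_left (mul_le_mul (mul_le_mul d1 d2 d0 (d0.trans d1)) d3 d0
          (mul_nonneg (d0.trans d1) (d0.trans d2))) hN'.le
    _ = ∑ t ∈ (G ×ˢ G).map ⟨_, hinj⟩, tupleWeight a P X N t := by
        rw [Finset.sum_map]
        rfl
    _ ≤ _ := Finset.sum_le_sum_of_subset_of_nonneg hsub fun t _ _ => tupleWeight_nonneg t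

end HasSpectralBounds

end Estimators

/-! ### The quantitative central limit theorem for skewness and kurtosis. -/

section CentralLimit

variable {Ω : Type*} [MeasurableSpace Ω] {P : Measure Ω} [IsProbabilityMeasure P]
  {X : Torus → Ω → ℝ} {a : ℝ → ℝ} {N : ℕ} {Q q₀ κ : ℝ}

lemma betaHat_eq_fieldIntReal (k : ℕ) : betaHat a P X N k = fieldIntReal X fun θ =>
    (√(sigmaSq a P X N))⁻¹ * psi a N (θ - ((k * (2 * π / N) : ℝ) : Torus)) := by
  funext ω
  rw [betaHat, beta_eq_fieldIntReal, fieldIntReal, fieldIntReal, div_eq_inv_mul,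
    ← integral_const_mul]
  simp only [mul_assoc]

lemma continuous_psi_shift (c : ℝ) (k : ℕ) : Continuous fun θ : Torus =>
    c * psi a N (θ - ((k * (2 * π / N) : ℝ) : Torus)) :=
  continuous_const.mul ((continuous_psi a N).comp (continuous_id.sub continuous_const))

variable (hX : IsIsotropicField P X)
include hX

lemma measurable_betaHat (k : ℕ) : Measurable (betaHat a P X N k) := by
  rw [betaHat_eq_fieldIntReal]
  exact hX.measurable_fieldIntReal (continuous_psi_shift _ k)

lemma memLp_betaHat (k : ℕ) : MemLp (betaHat a P X N k) 2 P := by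
  rw [betaHat_eq_fieldIntReal]
  exact hX.memLp_fieldIntReal (continuous_psi_shift _ k)

lemma hasGaussianLaw_betaHat (hB : IsGaussianProcess X P) :
    HasGaussianLaw (fun ω (k : Finset.Icc 1 N) => betaHat a P X N k ω) P := by
  simp_rw [betaHat_eq_fieldIntReal]
  exact hX.hasGaussianLaw_fieldIntReal hB fun k => continuous_psi_shift _ (k : ℕ)

lemma integral_betaHat (k : ℕ) : ∫ ω, betaHat a P X N k ω ∂P = 0 := by
  rw [betaHat_eq_fieldIntReal]
  exact hX.integral_fieldIntReal (continuous_psi_shift _ k)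

/-- The abstract theorem applied to the law of the normalized coefficients. The constant depends
neither on `N` nor on `x`, `y` within the bound `B`, which later allows `N`-dependent
normalizations. -/
lemma HasSpectralBounds.exists_norm_integral_cexp_sub_le (ha : IsWindow a)
    (hB : IsGaussianProcess X P) (hQ : 0 < Q) {B : ℝ} (hB1 : 1 ≤ B) :
    ∃ K : ℝ, ∀ N : ℕ, HasSpectralBounds a P X N Q q₀ κ → ∀ x y : ℝ, |x| ≤ B → |y| ≤ B →
      ‖∫ ω, Complex.exp (Complex.I *
          (x * skewness a P X N ω + y * kurtosis a P X N ω : ℝ)) ∂P -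
        Complex.exp (-((6 * x ^ 2 * corrPower a P X N 3 + y ^ 2 * (72 * corrPower a P X N 2 +
          24 * corrPower a P X N 4) : ℝ) : ℂ) / 2)‖ ≤ √(K / √N) := by
  obtain ⟨K, hK⟩ := exists_norm_charFun_addStat_sub_le hB1 (C₀ := 2 * Q) (by positivity)
  refine ⟨K, fun N hb x y hx hy => ?_⟩
  have hN := hb.pos
  have hN' : (0 : ℝ) < N := by exact_mod_cast hN
  set V : Ω → Finset.Icc 1 N → ℝ := fun ω k => betaHat a P X N k ω with hV
  have hVm : Measurable V := measurable_pi_iff.2 fun k => measurable_betaHat hX k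
  have hVG : HasGaussianLaw V P := hasGaussianLaw_betaHat hX hB
  have : IsGaussian (P.map V) := hVG.isGaussian_map
  have : Nonempty (Finset.Icc 1 N) := ⟨⟨1, Finset.mem_Icc.2 ⟨le_rfl, hN⟩⟩⟩
  have hcard : Fintype.card (Finset.Icc 1 N) = N := by simp
  have hint : ∀ k l : Finset.Icc 1 N, ∫ z, z k * z l ∂(P.map V) = corr a P X N k l := by
    intro k l
    rw [integral_map hVm.aemeasurable (by fun_prop), corr]
  have hmm : ∀ k l : Finset.Icc 1 N,
      Integrable (fun ω => betaHat a P X N k ω * betaHat a P X N l ω) P := fun k l =>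
    (memLp_betaHat hX k).integrable_mul (memLp_betaHat hX l)
  have hsq : ∀ v : Finset.Icc 1 N → ℝ, ∫ z, (∑ k, v k * z k) ^ 2 ∂(P.map V) ≤
      2 * Q * ∑ k, v k ^ 2 := by
    intro v
    refine le_trans (le_of_eq ?_) (integral_sum_betaHat_sq_le hX ha.even hN hb.specWeight_le v)
    have hm : Measurable fun z : Finset.Icc 1 N → ℝ => (∑ k, v k * z k) ^ 2 := by fun_prop
    rw [integral_map hVm.aemeasurable hm.aestronglyMeasurable]
    have e : ∀ ω, (∑ k, v k * V ω k) ^ 2 = ∑ k, ∑ l, v k * v l *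
        (betaHat a P X N k ω * betaHat a P X N l ω) := by
      intro ω
      rw [sq, Finset.sum_mul_sum]
      refine Finset.sum_congr rfl fun k _ => Finset.sum_congr rfl fun l _ => ?_
      simp only [hV]
      ring
    simp_rw [e]
    rw [integral_finsetSum _ fun k _ => integrable_finsetSum _ fun l _ => (hmm k l).const_mul _]
    refine Finset.sum_congr rfl fun k _ => ?_
    rw [integral_finsetSum _ fun l _ => (hmm k l).const_mul _]
    refine Finset.sum_congr rfl fun l _ => ?_
    rw [integral_const_mul, corr]
  have hmean : (P.map V)[id] = 0 := by
    funext k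
    have h1 : Integrable (id : (Finset.Icc 1 N → ℝ) → _) (P.map V) := IsGaussian.integrable_id
    rw [eval_integral fun k => by exact h1.eval k]
    change ∫ z : Finset.Icc 1 N → ℝ, z k ∂(P.map V) = 0
    rw [integral_map hVm.aemeasurable (measurable_pi_apply k).aestronglyMeasurable]
    exact integral_betaHat hX k
  have hd : ∀ p, corrPower a P X N p = 1 / (N : ℝ) * ∑ k : Finset.Icc 1 N, ∑ l : Finset.Icc 1 N,
      corr a P X N k l ^ p := by
    intro p
    simp only [corrPower, tupleWeight]
    rw [← sum_corr_pow hX ha.even hN p, ← Finset.sum_coe_sort (Finset.Icc 1 N)]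
    congr 1
    exact Finset.sum_congr rfl fun k _ =>
      (Finset.sum_coe_sort (Finset.Icc 1 N) fun l => corr a P X N k l ^ p).symm
  have hd0 : ∀ p, 0 ≤ corrPower a P X N p := fun p =>
    Finset.sum_nonneg fun t _ => tupleWeight_nonneg t
  have key := hK (Finset.Icc 1 N) (P.map V) hmean
    (fun k => by rw [hint, corr_self hX ha.even hN hb.sigmaSq_pos.ne']) hsq x y
    (6 * x ^ 2 * corrPower a P X N 3 + y ^ 2 * (72 * corrPower a P X N 2 +
          24 * corrPower a P X N 4)) hx hy
    (by have := hd0 2; have := hd0 3; have := hd0 4; positivity) (by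
      simp_rw [hint, hcard, hd, Finset.sum_add_distrib, mul_add, ← Finset.mul_sum,
        Finset.sum_add_distrib, ← Finset.mul_sum]
      ring)
  have hm : Measurable fun z : Finset.Icc 1 N → ℝ =>
      Complex.exp (Complex.I * addStat (1 / √N) (statPoly x y) z) := by
    have := (continuous_addStat (ι := Finset.Icc 1 N) (1 / √N) (statPoly x y)).measurable
    fun_prop
  rw [hcard, integral_map hVm.aemeasurable hm.aestronglyMeasurable] at key
  have e : (fun ω => Complex.exp (Complex.I *
          (x * skewness a P X N ω + y * kurtosis a P X N ω : ℝ))) =ᵐ[P] fun ω =>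
      Complex.exp (Complex.I * addStat (1 / √N) (statPoly x y) (V ω)) := by
    filter_upwards [ae_sum_beta hX ha.even hN] with ω hω
    congr 3
    have h0 : ∑ k ∈ Finset.Icc 1 N, betaHat a P X N k ω = 0 := by
      simp only [betaHat]
      rw [← Finset.sum_div, hω, zero_div]
    have h1 : addStat (1 / √N) (statPoly x y) (V ω) = 1 / √N * ∑ k ∈ Finset.Icc 1 N,
        (x * (betaHat a P X N k ω ^ 3 - 3 * betaHat a P X N k ω) +
          y * (betaHat a P X N k ω ^ 4 - 3)) := by
      rw [addStat, ← Finset.sum_coe_sort (Finset.Icc 1 N)]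
      simp [statPoly, hV]
    -- The linear part of `H₃` drops out because the coefficients sum to zero over the grid.
    have h2 : ∑ k ∈ Finset.Icc 1 N, (betaHat a P X N k ω ^ 3 - 3 * betaHat a P X N k ω) =
        ∑ k ∈ Finset.Icc 1 N, betaHat a P X N k ω ^ 3 := by
      rw [Finset.sum_sub_distrib, ← Finset.mul_sum, h0, mul_zero, sub_zero]
    rw [h1, skewness, kurtosis, Finset.sum_add_distrib, ← Finset.mul_sum, ← Finset.mul_sum, h2]
    ring
  rw [integral_congr_ae e]
  exact key

end CentralLimit

/-! ### Standardization, Slutsky's theorem and the conclusion. -/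

section Studentized

variable {Ω : Type*} [MeasurableSpace Ω] {P : Measure Ω} [IsProbabilityMeasure P]
  {X : Torus → Ω → ℝ} {a : ℝ → ℝ} {N : ℕ} {Q q₀ κ : ℝ}

/-- The variance of the skewness. -/
noncomputable def skewVar (a : ℝ → ℝ) (P : Measure Ω) (X : Torus → Ω → ℝ) (N : ℕ) : ℝ :=
  6 * corrPower a P X N 3

/-- The variance of the kurtosis. -/
noncomputable def kurtVar (a : ℝ → ℝ) (P : Measure Ω) (X : Torus → Ω → ℝ) (N : ℕ) : ℝ :=
  72 * corrPower a P X N 2 + 24 * corrPower a P X N 4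

section Measurability

variable (hX : IsIsotropicField P X)
include hX

lemma measurable_skewness (N : ℕ) : Measurable (skewness a P X N) :=
  (Finset.measurable_fun_sum _ fun k _ => (measurable_betaHat hX k).pow_const 3).const_mul _

lemma measurable_kurtosis (N : ℕ) : Measurable (kurtosis a P X N) :=
  (Finset.measurable_fun_sum _ fun k _ =>
    ((measurable_betaHat hX k).pow_const 4).sub_const _).const_mul _

lemma measurable_sigmaSqEst (N : ℕ) : Measurable (sigmaSqEst a X N) :=
  (Finset.measurable_fun_sum _ fun l _ =>
    ((hX.measurable_coeff l).norm.pow_const 2).mul_const _).const_mul _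

lemma measurable_fejerSum (p N : ℕ) : Measurable (fejerSum a P X p N) :=
  Finset.measurable_fun_sum _ fun t _ => ((Finset.measurable_fun_prod _ fun i _ =>
    ((hX.measurable_coeff (t i)).norm.pow_const 2).mul_const _).const_mul _).mul_const _

lemma measurable_skewVarEst (N : ℕ) : Measurable (skewVarEst a P X N) := by
  have h1 := measurable_sigmaSqEst (a := a) hX N
  have h2 := measurable_fejerSum (a := a) hX 3 N
  unfold skewVarEst
  fun_prop

lemma measurable_kurtVarEst (N : ℕ) : Measurable (kurtVarEst a P X N) := by
  have h1 := measurable_sigmaSqEst (a := a) hX N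
  have h2 := measurable_fejerSum (a := a) hX 2 N
  have h3 := measurable_fejerSum (a := a) hX 4 N
  unfold kurtVarEst
  fun_prop

end Measurability

lemma measurable_toLp_pair {f g : Ω → ℝ} (hf : Measurable f) (hg : Measurable g) :
    Measurable fun ω => (!₂[f ω, g ω] : EuclideanSpace ℝ (Fin 2)) := by
  refine (WithLp.measurable_toLp 2 (Fin 2 → ℝ)).comp (measurable_pi_iff.2 fun i => ?_)
  fin_cases i
  · exact hf
  · exact hg

variable {Ns : ℕ → ℕ} (hX : IsIsotropicField P X) (ha : IsWindow a) (hB : IsGaussianProcess X P)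
  (hNs : Tendsto Ns atTop atTop) (hb : ∀ n, HasSpectralBounds a P X (Ns n) Q q₀ κ)
include hX ha hB hNs hb

lemma tendstoInMeasure_corrPowerEst_div {p : ℕ} (hp : 2 ≤ p) {b : ℝ} (hb₀ : 0 < b)
    (hb' : ∀ n, b ≤ corrPower a P X (Ns n) p) :
    TendstoInMeasure P (fun n ω => corrPowerEst a P X (Ns n) p ω / corrPower a P X (Ns n) p) atTop
      fun _ => 1 := by
  refine tendstoInMeasure_div_of_integral_sq_le hb₀ hb'
    (fun n => ((hb n).integral_corrPowerEst_sq_le hX hB hp).1) ?_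
    fun n => ((hb n).integral_corrPowerEst_sq_le hX hB hp).2
  exact (tendsto_natCast_atTop_atTop.comp hNs).const_div_atTop _

lemma tendstoInMeasure_sigmaRatio :
    TendstoInMeasure P (fun n ω => sigmaRatio a P X (Ns n) ω) atTop fun _ => 1 := by
  have hr : Tendsto (fun n => 2 * gaussMoment 2 * (6 * Q ^ 2) / (Ns n : ℝ)) atTop (𝓝 0) :=
    Tendsto.const_div_atTop ((tendsto_natCast_atTop_atTop (R := ℝ)).comp hNs) _
  have := tendstoInMeasure_div_of_integral_sq_le (Y := fun n => sigmaRatio a P X (Ns n))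
    (m := fun _ => 1) one_pos (fun _ => le_rfl)
    (fun n => ((hb n).integral_sigmaRatio_sq_le ha.even hX hB).1) hr
    fun n => ((hb n).integral_sigmaRatio_sq_le ha.even hX hB).2
  simpa using this

lemma tendstoInMeasure_corrPowerEst_div_mul {p : ℕ} (hp : 2 ≤ p) {b : ℝ} (hb₀ : 0 < b)
    (hb' : ∀ n, b ≤ corrPower a P X (Ns n) p) :
    TendstoInMeasure P (fun n ω => corrPowerEst a P X (Ns n) p ω / corrPower a P X (Ns n) p /
      sigmaRatio a P X (Ns n) ω ^ p) atTop fun _ => 1 := by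
  have hc : ContinuousAt (fun z : ℝ × ℝ => z.1 / z.2 ^ p) (1, 1) :=
    ContinuousAt.div continuousAt_fst (continuousAt_snd.pow p) (by simp)
  have h := tendstoInMeasure_prodMk
    (tendstoInMeasure_corrPowerEst_div hX ha hB hNs hb hp hb₀ hb')
    (tendstoInMeasure_sigmaRatio hX ha hB hNs hb)
  simpa using tendstoInMeasure_comp_continuousAt h hc

lemma tendstoInMeasure_skewVarEst_div (hq₀ : 0 < q₀) (hκ : 0 < κ) :
    TendstoInMeasure P (fun n ω => skewVarEst a P X (Ns n) ω / skewVar a P X (Ns n)) atTop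
      fun _ => 1 := by
  refine (tendstoInMeasure_corrPowerEst_div_mul hX ha hB hNs hb (p := 3) (by norm_num)
    (b := q₀ ^ 3 * κ ^ 2) (by positivity)
    fun n => (hb n).le_corrPower_three ha.even hq₀.le hκ.le).congr_left
    fun n => ae_of_all _ fun ω => ?_
  simp only [(hb n).skewVarEst_eq, skewVar]
  have : 0 < corrPower a P X (Ns n) 3 := lt_of_lt_of_le (by positivity)
    ((hb n).le_corrPower_three ha.even hq₀.le hκ.le)
  field_simp

lemma tendstoInMeasure_kurtVarEst_div :
    TendstoInMeasure P (fun n ω => kurtVarEst a P X (Ns n) ω / kurtVar a P X (Ns n)) atTop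
      fun _ => 1 := by
  have h2 : ∀ n, 1 ≤ corrPower a P X (Ns n) 2 := fun n =>
    (hb n).one_le_corrPower_of_even ha.even hX even_two
  have h4 : ∀ n, 1 ≤ corrPower a P X (Ns n) 4 := fun n =>
    (hb n).one_le_corrPower_of_even ha.even hX ⟨2, rfl⟩
  refine (tendstoInMeasure_convex_comb
    (tendstoInMeasure_corrPowerEst_div_mul hX ha hB hNs hb (p := 2) le_rfl one_pos h2)
    (tendstoInMeasure_corrPowerEst_div_mul hX ha hB hNs hb (p := 4) (by norm_num) one_pos h4)
    (w := fun n => 72 * corrPower a P X (Ns n) 2 / kurtVar a P X (Ns n)) (fun n => ?_)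
    fun n => ?_).congr_left fun n => ae_of_all _ fun ω => ?_
  · have := h2 n
    have := h4 n
    rw [kurtVar]
    positivity
  · have := h2 n
    have := h4 n
    rw [kurtVar]
    exact div_le_one_of_le₀ (by linarith) (by positivity)
  · have p2 : 0 < corrPower a P X (Ns n) 2 := one_pos.trans_le (h2 n)
    have p4 : 0 < corrPower a P X (Ns n) 4 := one_pos.trans_le (h4 n)
    simp only [(hb n).kurtVarEst_eq, kurtVar]
    have e : 1 - 72 * corrPower a P X (Ns n) 2 / (72 * corrPower a P X (Ns n) 2 +
        24 * corrPower a P X (Ns n) 4) = 24 * corrPower a P X (Ns n) 4 /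
        (72 * corrPower a P X (Ns n) 2 + 24 * corrPower a P X (Ns n) 4) := by
      field_simp
      ring
    rw [e, add_div]
    congr 1 <;> field_simp

omit hX hB hNs in
lemma le_skewVar (hq₀ : 0 < q₀) (hκ : 0 < κ) (n : ℕ) :
    6 * (q₀ ^ 3 * κ ^ 2) ≤ skewVar a P X (Ns n) := by
  have := (hb n).le_corrPower_three ha.even hq₀.le hκ.le
  rw [skewVar]
  linarith

omit hB hNs in
lemma one_le_kurtVar (n : ℕ) : 1 ≤ kurtVar a P X (Ns n) := by
  have h2 := (hb n).one_le_corrPower_of_even ha.even hX even_two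
  have h4 := (hb n).one_le_corrPower_of_even ha.even hX (p := 4) ⟨2, rfl⟩
  rw [kurtVar]
  linarith

/-- Joint asymptotic normality of skewness and kurtosis, standardized by their exact variances. -/
theorem tendstoInDistribution_standardized (hQ : 0 < Q) (hq₀ : 0 < q₀) (hκ : 0 < κ) :
    TendstoInDistribution (fun n ω => (!₂[skewness a P X (Ns n) ω / √(skewVar a P X (Ns n)),
        kurtosis a P X (Ns n) ω / √(kurtVar a P X (Ns n))] : EuclideanSpace ℝ (Fin 2))) atTop
      (id : EuclideanSpace ℝ (Fin 2) → EuclideanSpace ℝ (Fin 2)) (fun _ => P)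
      (multivariateGaussian 0 (1 : Matrix (Fin 2) (Fin 2) ℝ)) := by
  have hm : ∀ n, Measurable fun ω => (!₂[skewness a P X (Ns n) ω / √(skewVar a P X (Ns n)),
      kurtosis a P X (Ns n) ω / √(kurtVar a P X (Ns n))] : EuclideanSpace ℝ (Fin 2)) := fun n =>
    measurable_toLp_pair ((measurable_skewness hX _).div_const _)
      ((measurable_kurtosis hX _).div_const _)
  refine ⟨fun n => (hm n).aemeasurable, aemeasurable_id, ?_⟩
  refine ProbabilityMeasure.tendsto_iff_tendsto_charFun.2 fun t => ?_
  simp only [ProbabilityMeasure.coe_mk, Measure.map_id]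
  rw [multivariateGaussian_zero_one, charFun_stdGaussian]
  set b := 6 * (q₀ ^ 3 * κ ^ 2) with hb_def
  have hb₀ : 0 < b := by positivity
  -- The arguments are `t 0` and `t 1` divided by standard deviations that vary with `n`. The lower
  -- bounds `b` and `1` for the variances keep them in a fixed box, and with these arguments the
  -- exponent is exactly `-‖t‖² / 2`.
  obtain ⟨K, hK⟩ := HasSpectralBounds.exists_norm_integral_cexp_sub_le (q₀ := q₀) (κ := κ) hX ha hB
    hQ (B := 1 + |t 0| / √b + |t 1|) (by
      have : 0 ≤ |t 0| / √b := by positivity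
      have := abs_nonneg (t 1)
      linarith)
  rw [tendsto_iff_norm_sub_tendsto_zero]
  have hlim : Tendsto (fun n => √(K / √(Ns n))) atTop (𝓝 0) := by
    have h1 : Tendsto (fun n => √(Ns n : ℝ)) atTop atTop :=
      Real.tendsto_sqrt_atTop.comp (tendsto_natCast_atTop_atTop.comp hNs)
    have h2 := (Real.continuous_sqrt.tendsto 0).comp (h1.const_div_atTop K)
    simpa [Function.comp_def] using h2
  refine squeeze_zero (fun _ => norm_nonneg _) (fun n => ?_) hlim
  have hS := le_skewVar ha hb hq₀ hκ n
  have hU := one_le_kurtVar hX ha hb n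
  have hS₀ : 0 < skewVar a P X (Ns n) := hb₀.trans_le hS
  have hU₀ : 0 < kurtVar a P X (Ns n) := one_pos.trans_le hU
  have key := hK (Ns n) (hb n) (t 0 / √(skewVar a P X (Ns n))) (t 1 / √(kurtVar a P X (Ns n)))
    (by
      rw [abs_div, abs_of_nonneg (Real.sqrt_nonneg _)]
      have : |t 0| / √(skewVar a P X (Ns n)) ≤ |t 0| / √b := by gcongr
      have := abs_nonneg (t 1)
      linarith)
    (by
      rw [abs_div, abs_of_nonneg (Real.sqrt_nonneg _)]
      have h1 : |t 1| / √(kurtVar a P X (Ns n)) ≤ |t 1| :=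
        div_le_self (abs_nonneg _) (Real.one_le_sqrt.2 hU)
      have : 0 ≤ |t 0| / √b := by positivity
      linarith)
  refine le_trans (le_of_eq ?_) key
  congr 2
  · rw [charFun_apply, integral_map (hm n).aemeasurable (by fun_prop)]
    congr 1
    funext ω
    rw [mul_comm]
    congr 3
    rw [PiLp.inner_apply, Fin.sum_univ_two]
    simp
    ring
  · congr 2
    rw [← Complex.ofReal_pow, ← Complex.ofReal_neg, ← Complex.ofReal_neg]
    congr 2
    rw [EuclideanSpace.norm_sq_eq, Fin.sum_univ_two, div_pow, div_pow, Real.sq_sqrt hS₀.le,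
      Real.sq_sqrt hU₀.le, Real.norm_eq_abs, Real.norm_eq_abs, sq_abs, sq_abs]
    rw [← kurtVar, div_mul_cancel₀ _ hU₀.ne']
    congr 1
    rw [mul_right_comm, ← skewVar, mul_div_cancel₀ _ hS₀.ne']

/-- Joint asymptotic normality of the studentized skewness and kurtosis. -/
theorem tendstoInDistribution_studentized (hQ : 0 < Q) (hq₀ : 0 < q₀) (hκ : 0 < κ) :
    TendstoInDistribution (fun n => studentized a P X (Ns n)) atTop
      (id : EuclideanSpace ℝ (Fin 2) → EuclideanSpace ℝ (Fin 2)) (fun _ => P)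
      (multivariateGaussian 0 (1 : Matrix (Fin 2) (Fin 2) ℝ)) := by
  have hW := tendstoInDistribution_standardized hX ha hB hNs hb hQ hq₀ hκ
  have hcont : ContinuousAt (fun z : ℝ => (√z)⁻¹) 1 :=
    Real.continuous_sqrt.continuousAt.inv₀ (by simp)
  have h1 := tendstoInMeasure_comp_continuousAt
    (tendstoInMeasure_skewVarEst_div hX ha hB hNs hb hq₀ hκ) hcont
  have h2 := tendstoInMeasure_comp_continuousAt
    (tendstoInMeasure_kurtVarEst_div hX ha hB hNs hb) hcont
  simp only [Real.sqrt_one, inv_one] at h1 h2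
  -- Slutsky: the studentized pair is the standardized one multiplied by factors tending to `1` in
  -- probability.
  have hg : Continuous fun z : EuclideanSpace ℝ (Fin 2) × (ℝ × ℝ) =>
      (!₂[z.1 0 * z.2.1, z.1 1 * z.2.2] : EuclideanSpace ℝ (Fin 2)) := by fun_prop
  have h := hW.continuous_comp_prodMk_of_tendstoInMeasure_const hg (tendstoInMeasure_prodMk h1 h2)
    fun n => by
      have m1 := measurable_skewVarEst (a := a) hX (Ns n)
      have m2 := measurable_kurtVarEst (a := a) hX (Ns n)
      exact Measurable.aemeasurable (by fun_prop)
  refine h.congr (fun n => ae_of_all _ fun ω => ?_) (ae_of_all _ fun x => ?_)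
  · have hS₀ : 0 < skewVar a P X (Ns n) :=
      lt_of_lt_of_le (by positivity) (le_skewVar ha hb hq₀ hκ n)
    have hU₀ : 0 < kurtVar a P X (Ns n) := one_pos.trans_le (one_le_kurtVar hX ha hb n)
    have s1 : √(skewVar a P X (Ns n)) ≠ 0 := (Real.sqrt_pos.2 hS₀).ne'
    have s2 : √(kurtVar a P X (Ns n)) ≠ 0 := (Real.sqrt_pos.2 hU₀).ne'
    simp only [studentized]
    rw [Real.sqrt_div' _ hS₀.le, Real.sqrt_div' _ hU₀.le, inv_div, inv_div]
    ext i
    fin_cases i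
    · simp
      rw [div_mul_div_cancel₀ s1]
    · simp
      rw [div_mul_div_cancel₀ s2]
  · ext i
    fin_cases i <;> simp

end Studentized

end Needlet

theorem mainTheorem2 {Ω : Type*} [MeasurableSpace Ω] (P : Measure Ω) [IsProbabilityMeasure P]
    (a : ℝ → ℝ) (ha : Needlet.IsWindow a)
    (X : Needlet.Torus → Ω → ℝ) (hX : Needlet.IsIsotropicField P X)
    (hA1 : Needlet.PowerLawSpectrum P X) (hB : IsGaussianProcess X P) :
    TendstoInDistribution (fun (j : ℕ) => Needlet.studentized a P X (2 ^ (j + 2))) atTop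
      (id : EuclideanSpace ℝ (Fin 2) → EuclideanSpace ℝ (Fin 2)) (fun _ => P)
      (multivariateGaussian 0 (1 : Matrix (Fin 2) (Fin 2) ℝ)) := by
  obtain ⟨Q, q₀, κ, hQ, hq₀, hκ, hev⟩ := Needlet.exists_hasSpectralBounds (P := P) (X := X) ha hA1
  have hpow : Tendsto (fun j : ℕ => 2 ^ (j + 2)) atTop (atTop : Filter ℕ) :=
    (tendsto_pow_atTop_atTop_of_one_lt one_lt_two).comp (tendsto_add_atTop_nat 2)
  obtain ⟨j₀, hj₀⟩ := eventually_atTop.1 (hpow.eventually hev)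
  -- The spectral bounds hold only for large `N`, so the sequence is shifted by `j₀`; convergence is
  -- unaffected, and measurability of the initial terms is supplied separately.
  have h := Needlet.tendstoInDistribution_studentized (Ns := fun j => 2 ^ (j + j₀ + 2)) hX ha hB
    (hpow.comp (tendsto_add_atTop_nat j₀)) (fun j => hj₀ (j + j₀) (Nat.le_add_left _ _)) hQ hq₀ hκ
  have hm : ∀ j : ℕ, AEMeasurable (Needlet.studentized a P X (2 ^ (j + 2))) P := fun j =>
    (Needlet.measurable_toLp_pair
      ((Needlet.measurable_skewness hX _).div (Needlet.measurable_skewVarEst hX _).sqrt)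
      ((Needlet.measurable_kurtosis hX _).div (Needlet.measurable_kurtVarEst hX _).sqrt)).aemeasurable
  exact ⟨hm, h.aemeasurable_limit, (tendsto_add_atTop_iff_nat j₀).1 h.tendsto⟩
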